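/- **Setting.** Let $\mathbf B^*\in\mathbb R^{d_r\times d_c}$ be nonzero, of rank $\mathfrak r$, with least nonzero singular value $D_{\mathfrak r\mathfrak r}$. Write $\|\mathbf B\|_{\infty,2}$ for the largest Euclidean norm of a row of $\mathbf B$. Assume $\|\mathbf B^*\|_{\infty,2}\le b^*$ and put $\mu^*=\sqrt{d_r/\mathfrak r}\,\|\mathbf B^*\|_{\infty,2}/D_{\mathfrak r\mathfrak r}$. Playing arm $(j_t,k_t)$ at time $t=1,2,\dots$ yields $y_t=\mathbf B^*_{j_tk_t}+\epsilon_t$, with $\epsilon_t$ independent and 1-subgaussian. Put $\Delta_{jk}=\max\mathbf B^*-\mathbf B^*_{jk}$ and let $g(h)$ be the number of arms with $\Delta_{jk}\le h$. For constants $\alpha_2,\alpha_4,\alpha_5>0$ let $$\gamma(h)=\sqrt{\tfrac{d_r}{\mathfrak r}}\,\frac{h}{64\mu^*},\qquad \rho(h)=2\alpha_2\bigl(1+\gamma(h)^{-2}\bigr)\mathfrak r(d_r+d_c),\qquad h_{low}(T)=\max\Bigl\{64\mu^*\sqrt{\tfrac{2\alpha_4\mathfrak r}{Td_r}},\ \tfrac{2\alpha_5}{T}\Bigr\}.$$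 **Estimator.** Let $\bar{\mathbf B}$ be a matrix estimator which, from $n\ge2$ independent observations at uniformly random arms, satisfies $\mathbb P(\|\bar{\mathbf B}-\mathbf B^*\|_F\ge\delta)\le\exp\bigl(-\alpha_1\delta^2n/((d_r+d_c)\mathfrak r)\bigr)$ for every $\delta>0$ with $n/\log n\ge\alpha_2(1+\delta^{-2})\mathfrak r(d_r+d_c)$, where $\alpha_1,\alpha_2>0$. The row-enhanced estimator $\widehat{\mathbf B}$ of a sample is obtained as follows: apply $\bar{\mathbf B}$ to the first half of the sample, let $\mathbf V_{\mathfrak r}$ consist of the first $\mathfrak r$ right singular vectors of the result, and let row $j$ of $\widehat{\mathbf B}$ be $(\mathbf V_{\mathfrak r}\hat\vartheta_j)^\top$, where $\hat\vartheta_j$ is a least-squares fit of $\mathbf V_{\mathfrak r}\vartheta$ to the observations of row $j$ in the second half. **Algorithm (Low-Rank Bandit with filtering resolution $h$).** With $\rho=\rho(h)$, at time $t$ each arm is independently (of the other times and of the noise) forced with probability $\frac1{d_rd_c}$ if $t\le2\rho\log\rho$, and with probability $\frac{\rho}{d_rd_c[t-\rho\log\rho+1]}$ otherwise (at most one arm is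 forced at a time). A forced arm is played. If no arm is forced, let $\widehat{\mathbf B}^F$ be the row-enhanced estimator of the forced samples before $t$, let $\mathcal C$ be the set of arms with $\widehat{\mathbf B}^F_{jk}\ge\max\widehat{\mathbf B}^F-\frac h2$, and play an arm of $\mathcal C$ that maximizes $\bar x_{(j,k)}+\sqrt{2\log t/n_{(j,k)}}$, where $\bar x_{(j,k)}$ and $n_{(j,k)}$ are the average and the number of all earlier observations of arm $(j,k)$ (the index is $+\infty$ if there are none). Let $\mathrm{Regret}_T(h)=\sum_{t=1}^T\mathbb E[\Delta_{j_tk_t}]$. **Theorem (gap-independent bound).** There is a universal constant $C_1>0$, and there are constants $\alpha_3,\alpha_4,\alpha_5>0$ that depend only on $(d_r,d_c,\mathfrak r,\mu^*,\alpha_1)$, such that the following holds in this setting for every $T\ge1$ and every $h\ge h_{low}(T)$ with $$\rho(h)\ge\max\bigl\{32,\ 32d_r\alpha_3^{-1},\ \alpha_4\gamma(h)^{-2},\ \alpha_5h^{-1}\bigr\}:$$ $$\mathrm{Regret}_T(h)\le C_1\Bigl[\alpha_2b^*\Bigl(1+\frac1{\gamma(h)^2}\Bigr)\mathfrak r(d_r+d_c)\log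 T\Bigr]+4\sqrt{2T\,g(h)\log T}+100b^*+C_2,\qquad C_2=\Bigl(1+\frac{\pi^2}3\Bigr)\sum_{j,k}\Delta_{jk}.$$ -/

import Mathlib

open MeasureTheory ProbabilityTheory

noncomputable section

namespace LowRankBandit

/-! ### Arms and reward matrices -/

/-- Two-sided arms: a row and a column. -/
abbrev Arm (dr dc : ℕ) : Type := Fin dr × Fin dc

/-- The discrete σ-algebra on the outcomes `some arm` / `none` of the forced-sampling rule. -/
instance instMeasurableSpaceOptionArm (dr dc : ℕ) : MeasurableSpace (Option (Arm dr dc)) := ⊤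

variable {dr dc : ℕ}

/-- The largest Euclidean norm of a row. -/
def rowNorm (B : Matrix (Fin dr) (Fin dc) ℝ) : ℝ :=
  ⨆ j, √(∑ k, B j k ^ 2)

/-- The Frobenius norm. -/
def frobNorm (B : Matrix (Fin dr) (Fin dc) ℝ) : ℝ :=
  √(∑ j, ∑ k, B j k ^ 2)

/-- The smallest nonzero singular value, i.e. the one with (one-based) index `rank B`
(Mathlib numbers the singular values from zero, in decreasing order). -/
def leastSingularValue (B : Matrix (Fin dr) (Fin dc) ℝ) : ℝ :=
  B.toEuclideanLin.singularValues (B.rank - 1)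

/-- The row-incoherence parameter `μ(B)`. -/
def rowIncoherence (B : Matrix (Fin dr) (Fin dc) ℝ) : ℝ :=
  √((dr : ℝ) / (B.rank : ℝ)) * (rowNorm B / leastSingularValue B)

/-- The largest entry. -/
def maxEntry (B : Matrix (Fin dr) (Fin dc) ℝ) : ℝ :=
  ⨆ a : Arm dr dc, B a.1 a.2

/-- The suboptimality gap `Δ_a` of an arm. -/
def armGap (B : Matrix (Fin dr) (Fin dc) ℝ) (a : Arm dr dc) : ℝ :=
  maxEntry B - B a.1 a.2

/-- The near-optimal function `g(h)`: the number of arms at most `h` worse than the best one. -/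
def nearOptimalCount (B : Matrix (Fin dr) (Fin dc) ℝ) (h : ℝ) : ℕ :=
  {a : Arm dr dc | maxEntry B - h ≤ B a.1 a.2}.ncard

/-! ### Parameters -/

/-- `γ(h)`, for row dimension `dr`, rank `r` and row-incoherence `μ`. -/
def gammaRes (dr r : ℕ) (μ h : ℝ) : ℝ :=
  √((dr : ℝ) / (r : ℝ)) * (h / (64 * μ))

/-- The forced-sampling parameter `ρ(h)`. -/
def rhoParam (dr dc r : ℕ) (μ α₂ h : ℝ) : ℝ :=
  2 * α₂ * (1 + (gammaRes dr r μ h ^ 2)⁻¹) * r * (dr + dc)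

/-- The smallest admissible filtering resolution for the horizon `T`. -/
def hLow (dr r : ℕ) (μ α₄ α₅ : ℝ) (T : ℕ) : ℝ :=
  max (64 * μ * √(2 * α₄ * r / (T * dr))) (2 * α₅ / T)

/-- The lower bound that the forced-sampling parameter has to satisfy for the forced-sample
estimator to reach the resolution `h`. -/
def rhoMin (dr r : ℕ) (μ α₃ α₄ α₅ h : ℝ) : ℝ :=
  max (max 32 (32 * dr / α₃)) (max (α₄ / gammaRes dr r μ h ^ 2) (α₅ / h))

/-! ### The low-rank estimator and its row enhancement -/

/-- A sample of `n` observations: the arms that were played and the rewards. -/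
abbrev Sample (dr dc n : ℕ) : Type := Fin n → Arm dr dc × ℝ

/-- A matrix estimator: it turns a sample of any size into a matrix. -/
abbrev Estimator (dr dc : ℕ) : Type :=
  (n : ℕ) → Sample dr dc n → Matrix (Fin dr) (Fin dc) ℝ

/-- The estimator is a Borel function of the sample. -/
def Estimator.IsMeasurable (E : Estimator dr dc) : Prop :=
  ∀ n j k, Measurable fun D : Sample dr dc n => E n D j k

/-- The law of one observation whose arm is uniform and whose noise is independent of the arm
with law `ν`. -/
def obsLaw (B : Matrix (Fin dr) (Fin dc) ℝ) (ν : Measure ℝ) : Measure (Arm dr dc × ℝ) :=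
  ((uniformOn (Set.univ : Set (Arm dr dc))).prod ν).map
    fun p => (p.1, B p.1.1 p.1.2 + p.2)

/-- The tail bound for a low-rank estimator of `B`, of rank `r`, with constants `α₁`, `α₂`:
the `n` observations are independent, at uniformly random arms, and carry the noise of the time
periods `τ 0 < τ 1 < ⋯`, with laws `ν (τ i)`. When the noise is identically distributed these are
just `n` i.i.d. observations. -/
def TailBound (B : Matrix (Fin dr) (Fin dc) ℝ) (r : ℕ) (α₁ α₂ : ℝ) (Bbar : Estimator dr dc)
    (ν : ℕ → Measure ℝ) : Prop :=
  ∀ (n : ℕ) (τ : Fin n → ℕ) (δ : ℝ), 2 ≤ n → StrictMono τ → (∀ i, 1 ≤ τ i) → 0 < δ →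
    α₂ * (1 + (δ ^ 2)⁻¹) * r * (dr + dc) ≤ (n : ℝ) / Real.log n →
    (Measure.pi fun i => obsLaw B (ν (τ i)))
        {D : Sample dr dc n | δ ≤ frobNorm (Bbar n D - B)}
      ≤ ENNReal.ofReal (Real.exp (-(α₁ * δ ^ 2 * n / ((dr + dc) * r))))

/-- `A = U D Vᵀ` is a singular value decomposition, with the singular values `s 0 ≥ s 1 ≥ ⋯ ≥ 0`
on the diagonal of `D`. -/
def IsSVD (A : Matrix (Fin dr) (Fin dc) ℝ) (U : Matrix (Fin dr) (Fin dr) ℝ) (s : ℕ → ℝ)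
    (V : Matrix (Fin dc) (Fin dc) ℝ) : Prop :=
  U ∈ Matrix.orthogonalGroup (Fin dr) ℝ ∧ V ∈ Matrix.orthogonalGroup (Fin dc) ℝ ∧
    Antitone s ∧ (∀ i, 0 ≤ s i) ∧
    A = U * (Matrix.of fun (i : Fin dr) (j : Fin dc) => if (i : ℕ) = (j : ℕ) then s i else 0) *
      V.transpose

/-- The matrix of the first `r` columns. -/
def firstCols (V : Matrix (Fin dc) (Fin dc) ℝ) (r : ℕ) (hr : r ≤ dc) :
    Matrix (Fin dc) (Fin r) ℝ :=
  V.submatrix id (Fin.castLE hr)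

/-- The first half of a sample. -/
def firstHalf {n : ℕ} (D : Sample dr dc n) : Sample dr dc (n / 2) :=
  fun i => D (Fin.castLE (Nat.div_le_self n 2) i)

/-- The squared error of the vector `v` of column values, on the observations of the second half
of the sample that lie in row `j`. -/
def rowLoss {n : ℕ} (D : Sample dr dc n) (j : Fin dr) (v : Fin dc → ℝ) : ℝ :=
  ∑ i : Fin n, if n / 2 ≤ (i : ℕ) ∧ (D i).1.1 = j then ((D i).2 - v (D i).1.2) ^ 2 else 0

/-- `M` is an output of the row-enhancement procedure, with rank `r` and low-rank estimator `Bbar`,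
on the sample `D`. The singular value decomposition and the least-squares minimizers need not be
unique; any choice is allowed. -/
def IsRowEnhancement (r : ℕ) (Bbar : Estimator dr dc) {n : ℕ} (D : Sample dr dc n)
    (M : Matrix (Fin dr) (Fin dc) ℝ) : Prop :=
  ∃ (hr : r ≤ dc) (U : Matrix (Fin dr) (Fin dr) ℝ) (s : ℕ → ℝ) (V : Matrix (Fin dc) (Fin dc) ℝ),
    IsSVD (Bbar (n / 2) (firstHalf D)) U s V ∧
    ∀ j, ∃ θ : Fin r → ℝ,
      (∀ θ' : Fin r → ℝ,
        rowLoss D j ((firstCols V r hr).mulVec θ) ≤ rowLoss D j ((firstCols V r hr).mulVec θ')) ∧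
      M j = (firstCols V r hr).mulVec θ

/-! ### The random environment -/

/-- The probability that the forced-sampling rule with parameter `ρ` picks a given arm at
time `t`. -/
def forcedProb (dr dc : ℕ) (ρ : ℝ) (t : ℕ) : ℝ :=
  if (t : ℝ) ≤ 2 * ρ * Real.log ρ then 1 / (dr * dc)
  else ρ / (dr * dc * (t - ρ * Real.log ρ + 1))

/-- The forced-sampling rule `f` (with `f t = none` when no arm is forced at time `t`) and the
noise `ε`: `f t` has the prescribed law, `ε t` is 1-subgaussian, and all of the variables `f t`,
`ε t` are independent. Time starts at `t = 1`. -/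
structure Environment {Ω : Type*} [MeasurableSpace Ω] (P : Measure Ω) (ρ : ℝ)
    (f : ℕ → Ω → Option (Arm dr dc)) (ε : ℕ → Ω → ℝ) : Prop where
  measurable_forced : ∀ t, Measurable (f t)
  measurable_noise : ∀ t, Measurable (ε t)
  forced_law : ∀ t, 1 ≤ t → ∀ a : Arm dr dc,
    P {ω | f t ω = some a} = ENNReal.ofReal (forcedProb dr dc ρ t)
  subgaussian : ∀ t, HasSubgaussianMGF (ε t) 1 P
  indep_time : iIndepFun (fun t ω => (f t ω, ε t ω)) P
  indep_forced_noise : ∀ t, IndepFun (f t) (ε t) P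

/-! ### The Low-Rank Bandit algorithm -/

section Algorithm

variable {Ω : Type*} (B : Matrix (Fin dr) (Fin dc) ℝ) (f : ℕ → Ω → Option (Arm dr dc))
  (ε : ℕ → Ω → ℝ) (π : ℕ → Ω → Arm dr dc)

/-- The reward at time `t` when the arms `π` are played. -/
def reward (t : ℕ) (ω : Ω) : ℝ :=
  B (π t ω).1 (π t ω).2 + ε t ω

/-- The forced-sampling periods before time `t`. -/
def forcedTimes (t : ℕ) (ω : Ω) : Finset ℕ :=
  {s ∈ Finset.Ico 1 t | (f s ω).isSome}

/-- The observations of the forced-sampling periods before time `t`, in order of time. -/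
def forcedSample (t : ℕ) (ω : Ω) : Sample dr dc (forcedTimes f t ω).card :=
  fun i =>
    (π ((forcedTimes f t ω).orderEmbOfFin rfl i) ω,
      reward B ε π ((forcedTimes f t ω).orderEmbOfFin rfl i) ω)

/-- The forced-sample estimate that is available at time `t`. -/
def forcedEstimate (Bhat : Estimator dr dc) (t : ℕ) (ω : Ω) : Matrix (Fin dr) (Fin dc) ℝ :=
  Bhat _ (forcedSample B f ε π t ω)

/-- The targeted set at time `t`. -/
def targetSet (Bhat : Estimator dr dc) (h : ℝ) (t : ℕ) (ω : Ω) : Set (Arm dr dc) :=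
  {a | maxEntry (forcedEstimate B f ε π Bhat t ω) - h / 2
    ≤ forcedEstimate B f ε π Bhat t ω a.1 a.2}

/-- The periods before time `t` in which arm `a` was played. -/
def playTimes (a : Arm dr dc) (t : ℕ) (ω : Ω) : Finset ℕ :=
  {s ∈ Finset.Ico 1 t | π s ω = a}

/-- The upper confidence index of an arm at time `t`: the average of all its observations before
time `t` plus the exploration bonus `√(2 log t / n)`; it is infinite for an arm that was not
played yet. -/
def ucbIndex (t : ℕ) (a : Arm dr dc) (ω : Ω) : EReal :=
  if (playTimes π a t ω).card = 0 then ⊤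
  else (((∑ s ∈ playTimes π a t ω, reward B ε π s ω) / ((playTimes π a t ω).card : ℝ)
    + √(2 * Real.log t / ((playTimes π a t ω).card : ℝ)) : ℝ) : EReal)

/-- What is known when the arm of time `t` is chosen: the forced-sampling rule up to time `t` and
the noise before time `t`. -/
@[reducible] def history (t : ℕ) : MeasurableSpace Ω :=
  (⨆ s ∈ Set.Icc 1 t, MeasurableSpace.comap (f s) inferInstance) ⊔
    ⨆ s ∈ Set.Ico 1 t, MeasurableSpace.comap (ε s) inferInstance

/-- The arms `π 1, π 2, …` are those played by the Low-Rank Bandit algorithm with filtering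
resolution `h` and forced-sample estimator `Bhat`. Ties in the maximization are broken in any way
that does not look into the future. -/
structure IsLowRankBandit (Bhat : Estimator dr dc) (h : ℝ) : Prop where
  adapted : ∀ t, 1 ≤ t → Measurable[history f ε t] (π t)
  forced : ∀ t, 1 ≤ t → ∀ ω a, f t ω = some a → π t ω = a
  targeted : ∀ t, 1 ≤ t → ∀ ω, f t ω = none →
    π t ω ∈ targetSet B f ε π Bhat h t ω ∧
    ∀ a ∈ targetSet B f ε π Bhat h t ω,
      ucbIndex B ε π t a ω ≤ ucbIndex B ε π t (π t ω) ω

/-- The cumulative expected regret up to time `T`. -/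
def regret [MeasurableSpace Ω] (P : Measure Ω) (T : ℕ) : ℝ :=
  ∑ t ∈ Finset.Icc 1 T, ∫ ω, armGap B (π t ω) ∂P

end Algorithm

end LowRankBandit

end

/-!
Write `K = dr * dc` and `ρ = ρ(h)`, and note that every gap is at most `2 b*`. The first term of
the bound is `C₁ b* (ρ / 2) log T`; the constants `α₃`, `α₄` are chosen so that the lower bound on
`ρ` gives `ρ ≥ 16 K² + exp K`, `α₁ γ² ρ ≥ 16 (dr + dc) r` and `ρ h² ≥ 131072 K dc`. Horizons
`T < ρ` are then trivial, so let `T ≥ ρ`; in particular `K ≤ log T`. The regret is split into four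
parts.

* The initialization `t ≤ 2 ρ log ρ` costs at most `4 b* ρ log ρ`.
* A later period `t` is a forced-sampling period with probability at most `2 ρ / t`.
* In a later period, the forced-sample estimate misses the accuracy `h / 4` with probability
  `O(K / t²)`. Given the set of forced-sampling periods before `t`, the forced observations are
  independent, at uniformly random arms (`Environment.measure_forcedTimes_inter_sample`), and by
  Chernoff's bound there are more than `ρ log t / 2` of them outside an event of probability
  `1 / t²`. On such a sample the tail bound controls the low-rank estimator, and Hoeffding's
  inequality controls the numbers of observations and the noise averages of the arms. The
  deterministic part is `IsRowEnhancement.abs_sub_le`: by Weyl's inequality the first `r` right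
  singular vectors of the estimate almost contain the rows of `B`, and least squares with nearly
  equal weights loses only a constant factor.
* In the remaining periods the targeted set holds a best arm `b` and only arms with gaps at most
  `h`, and the confidence bounds take over. A union bound over the number of plays of an arm at
  each time would be too weak for the bonus `√(2 log t / n)`: it leaves an error probability of
  order `1` per period. Two devices replace it. Overestimation of an arm is indexed by its number
  `n` of plays instead of by time: for each pair of arm and `n ≤ T` the event `overestimated` has
  probability at most `1 / T` and costs at most one period, which adds up to one gap per arm.
  Underestimation of `b` is not treated as an event; its size is bounded in expectation by
  `1 / √t` (`Environment.lintegral_shortfall_le`). The sum `2 √T` of these is absorbed in the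
  square-root term, since the best arm counts towards `g(h)` but costs nothing, and `g(h) ≤ K ≤
  log T` (`sqrt_add_le_of_lt`).

Both devices rest on one exponential supermartingale, the product of `exp (l ε - l² / 2)` over
periods that are selected without looking into the future
(`Environment.lintegral_exp_logProcess_le`).
-/

open MeasureTheory ProbabilityTheory

noncomputable section

namespace LowRankBandit

/-! ### Singular values -/

section Singular

open Module InnerProductSpace

variable {E F : Type*} [NormedAddCommGroup E] [InnerProductSpace ℝ E] [FiniteDimensional ℝ E]
  [NormedAddCommGroup F] [InnerProductSpace ℝ F] [FiniteDimensional ℝ F]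

/-- A linear map expands every vector orthogonal to its kernel by at least its least nonzero
singular value. -/
theorem leastSingularValue_mul_norm_le (T : E →ₗ[ℝ] F) {w : E} (hw : w ∈ (LinearMap.ker T)ᗮ) :
    T.singularValues (finrank ℝ (LinearMap.range T) - 1) * ‖w‖ ≤ ‖T w‖ := by
  set σ := T.singularValues (finrank ℝ (LinearMap.range T) - 1)
  have hσ : 0 ≤ σ := T.singularValues_nonneg _
  let b := T.isSymmetric_adjoint_comp_self.eigenvectorBasis rfl
  have hb : ∀ i, (LinearMap.adjoint T ∘ₗ T) (b i) = (T.singularValues i ^ 2) • b i := fun i => by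
    rw [T.sq_singularValues_fin rfl]
    exact T.isSymmetric_adjoint_comp_self.apply_eigenvectorBasis rfl i
  have hTw : ‖T w‖ ^ 2 =
      ∑ i : Fin (finrank ℝ E), T.singularValues i ^ 2 * (inner ℝ (b i) w) ^ 2 := by
    rw [← real_inner_self_eq_norm_sq, ← LinearMap.adjoint_inner_right,
      ← b.sum_inner_mul_inner]
    refine Finset.sum_congr rfl fun i _ => ?_
    have : inner ℝ (b i) (LinearMap.adjoint T (T w)) =
        T.singularValues i ^ 2 * inner ℝ (b i) w := by
      rw [LinearMap.adjoint_inner_right, ← LinearMap.adjoint_inner_left]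
      have := hb i
      rw [LinearMap.comp_apply] at this
      rw [this, inner_smul_left]
      simp
    rw [this, real_inner_comm w (b i)]
    ring
  have hw2 : ‖w‖ ^ 2 = ∑ i, (inner ℝ (b i) w) ^ 2 := by
    rw [← real_inner_self_eq_norm_sq, ← b.sum_inner_mul_inner]
    exact Finset.sum_congr rfl fun i _ => by rw [real_inner_comm w (b i)]; ring
  refine le_of_sq_le_sq ?_ (norm_nonneg _)
  rw [mul_pow, hTw, hw2, Finset.mul_sum]
  refine Finset.sum_le_sum fun i _ => ?_
  rcases (T.singularValues_nonneg i).eq_or_lt with h0 | h0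
  · have hker : b i ∈ LinearMap.ker T := by
      have h1 := hb i
      rw [← h0] at h1
      have : ‖T (b i)‖ ^ 2 = 0 := by
        rw [← real_inner_self_eq_norm_sq, ← LinearMap.adjoint_inner_right]
        rw [LinearMap.comp_apply] at h1
        rw [h1]; simp
      simpa using this
    rw [(Submodule.mem_orthogonal _ _).1 hw _ hker]
    simp
  · have hi := T.singularValues_pos_iff_lt_finrank_range.1 h0
    have : σ ≤ T.singularValues i := T.singularValues_antitone (by omega)
    gcongr

/-- Every vector in the range of the adjoint is the image of a vector whose norm is controlled by
the least nonzero singular value. -/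
theorem exists_adjoint_eq_and_norm_le (T : E →ₗ[ℝ] F) (e : F) :
    ∃ u, LinearMap.adjoint T u = LinearMap.adjoint T e ∧
      T.singularValues (finrank ℝ (LinearMap.range T) - 1) * ‖u‖ ≤ ‖LinearMap.adjoint T e‖ := by
  set σ := T.singularValues (finrank ℝ (LinearMap.range T) - 1)
  have hσ : 0 ≤ σ := T.singularValues_nonneg _
  obtain ⟨u, hu, v, hv, rfl⟩ := (LinearMap.range T).exists_add_mem_mem_orthogonal e
  obtain ⟨w₀, rfl⟩ := hu
  obtain ⟨x, hx, w, hw, rfl⟩ := (LinearMap.ker T).exists_add_mem_mem_orthogonal w₀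
  have hTx : T (x + w) = T w := by rw [map_add, LinearMap.mem_ker.1 hx, zero_add]
  rw [hTx]
  have hv0 : LinearMap.adjoint T v = 0 := by
    refine ext_inner_left ℝ fun y => ?_
    rw [LinearMap.adjoint_inner_right, inner_zero_right]
    exact (Submodule.mem_orthogonal _ _).1 hv _ (LinearMap.mem_range_self T y)
  refine ⟨T w, by rw [map_add, hv0, add_zero], ?_⟩
  rw [map_add, hv0, add_zero]
  have h1 := leastSingularValue_mul_norm_le T hw
  have h2 : ‖T w‖ ^ 2 ≤ ‖w‖ * ‖LinearMap.adjoint T (T w)‖ := by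
    rw [← real_inner_self_eq_norm_sq, ← LinearMap.adjoint_inner_right]
    exact real_inner_le_norm _ _
  rcases (norm_nonneg (T w)).eq_or_lt with h0 | h0
  · rw [← h0]; simp
  · refine le_of_mul_le_mul_right ?_ h0
    calc σ * ‖T w‖ * ‖T w‖ = σ * ‖T w‖ ^ 2 := by ring
      _ ≤ σ * (‖w‖ * ‖LinearMap.adjoint T (T w)‖) := by gcongr
      _ = (σ * ‖w‖) * ‖LinearMap.adjoint T (T w)‖ := by ring
      _ ≤ ‖T w‖ * ‖LinearMap.adjoint T (T w)‖ := by gcongr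
      _ = _ := by ring

end Singular

variable {dr dc : ℕ}

section Matrices

open Matrix

theorem finrank_range_toEuclideanLin (B : Matrix (Fin dr) (Fin dc) ℝ) :
    Module.finrank ℝ (LinearMap.range B.toEuclideanLin) = B.rank := by
  rw [Matrix.rank_eq_finrank_range_toLin B (PiLp.basisFun 2 ℝ (Fin dr))
    (PiLp.basisFun 2 ℝ (Fin dc))]
  rfl

theorem rank_ne_zero {B : Matrix (Fin dr) (Fin dc) ℝ} (hB : B ≠ 0) : B.rank ≠ 0 := by
  rwa [← finrank_range_toEuclideanLin, Ne, Submodule.finrank_eq_zero, LinearMap.range_eq_bot,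
    LinearEquiv.map_eq_zero_iff]

theorem leastSingularValue_pos {B : Matrix (Fin dr) (Fin dc) ℝ} (hB : B ≠ 0) :
    0 < leastSingularValue B := by
  rw [leastSingularValue, LinearMap.singularValues_pos_iff_lt_finrank_range,
    finrank_range_toEuclideanLin]
  have := rank_ne_zero hB
  omega

/-- Each row of `B` is `Bᵀ u` for some `u` of norm at most `‖row‖ / D`, where `D` is the least
nonzero singular value. -/
theorem exists_transpose_mulVec_eq_row (B : Matrix (Fin dr) (Fin dc) ℝ) (j : Fin dr) :
    ∃ u : Fin dr → ℝ, Bᵀ *ᵥ u = B j ∧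
      leastSingularValue B ^ 2 * (u ⬝ᵥ u) ≤ B j ⬝ᵥ B j := by
  obtain ⟨u, hu, hn⟩ := exists_adjoint_eq_and_norm_le B.toEuclideanLin
    (WithLp.toLp 2 (Pi.single j 1))
  have hadj : LinearMap.adjoint B.toEuclideanLin = Bᵀ.toEuclideanLin := by
    rw [← Matrix.toEuclideanLin_conjTranspose_eq_adjoint,
      Matrix.conjTranspose_eq_transpose_of_trivial]
  rw [hadj] at hu hn
  have hrow : Bᵀ.toEuclideanLin (WithLp.toLp 2 (Pi.single j 1)) = WithLp.toLp 2 (B j) := by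
    rw [Matrix.toLpLin_toLp]
    simp
    rfl
  rw [hrow] at hu hn
  refine ⟨u.ofLp, ?_, ?_⟩
  · have := congrArg WithLp.ofLp hu
    simpa [Matrix.ofLp_toLpLin] using this
  · rw [finrank_range_toEuclideanLin] at hn
    have h2 := pow_le_pow_left₀
      (mul_nonneg (LinearMap.singularValues_nonneg _ _) (norm_nonneg _)) hn 2
    rw [mul_pow, EuclideanSpace.real_norm_sq_eq, EuclideanSpace.real_norm_sq_eq] at h2
    simpa [leastSingularValue, dotProduct, sq] using h2

/-! ### Singular value decompositions and Weyl's inequality -/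

theorem frobNorm_sq (M : Matrix (Fin dr) (Fin dc) ℝ) : frobNorm M ^ 2 = ∑ j, ∑ k, M j k ^ 2 :=
  Real.sq_sqrt (by positivity)

theorem mulVec_dotProduct_self_le (M : Matrix (Fin dr) (Fin dc) ℝ) (x : Fin dc → ℝ) :
    (M *ᵥ x) ⬝ᵥ (M *ᵥ x) ≤ frobNorm M ^ 2 * (x ⬝ᵥ x) := by
  rw [frobNorm_sq, Finset.sum_mul, dotProduct]
  refine Finset.sum_le_sum fun j _ => ?_
  have := Finset.sum_mul_sq_le_sq_mul_sq Finset.univ (M j) x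
  simpa [mulVec, dotProduct, sq] using this

theorem orthogonal_mulVec_dotProduct_self {n : ℕ} {U : Matrix (Fin n) (Fin n) ℝ}
    (hU : U ∈ Matrix.orthogonalGroup (Fin n) ℝ) (x : Fin n → ℝ) :
    (U *ᵥ x) ⬝ᵥ (U *ᵥ x) = x ⬝ᵥ x := by
  rw [dotProduct_mulVec, vecMul_mulVec, ← dotProduct_mulVec]
  have : Uᵀ * U = 1 := (Matrix.mem_orthogonalGroup_iff' (Fin n) ℝ).1 hU
  rw [this, one_mulVec]

/-- The diagonal factor of a singular value decomposition. -/
def diagPart (dr dc : ℕ) (s : ℕ → ℝ) : Matrix (Fin dr) (Fin dc) ℝ :=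
  Matrix.of fun (i : Fin dr) (j : Fin dc) => if (i : ℕ) = (j : ℕ) then s i else 0

theorem diagPart_mulVec_dotProduct_self (s : ℕ → ℝ) (c : Fin dc → ℝ) :
    (diagPart dr dc s *ᵥ c) ⬝ᵥ (diagPart dr dc s *ᵥ c) =
      ∑ j : Fin dc, if (j : ℕ) < dr then (s j * c j) ^ 2 else 0 := by
  have h1 : ∀ i : Fin dr, (diagPart dr dc s *ᵥ c) i * (diagPart dr dc s *ᵥ c) i =
      ∑ j : Fin dc, if (i : ℕ) = (j : ℕ) then (s j * c j) ^ 2 else 0 := by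
    intro i
    have h2 : (diagPart dr dc s *ᵥ c) i =
        ∑ j : Fin dc, if (i : ℕ) = (j : ℕ) then s j * c j else 0 := by
      simp only [diagPart, mulVec, dotProduct, Matrix.of_apply, ite_mul, zero_mul]
      refine Finset.sum_congr rfl fun j _ => ?_
      split_ifs with h
      · rw [h]
      · rfl
    rw [h2]
    by_cases hi : (i : ℕ) < dc
    · have : ∀ j : Fin dc, ((i : ℕ) = (j : ℕ)) = (⟨i, hi⟩ = j) := fun j => by simp [Fin.ext_iff]
      simp only [this, Finset.sum_ite_eq, Finset.mem_univ, if_true]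
      ring
    · have : ∀ j : Fin dc, ((i : ℕ) = (j : ℕ)) = False := fun j => by
        have := j.2
        simp only [eq_iff_iff, iff_false]
        omega
      simp [this]
  rw [dotProduct, Finset.sum_congr rfl fun i _ => h1 i, Finset.sum_comm]
  refine Finset.sum_congr rfl fun j _ => ?_
  split_ifs with h
  · have : ∀ i : Fin dr, ((i : ℕ) = (j : ℕ)) = (i = ⟨j, h⟩) := fun i => by simp [Fin.ext_iff]
    simp [this]
  · refine Finset.sum_eq_zero fun i _ => if_neg ?_
    have := i.2
    omega

theorem IsSVD.mulVec_dotProduct_self {A : Matrix (Fin dr) (Fin dc) ℝ}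
    {U : Matrix (Fin dr) (Fin dr) ℝ} {s : ℕ → ℝ} {V : Matrix (Fin dc) (Fin dc) ℝ}
    (h : IsSVD A U s V) (c : Fin dc → ℝ) :
    (A *ᵥ (V *ᵥ c)) ⬝ᵥ (A *ᵥ (V *ᵥ c)) =
      ∑ j : Fin dc, if (j : ℕ) < dr then (s j * c j) ^ 2 else 0 := by
  obtain ⟨hU, hV, -, -, hA⟩ := h
  have hVV : Vᵀ * V = 1 := (Matrix.mem_orthogonalGroup_iff' (Fin dc) ℝ).1 hV
  have : A *ᵥ (V *ᵥ c) = U *ᵥ (diagPart dr dc s *ᵥ c) := by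
    rw [hA, mulVec_mulVec, Matrix.mul_assoc, hVV, Matrix.mul_one, ← mulVec_mulVec]
    rfl
  rw [this, orthogonal_mulVec_dotProduct_self hU, diagPart_mulVec_dotProduct_self]

/-- **Weyl's inequality** for the first singular value beyond the rank of `B`: it is at most the
distance to `B`. A vector in the span of the first `r + 1` right singular vectors of `A` that `B`
annihilates, which exists by counting dimensions, is the witness. -/
theorem IsSVD.singularValue_rank_le {A B : Matrix (Fin dr) (Fin dc) ℝ}
    {U : Matrix (Fin dr) (Fin dr) ℝ} {s : ℕ → ℝ} {V : Matrix (Fin dc) (Fin dc) ℝ}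
    (h : IsSVD A U s V) (hr : B.rank < dr) (hc : B.rank < dc) :
    s B.rank ≤ frobNorm (A - B) := by
  set r := B.rank
  have hc' : r + 1 ≤ dc := hc
  let W : Matrix (Fin dc) (Fin (r + 1)) ℝ :=
    (1 : Matrix (Fin dc) (Fin dc) ℝ).submatrix id (Fin.castLE hc')
  have hW : ∀ (x : Fin (r + 1) → ℝ) (j : Fin dc),
      (W *ᵥ x) j = if hj : (j : ℕ) < r + 1 then x ⟨j, hj⟩ else 0 := by
    intro x j
    simp only [W, mulVec, dotProduct, submatrix_apply, id, Matrix.one_apply, ite_mul, one_mul,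
      zero_mul]
    split_ifs with hj
    · rw [Finset.sum_eq_single ⟨j, hj⟩]
      · simp
      · intro b _ hb
        rw [if_neg]
        intro hjb
        exact hb (by simp [hjb])
      · simp
    · refine Finset.sum_eq_zero fun i _ => if_neg ?_
      intro hji
      have := i.2
      rw [hji] at hj
      simp at hj
      omega
  obtain ⟨x, hx, hx0⟩ : ∃ x : Fin (r + 1) → ℝ, x ≠ 0 ∧ B *ᵥ (V *ᵥ (W *ᵥ x)) = 0 := by
    have hker : LinearMap.ker (B * (V * W)).mulVecLin ≠ ⊥ := by
      intro hbot
      have h1 := LinearMap.finrank_range_add_finrank_ker (B * (V * W)).mulVecLin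
      rw [hbot, finrank_bot, add_zero, Module.finrank_fin_fun] at h1
      have h2 : (B * (V * W)).rank ≤ r := Matrix.rank_mul_le_left _ _
      rw [Matrix.rank] at h2
      omega
    obtain ⟨x, hx, hx0⟩ := (Submodule.ne_bot_iff _).1 hker
    refine ⟨x, hx0, ?_⟩
    rw [LinearMap.mem_ker, mulVecLin_apply] at hx
    rw [← hx]
    simp only [mulVec_mulVec]
  set c := W *ᵥ x with hc_def
  have hcc : 0 < c ⬝ᵥ c := by
    obtain ⟨i, hi⟩ := Function.ne_iff.1 hx
    refine Finset.sum_pos' (fun j _ => mul_self_nonneg _) ⟨Fin.castLE hc' i, Finset.mem_univ _, ?_⟩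
    rw [hc_def, hW]
    have : ((Fin.castLE hc' i : Fin dc) : ℕ) < r + 1 := i.2
    rw [dif_pos this]
    exact mul_self_pos.2 hi
  have h1 := h.mulVec_dotProduct_self c
  obtain ⟨hU, hV, hs, hs0, hA⟩ := h
  have h2 : s r ^ 2 * (c ⬝ᵥ c) ≤ (A *ᵥ (V *ᵥ c)) ⬝ᵥ (A *ᵥ (V *ᵥ c)) := by
    rw [h1, dotProduct, Finset.mul_sum]
    refine Finset.sum_le_sum fun j _ => ?_
    by_cases hj : (j : ℕ) < r + 1
    · rw [if_pos (by omega), mul_pow, ← sq]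
      have h3 : s r ≤ s j := hs (by omega)
      have := hs0 r
      gcongr
    · have : c j = 0 := by rw [hc_def, hW, dif_neg hj]
      simp [this]
  have h3 : A *ᵥ (V *ᵥ c) = (A - B) *ᵥ (V *ᵥ c) := by rw [sub_mulVec, hx0, sub_zero]
  have h4 := mulVec_dotProduct_self_le (A - B) (V *ᵥ c)
  rw [orthogonal_mulVec_dotProduct_self hV, ← h3] at h4
  exact le_of_sq_le_sq (le_of_mul_le_mul_right (h2.trans h4) hcc) (Real.sqrt_nonneg _)

/-- The part of a row of `B` that is orthogonal to the first `r = rank B` right singular vectors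
of an approximation `A` of `B` (the coordinates of the row in the basis `V` are `Vᵀ (B j)`) is
small, in proportion to the row itself. -/
theorem IsSVD.row_tail_le {A B : Matrix (Fin dr) (Fin dc) ℝ} (hB : B ≠ 0)
    {U : Matrix (Fin dr) (Fin dr) ℝ} {s : ℕ → ℝ} {V : Matrix (Fin dc) (Fin dc) ℝ}
    (h : IsSVD A U s V) (j : Fin dr) :
    ∑ i : Fin dc, (if (i : ℕ) < B.rank then 0 else (Vᵀ *ᵥ B j) i) ^ 2 ≤
      (2 * frobNorm (A - B) / leastSingularValue B) ^ 2 * (B j ⬝ᵥ B j) := by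
  set F := frobNorm (A - B)
  set D := leastSingularValue B
  have hD : 0 < D := leastSingularValue_pos hB
  have hF : 0 ≤ F := Real.sqrt_nonneg _
  set c : Fin dc → ℝ := Vᵀ *ᵥ B j
  set c' : Fin dc → ℝ := fun i => if (i : ℕ) < B.rank then 0 else c i with hc'
  have hV := h.2.1
  obtain ⟨u, hu, hun⟩ := exists_transpose_mulVec_eq_row B j
  have hsum : ∑ i : Fin dc, (if (i : ℕ) < B.rank then 0 else c i) ^ 2 = c' ⬝ᵥ c' :=
    Finset.sum_congr rfl fun i _ => sq _
  rw [hsum]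
  -- the squared length of the tail is `⟪B (V c'), u⟫`
  have h1 : c' ⬝ᵥ c' = (B *ᵥ (V *ᵥ c')) ⬝ᵥ u := by
    have h2 : c' ⬝ᵥ c' = c' ⬝ᵥ c := by
      refine Finset.sum_congr rfl fun i _ => ?_
      simp only [hc']
      split_ifs <;> simp
    rw [h2]
    simp only [c]
    rw [dotProduct_mulVec, vecMul_transpose, ← hu, dotProduct_mulVec, vecMul_transpose]
  have hA : (A *ᵥ (V *ᵥ c')) ⬝ᵥ (A *ᵥ (V *ᵥ c')) ≤ F ^ 2 * (c' ⬝ᵥ c') := by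
    rw [h.mulVec_dotProduct_self, dotProduct, Finset.mul_sum]
    refine Finset.sum_le_sum fun i _ => ?_
    by_cases hi : (i : ℕ) < B.rank
    · simp [hc', hi]
    · by_cases hi' : (i : ℕ) < dr
      · rw [if_pos hi', mul_pow, ← sq]
        have h3 : s i ≤ F := (h.2.2.1 (by omega)).trans
          (h.singularValue_rank_le (B := B) (by omega) (by omega))
        have := h.2.2.2.1 i
        gcongr
      · rw [if_neg hi']
        exact mul_nonneg (sq_nonneg _) (mul_self_nonneg _)
  have hAB : ((A - B) *ᵥ (V *ᵥ c')) ⬝ᵥ ((A - B) *ᵥ (V *ᵥ c')) ≤ F ^ 2 * (c' ⬝ᵥ c') := by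
    have := mulVec_dotProduct_self_le (A - B) (V *ᵥ c')
    rwa [orthogonal_mulVec_dotProduct_self hV] at this
  have hBn : (B *ᵥ (V *ᵥ c')) ⬝ᵥ (B *ᵥ (V *ᵥ c')) ≤ (2 * F) ^ 2 * (c' ⬝ᵥ c') := by
    set a := A *ᵥ (V *ᵥ c')
    set b := (A - B) *ᵥ (V *ᵥ c') with hb
    have hBv : B *ᵥ (V *ᵥ c') = a - b := by rw [hb, sub_mulVec]; simp [a]
    have : (a - b) ⬝ᵥ (a - b) ≤ 2 * (a ⬝ᵥ a) + 2 * (b ⬝ᵥ b) := by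
      simp only [dotProduct, Finset.mul_sum, ← Finset.sum_add_distrib]
      refine Finset.sum_le_sum fun i _ => ?_
      simp only [Pi.sub_apply]
      nlinarith [sq_nonneg (a i + b i)]
    rw [hBv]
    linarith
  have hcs : (c' ⬝ᵥ c') ^ 2 ≤ ((B *ᵥ (V *ᵥ c')) ⬝ᵥ (B *ᵥ (V *ᵥ c'))) * (u ⬝ᵥ u) := by
    rw [h1]
    have := Finset.sum_mul_sq_le_sq_mul_sq Finset.univ (B *ᵥ (V *ᵥ c')) u
    simpa [dotProduct, sq] using this
  have hc0 : 0 ≤ c' ⬝ᵥ c' := Finset.sum_nonneg fun i _ => mul_self_nonneg _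
  have hu0 : 0 ≤ u ⬝ᵥ u := Finset.sum_nonneg fun i _ => mul_self_nonneg _
  rcases hc0.eq_or_lt with h0 | h0
  · rw [← h0]
    exact mul_nonneg (sq_nonneg _) (Finset.sum_nonneg fun i _ => mul_self_nonneg _)
  · have h5 : c' ⬝ᵥ c' ≤ (2 * F) ^ 2 * (u ⬝ᵥ u) := by
      refine le_of_mul_le_mul_right ?_ h0
      calc c' ⬝ᵥ c' * (c' ⬝ᵥ c') = (c' ⬝ᵥ c') ^ 2 := by ring
        _ ≤ _ := hcs
        _ ≤ ((2 * F) ^ 2 * (c' ⬝ᵥ c')) * (u ⬝ᵥ u) := by gcongr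
        _ = _ := by ring
    have h6 : u ⬝ᵥ u ≤ (B j ⬝ᵥ B j) / D ^ 2 := by
      rw [le_div_iff₀ (by positivity)]
      linarith
    calc c' ⬝ᵥ c' ≤ (2 * F) ^ 2 * (u ⬝ᵥ u) := h5
      _ ≤ (2 * F) ^ 2 * ((B j ⬝ᵥ B j) / D ^ 2) := by gcongr
      _ = _ := by rw [div_pow]; ring

/-! ### Accuracy of the row enhancement -/

theorem rowNorm_nonneg (B : Matrix (Fin dr) (Fin dc) ℝ) : 0 ≤ rowNorm B :=
  Real.iSup_nonneg fun _ => Real.sqrt_nonneg _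

theorem row_dotProduct_self_le (B : Matrix (Fin dr) (Fin dc) ℝ) (j : Fin dr) :
    B j ⬝ᵥ B j ≤ rowNorm B ^ 2 := by
  have h : √(∑ k, B j k ^ 2) ≤ rowNorm B :=
    le_ciSup (f := fun j => √(∑ k, B j k ^ 2)) (Set.finite_range _).bddAbove j
  have h2 := Real.sqrt_le_left (rowNorm_nonneg B) |>.1 h
  simpa [dotProduct, sq] using h2

theorem abs_entry_le_rowNorm (B : Matrix (Fin dr) (Fin dc) ℝ) (j : Fin dr) (k : Fin dc) :
    |B j k| ≤ rowNorm B := by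
  refine abs_le_of_sq_le_sq ?_ (rowNorm_nonneg B)
  refine le_trans ?_ (row_dotProduct_self_le B j)
  rw [sq]
  exact Finset.single_le_sum (f := fun k => B j k * B j k) (fun i _ => mul_self_nonneg _)
    (Finset.mem_univ k)

theorem rowNorm_pos {B : Matrix (Fin dr) (Fin dc) ℝ} (hB : B ≠ 0) : 0 < rowNorm B := by
  refine (rowNorm_nonneg B).lt_of_ne fun h => hB ?_
  ext j k
  have := abs_entry_le_rowNorm B j k
  rw [← h] at this
  simpa using this

/-- The indices of the observations of arm `a` in the second half of a sample. -/
def secondHalfTimes {n : ℕ} (D : Sample dr dc n) (a : Arm dr dc) : Finset (Fin n) :=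
  {i | n / 2 ≤ (i : ℕ) ∧ (D i).1 = a}

theorem sum_secondHalf_row {n : ℕ} (D : Sample dr dc n) (j : Fin dr) (φ : Fin n → Fin dc → ℝ) :
    (∑ i : Fin n, if n / 2 ≤ (i : ℕ) ∧ (D i).1.1 = j then φ i (D i).1.2 else 0) =
      ∑ k, ∑ i ∈ secondHalfTimes D (j, k), φ i k := by
  simp only [secondHalfTimes, Finset.sum_filter]
  rw [Finset.sum_comm]
  refine Finset.sum_congr rfl fun i _ => ?_
  by_cases h : n / 2 ≤ (i : ℕ) ∧ (D i).1.1 = j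
  · rw [if_pos h, Finset.sum_eq_single (D i).1.2]
    · rw [if_pos ⟨h.1, Prod.ext h.2 rfl⟩]
    · intro k _ hk
      rw [if_neg]
      rintro ⟨-, h2⟩
      exact hk (by rw [h2])
    · simp
  · rw [if_neg h, Finset.sum_eq_zero]
    intro k _
    rw [if_neg]
    rintro ⟨h1, h2⟩
    exact h ⟨h1, by rw [h2]⟩

theorem firstCols_mulVec {V : Matrix (Fin dc) (Fin dc) ℝ} {r : ℕ} (hr : r ≤ dc)
    (c : Fin dc → ℝ) :
    firstCols V r hr *ᵥ (fun i => c (Fin.castLE hr i)) =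
      V *ᵥ (fun i => if (i : ℕ) < r then c i else 0) := by
  ext k
  simp only [mulVec, dotProduct, firstCols, submatrix_apply, id, mul_ite, mul_zero]
  rw [← Finset.sum_filter]
  refine Finset.sum_bij (fun i _ => Fin.castLE hr i) (fun i _ => by simp) (fun i _ i' _ h => ?_)
    (fun b hb => ⟨⟨b, (Finset.mem_filter.1 hb).2⟩, Finset.mem_univ _, rfl⟩) (fun _ _ => rfl)
  exact Fin.castLE_injective hr h

/-- A least-squares fit `v` of a row, compared with the reference vector `p`: the weighted error
of the fit is controlled by that of the reference. The weights are the numbers of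
observations. -/
theorem sum_card_mul_sq_le_of_rowLoss_le {n : ℕ} {D : Sample dr dc n} {j : Fin dr}
    {β p v e : Fin dc → ℝ} (hle : rowLoss D j v ≤ rowLoss D j p)
    (he : ∀ k, ∑ i ∈ secondHalfTimes D (j, k), ((D i).2 - β k) =
      (secondHalfTimes D (j, k)).card * e k) :
    ∑ k, ((secondHalfTimes D (j, k)).card : ℝ) * (v k - p k) ^ 2 ≤
      4 * ∑ k, ((secondHalfTimes D (j, k)).card : ℝ) * (β k - p k + e k) ^ 2 := by
  have hexp : rowLoss D j v - rowLoss D j p =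
      ∑ k, ((secondHalfTimes D (j, k)).card : ℝ) *
        ((v k - p k) ^ 2 - 2 * (v k - p k) * (β k - p k + e k)) := by
    have h1 : ∀ w : Fin dc → ℝ, rowLoss D j w =
        ∑ k, ∑ i ∈ secondHalfTimes D (j, k), ((D i).2 - w k) ^ 2 := fun w =>
      sum_secondHalf_row D j fun i k => ((D i).2 - w k) ^ 2
    rw [h1, h1, ← Finset.sum_sub_distrib]
    refine Finset.sum_congr rfl fun k _ => ?_
    rw [← Finset.sum_sub_distrib]
    have h2 : ∀ i ∈ secondHalfTimes D (j, k), ((D i).2 - v k) ^ 2 - ((D i).2 - p k) ^ 2 =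
        ((v k - p k) ^ 2 - 2 * (v k - p k) * (β k - p k)) +
          (-2 * (v k - p k)) * ((D i).2 - β k) := fun i _ => by ring
    rw [Finset.sum_congr rfl h2, Finset.sum_add_distrib, ← Finset.mul_sum, he, Finset.sum_const,
      nsmul_eq_mul]
    ring
  have h3 : ∑ k, ((secondHalfTimes D (j, k)).card : ℝ) *
      ((v k - p k) ^ 2 / 2 - 2 * (β k - p k + e k) ^ 2) ≤ 0 := by
    refine le_trans (Finset.sum_le_sum fun k _ => ?_) (hexp.symm.trans_le (sub_nonpos.2 hle))
    refine mul_le_mul_of_nonneg_left ?_ (Nat.cast_nonneg _)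
    nlinarith [sq_nonneg ((v k - p k) - 2 * (β k - p k + e k))]
  have h4 : ∑ k, ((secondHalfTimes D (j, k)).card : ℝ) *
      ((v k - p k) ^ 2 / 2 - 2 * (β k - p k + e k) ^ 2) =
      (∑ k, ((secondHalfTimes D (j, k)).card : ℝ) * (v k - p k) ^ 2) / 2 -
      2 * ∑ k, ((secondHalfTimes D (j, k)).card : ℝ) * (β k - p k + e k) ^ 2 := by
    rw [Finset.sum_div, Finset.mul_sum, ← Finset.sum_sub_distrib]
    exact Finset.sum_congr rfl fun k _ => by ring
  linarith

/-- The row-enhanced estimator is accurate to `h / 4` as soon as the low-rank estimator of the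
first half is close to `B`, the arms are observed about equally often in the second half, and the
noise averages of the second half are small. -/
theorem IsRowEnhancement.abs_sub_le {B : Matrix (Fin dr) (Fin dc) ℝ} (hB : B ≠ 0)
    {Bbar : Estimator dr dc} {n : ℕ} {D : Sample dr dc n} {M : Matrix (Fin dr) (Fin dc) ℝ}
    (hM : IsRowEnhancement B.rank Bbar D M) {h m : ℝ} (hh : 0 < h) (hm : 0 < m)
    (hF : frobNorm (Bbar (n / 2) (firstHalf D) - B) ≤
      h * leastSingularValue B / (64 * rowNorm B))
    (hcount : ∀ a, m / 2 ≤ ((secondHalfTimes D a).card : ℝ) ∧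
      ((secondHalfTimes D a).card : ℝ) ≤ 3 * m / 2)
    (hnoise : ∀ a : Arm dr dc, |∑ i ∈ secondHalfTimes D a, ((D i).2 - B a.1 a.2)| ≤
      (secondHalfTimes D a).card * (h / (64 * √dc))) (j : Fin dr) (k : Fin dc) :
    |M j k - B j k| ≤ h / 4 := by
  obtain ⟨hr, U, s, V, hsvd, hθ⟩ := hM
  obtain ⟨θ, hmin, hMj⟩ := hθ j
  set N : Fin dc → ℝ := fun k => ((secondHalfTimes D (j, k)).card : ℝ) with hN
  have hNpos : ∀ k, 0 < N k := fun k => by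
    have := (hcount (j, k)).1
    simp only [hN]
    linarith
  have hdc : (0 : ℝ) < dc := by
    have := k.pos
    exact_mod_cast this
  have hD := leastSingularValue_pos hB
  have hR := rowNorm_pos hB
  set β := B j with hβ
  set c := Vᵀ *ᵥ β with hc
  set p := firstCols V B.rank hr *ᵥ (fun i => c (Fin.castLE hr i)) with hp
  set v := firstCols V B.rank hr *ᵥ θ with hv
  set e : Fin dc → ℝ := fun k => (∑ i ∈ secondHalfTimes D (j, k), ((D i).2 - β k)) / N k with he
  have heN : ∀ k, ∑ i ∈ secondHalfTimes D (j, k), ((D i).2 - β k) = N k * e k := fun k => by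
    rw [he]
    field_simp [(hNpos k).ne']
  have hebound : ∀ k, e k ^ 2 ≤ h ^ 2 / (4096 * dc) := fun k => by
    have h1 : |e k| ≤ h / (64 * √dc) := by
      rw [he]
      simp only
      rw [abs_div, abs_of_pos (hNpos k), div_le_iff₀ (hNpos k), mul_comm]
      exact hnoise (j, k)
    calc e k ^ 2 = |e k| ^ 2 := (sq_abs _).symm
      _ ≤ (h / (64 * √dc)) ^ 2 := by gcongr
      _ = h ^ 2 / (4096 * dc) := by
        rw [div_pow, mul_pow, Real.sq_sqrt hdc.le]
        norm_num
  -- the approximation error of the first right singular vectors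
  have hVV : V * Vᵀ = 1 := (Matrix.mem_orthogonalGroup_iff (Fin dc) ℝ).1 hsvd.2.1
  have hbias : (β - p) ⬝ᵥ (β - p) ≤ (h / 32) ^ 2 := by
    have h1 : β - p = V *ᵥ (fun i => if (i : ℕ) < B.rank then 0 else c i) := by
      rw [hp, firstCols_mulVec]
      have h2 : β = V *ᵥ c := by rw [hc, mulVec_mulVec, hVV, one_mulVec]
      rw [h2, ← mulVec_sub]
      congr 1
      ext i
      simp only [Pi.sub_apply]
      split_ifs <;> simp
    rw [h1, orthogonal_mulVec_dotProduct_self hsvd.2.1]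
    have h3 := hsvd.row_tail_le hB j
    have h4 : 2 * frobNorm (Bbar (n / 2) (firstHalf D) - B) / leastSingularValue B ≤
        h / (32 * rowNorm B) := by
      rw [div_le_iff₀ hD]
      calc _ ≤ 2 * (h * leastSingularValue B / (64 * rowNorm B)) := by gcongr
        _ = _ := by field_simp; norm_num
    have h0 : 0 ≤ 2 * frobNorm (Bbar (n / 2) (firstHalf D) - B) / leastSingularValue B :=
      div_nonneg (mul_nonneg two_pos.le (Real.sqrt_nonneg _)) hD.le
    calc _ = ∑ i : Fin dc, (if (i : ℕ) < B.rank then 0 else c i) ^ 2 :=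
          Finset.sum_congr rfl fun i _ => (sq _).symm
      _ ≤ _ := h3
      _ ≤ (h / (32 * rowNorm B)) ^ 2 * rowNorm B ^ 2 := by
        exact mul_le_mul (pow_le_pow_left₀ h0 h4 2) (row_dotProduct_self_le B j)
          (Finset.sum_nonneg fun i _ => mul_self_nonneg _) (sq_nonneg _)
      _ = (h / 32) ^ 2 := by field_simp
  have hLS := sum_card_mul_sq_le_of_rowLoss_le (hmin fun i => c (Fin.castLE hr i)) heN
  -- the weights lie within a factor of three of each other
  have hvp : ∑ k, (v k - p k) ^ 2 ≤ 12 * ∑ k, (β k - p k + e k) ^ 2 := by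
    have h1 : m / 2 * ∑ k, (v k - p k) ^ 2 ≤ ∑ k, N k * (v k - p k) ^ 2 := by
      rw [Finset.mul_sum]
      exact Finset.sum_le_sum fun k _ =>
        mul_le_mul_of_nonneg_right (hcount (j, k)).1 (sq_nonneg _)
    have h2 : ∑ k, N k * (β k - p k + e k) ^ 2 ≤ 3 * m / 2 * ∑ k, (β k - p k + e k) ^ 2 := by
      rw [Finset.mul_sum]
      exact Finset.sum_le_sum fun k _ =>
        mul_le_mul_of_nonneg_right (hcount (j, k)).2 (sq_nonneg _)
    have h3 : m / 2 * ∑ k, (v k - p k) ^ 2 ≤ m / 2 * (12 * ∑ k, (β k - p k + e k) ^ 2) := by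
      have := h1.trans (hLS.trans (mul_le_mul_of_nonneg_left h2 (by norm_num)))
      linarith
    exact le_of_mul_le_mul_left h3 (by positivity)
  have hw : ∑ k, (β k - p k + e k) ^ 2 ≤ h ^ 2 * (5 / 2048) := by
    have h1 : ∑ k, (β k - p k + e k) ^ 2 ≤
        2 * ((β - p) ⬝ᵥ (β - p)) + 2 * ∑ k, e k ^ 2 := by
      simp only [dotProduct, Finset.mul_sum, ← Finset.sum_add_distrib]
      refine Finset.sum_le_sum fun k _ => ?_
      simp only [Pi.sub_apply]
      nlinarith [sq_nonneg (β k - p k - e k)]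
    have h2 : ∑ k, e k ^ 2 ≤ h ^ 2 / 4096 := by
      calc ∑ k, e k ^ 2 ≤ ∑ _k : Fin dc, h ^ 2 / (4096 * dc) :=
            Finset.sum_le_sum fun k _ => hebound k
        _ = h ^ 2 / 4096 := by
          rw [Finset.sum_const, Finset.card_univ, Fintype.card_fin, nsmul_eq_mul]
          field_simp
    nlinarith
  have hvk : |v k - p k| ≤ h * (11 / 64) := by
    refine abs_le_of_sq_le_sq ?_ (by positivity)
    have := Finset.single_le_sum (f := fun k => (v k - p k) ^ 2) (fun i _ => sq_nonneg _)
      (Finset.mem_univ k)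
    nlinarith [sq_nonneg h]
  have hbk : |β k - p k| ≤ h / 32 := by
    refine abs_le_of_sq_le_sq (le_trans ?_ hbias) (by positivity)
    rw [sq]
    exact Finset.single_le_sum (f := fun k => (β - p) k * (β - p) k)
      (fun i _ => mul_self_nonneg _) (Finset.mem_univ k)
  rw [hMj]
  have : v k - β k = (v k - p k) - (β k - p k) := by ring
  rw [this]
  have := abs_sub (v k - p k) (β k - p k)
  linarith

end Matrices

open scoped ENNReal

/-! ### Exponential bounds -/

theorem lintegral_exp_subgaussian_le {Ω : Type*} [MeasurableSpace Ω] {P : Measure Ω} {X : Ω → ℝ}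
    (hX : HasSubgaussianMGF X 1 P) (l : ℝ) :
    ∫⁻ ω, ENNReal.ofReal (Real.exp (l * X ω - l ^ 2 / 2)) ∂P ≤ 1 := by
  have h1 : ∀ ω, Real.exp (l * X ω - l ^ 2 / 2) = Real.exp (l * X ω) * Real.exp (-(l ^ 2 / 2)) :=
    fun ω => by rw [← Real.exp_add]; rfl
  simp only [h1]
  rw [← ofReal_integral_eq_lintegral_ofReal ((hX.integrable_exp_mul l).mul_const _)
    (ae_of_all _ fun ω => by positivity), integral_mul_const, ENNReal.ofReal_le_one]
  have h2 := hX.mgf_le l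
  rw [mgf] at h2
  calc _ ≤ Real.exp (((1 : NNReal) : ℝ) * l ^ 2 / 2) * Real.exp (-(l ^ 2 / 2)) := by gcongr
    _ = 1 := by rw [← Real.exp_add]; simp

/-- **Chernoff's bound** for a variable whose exponential has mean at most one. -/
theorem measure_le_exp_neg_of_lintegral_exp_le_one {Ω : Type*} [MeasurableSpace Ω] {P : Measure Ω}
    {Z : Ω → ℝ} (hZ : Measurable Z) (h : ∫⁻ ω, ENNReal.ofReal (Real.exp (Z ω)) ∂P ≤ 1) (x : ℝ) :
    P {ω | x ≤ Z ω} ≤ ENNReal.ofReal (Real.exp (-x)) := by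
  calc P {ω | x ≤ Z ω} ≤
        P {ω | ENNReal.ofReal (Real.exp x) ≤ ENNReal.ofReal (Real.exp (Z ω))} :=
        measure_mono fun ω hω => ENNReal.ofReal_le_ofReal (Real.exp_le_exp.2 hω)
    _ ≤ (∫⁻ ω, ENNReal.ofReal (Real.exp (Z ω)) ∂P) / ENNReal.ofReal (Real.exp x) :=
        meas_ge_le_lintegral_div (by fun_prop) (by simpa using Real.exp_pos _)
          ENNReal.ofReal_ne_top
    _ ≤ 1 / ENNReal.ofReal (Real.exp x) := by gcongr
    _ = _ := by rw [Real.exp_neg, ENNReal.ofReal_inv_of_pos (Real.exp_pos _), one_div]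

/-! ### Samples at uniformly random arms -/

theorem measurable_observe (B : Matrix (Fin dr) (Fin dc) ℝ) :
    Measurable fun p : Arm dr dc × ℝ => (p.1, B p.1.1 p.1.2 + p.2) :=
  measurable_fst.prodMk
    (((measurable_of_finite fun a : Arm dr dc => B a.1 a.2).comp measurable_fst).add measurable_snd)

theorem isProbabilityMeasure_obsLaw [Nonempty (Arm dr dc)] (B : Matrix (Fin dr) (Fin dc) ℝ)
    (ν : Measure ℝ) [IsProbabilityMeasure ν] : IsProbabilityMeasure (obsLaw B ν) := by
  have : IsProbabilityMeasure (uniformOn (Set.univ : Set (Arm dr dc))) :=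
    isProbabilityMeasure_uniformOn Set.finite_univ Set.univ_nonempty
  exact Measure.isProbabilityMeasure_map (measurable_observe B).aemeasurable

theorem uniformOn_univ_singleton (a : Arm dr dc) :
    uniformOn (Set.univ : Set (Arm dr dc)) {a} = ENNReal.ofReal (1 / (dr * dc)) := by
  have : Nonempty (Arm dr dc) := ⟨a⟩
  rw [uniformOn_univ, Measure.count_singleton, Fintype.card_prod, Fintype.card_fin,
    Fintype.card_fin, ENNReal.ofReal_div_of_pos (by
      have := a.1.pos
      have := a.2.pos
      positivity), ENNReal.ofReal_one]
  rw [← Nat.cast_mul (α := ℝ), ENNReal.ofReal_natCast]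

theorem obsLaw_fst [Nonempty (Arm dr dc)] (B : Matrix (Fin dr) (Fin dc) ℝ) (ν : Measure ℝ)
    [IsProbabilityMeasure ν] (a : Arm dr dc) :
    obsLaw B ν {p | p.1 = a} = ENNReal.ofReal (1 / (dr * dc)) := by
  have hset : MeasurableSet {p : Arm dr dc × ℝ | p.1 = a} :=
    measurable_fst (measurableSet_singleton a)
  rw [obsLaw, Measure.map_apply (measurable_observe B) hset]
  have : (fun p : Arm dr dc × ℝ => (p.1, B p.1.1 p.1.2 + p.2)) ⁻¹' {p | p.1 = a} =
      {a} ×ˢ Set.univ := by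
    ext p; simp
  rw [this, Measure.prod_prod, measure_univ, mul_one, uniformOn_univ_singleton]

theorem lintegral_exp_obsLaw_le [Nonempty (Arm dr dc)] (B : Matrix (Fin dr) (Fin dc) ℝ)
    {ν : Measure ℝ} [IsProbabilityMeasure ν] (hν : HasSubgaussianMGF id 1 ν) (a : Arm dr dc)
    (l : ℝ) :
    ∫⁻ p, (if p.1 = a then ENNReal.ofReal (Real.exp (l * (p.2 - B a.1 a.2) - l ^ 2 / 2)) else 1)
      ∂(obsLaw B ν) ≤ 1 := by
  have : IsProbabilityMeasure (uniformOn (Set.univ : Set (Arm dr dc))) :=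
    isProbabilityMeasure_uniformOn Set.finite_univ Set.univ_nonempty
  have hmeas : Measurable fun p : Arm dr dc × ℝ =>
      (if p.1 = a then ENNReal.ofReal (Real.exp (l * (p.2 - B a.1 a.2) - l ^ 2 / 2)) else 1) :=
    Measurable.ite (measurable_fst (measurableSet_singleton a)) (by fun_prop) measurable_const
  rw [obsLaw, lintegral_map hmeas (measurable_observe B),
    lintegral_prod (fun p : Arm dr dc × ℝ => if p.1 = a then
      ENNReal.ofReal (Real.exp (l * (B p.1.1 p.1.2 + p.2 - B a.1 a.2) - l ^ 2 / 2)) else 1)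
      (hmeas.comp (measurable_observe B)).aemeasurable]
  calc _ ≤ ∫⁻ _ : Arm dr dc, 1 ∂(uniformOn Set.univ) := by
        refine lintegral_mono fun a' => ?_
        by_cases h : a' = a
        · subst h
          simpa using lintegral_exp_subgaussian_le hν l
        · simp [h]
    _ = 1 := by simp

theorem measurable_sum_secondHalf {n : ℕ} (a : Arm dr dc) {φ : ℝ → ℝ} (hφ : Measurable φ) :
    Measurable fun D : Sample dr dc n => ∑ i ∈ secondHalfTimes D a, φ (D i).2 := by
  simp only [secondHalfTimes, Finset.sum_filter]
  refine Finset.measurable_sum _ fun i _ => Measurable.ite ?_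
    (hφ.comp (measurable_snd.comp (measurable_pi_apply i))) measurable_const
  exact (MeasurableSet.const _).inter
    ((measurable_fst.comp (measurable_pi_apply i)) (measurableSet_singleton a))

section Sample

variable {n : ℕ} (B : Matrix (Fin dr) (Fin dc) ℝ) (ν : Fin n → Measure ℝ)

/-- The law of a sample of independent observations at uniformly random arms. -/
def sampleLaw : Measure (Sample dr dc n) := Measure.pi fun i => obsLaw B (ν i)

variable [Nonempty (Arm dr dc)] [∀ i, IsProbabilityMeasure (ν i)]

instance : IsProbabilityMeasure (sampleLaw B ν) := by
  have := fun i => isProbabilityMeasure_obsLaw B (ν i)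
  rw [sampleLaw]
  infer_instance

theorem sampleLaw_map_eval (i : Fin n) :
    (sampleLaw B ν).map (fun D => D i) = obsLaw B (ν i) := by
  have := fun i => isProbabilityMeasure_obsLaw B (ν i)
  exact (measurePreserving_eval (fun i => obsLaw B (ν i)) i).map_eq

theorem sampleLaw_map_firstHalf :
    (sampleLaw B ν).map firstHalf =
      sampleLaw B fun i : Fin (n / 2) => ν (Fin.castLE (Nat.div_le_self n 2) i) := by
  have := fun i => isProbabilityMeasure_obsLaw B (ν i)
  have h1 : iIndepFun (fun (i : Fin n) (D : Sample dr dc n) => D i) (sampleLaw B ν) :=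
    iIndepFun_pi (X := fun _ => id) fun _ => aemeasurable_id
  have h2 := h1.precomp (Fin.castLE_injective (Nat.div_le_self n 2))
  have h3 := (iIndepFun_iff_map_fun_eq_pi_map
    (fun i => (measurable_pi_apply _).aemeasurable)).1 h2
  simp only [sampleLaw_map_eval] at h3
  exact h3

theorem card_secondHalf : (({i : Fin n | n / 2 ≤ (i : ℕ)} : Finset (Fin n)).card : ℝ) =
    ((n - n / 2 : ℕ) : ℝ) := by
  congr 1
  have h1 := Finset.card_map Fin.valEmbedding
    (s := ({i : Fin n | n / 2 ≤ (i : ℕ)} : Finset (Fin n)))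
  rw [← h1, ← Nat.card_Ico]
  congr 1
  ext x
  simp only [Finset.mem_map, Finset.mem_filter, Finset.mem_univ, true_and, Fin.valEmbedding_apply,
    Finset.mem_Ico]
  constructor
  · rintro ⟨i, hi, rfl⟩
    exact ⟨hi, i.2⟩
  · rintro ⟨h1, h2⟩
    exact ⟨⟨x, h2⟩, h1, rfl⟩

/-- Every arm is observed about equally often in the second half of a sample. -/
theorem sampleLaw_count_le (a : Arm dr dc) :
    sampleLaw B ν {D | ((n - n / 2 : ℕ) : ℝ) / (dr * dc) / 2 ≤
        |((secondHalfTimes D a).card : ℝ) - ((n - n / 2 : ℕ) : ℝ) / (dr * dc)|} ≤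
      2 * ENNReal.ofReal (Real.exp (-((n - n / 2 : ℕ) / (2 * (dr * dc) ^ 2)))) := by
  set m : ℝ := ((n - n / 2 : ℕ) : ℝ)
  set K : ℝ := dr * dc
  set Q := sampleLaw B ν
  have hobs := fun i => isProbabilityMeasure_obsLaw B (ν i)
  have hK : 0 < K := by
    have h1 : (0 : ℝ) < dr := by exact_mod_cast a.1.pos
    have h2 : (0 : ℝ) < dc := by exact_mod_cast a.2.pos
    positivity
  let X : Arm dr dc × ℝ → ℝ := fun p => Set.indicator {p | p.1 = a} 1 p
  have hset : MeasurableSet {p : Arm dr dc × ℝ | p.1 = a} :=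
    measurable_fst (measurableSet_singleton a)
  have hX : Measurable X := measurable_one.indicator hset
  have hmean : ∀ i, ∫ D, X (D i) ∂Q = 1 / K := fun i => by
    rw [← integral_map (φ := fun D : Sample dr dc n => D i)
      (measurable_pi_apply i).aemeasurable hX.aestronglyMeasurable,
      sampleLaw_map_eval, integral_indicator_one hset, measureReal_def, obsLaw_fst,
      ENNReal.toReal_ofReal (by positivity)]
  have hsub : ∀ i, HasSubgaussianMGF (fun D : Sample dr dc n => X (D i) - 1 / K) (1 / 4) Q := by
    intro i
    have h1 : ∀ᵐ D ∂Q, X (D i) ∈ Set.Icc (0 : ℝ) 1 := ae_of_all _ fun D => by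
      simp only [X, Set.indicator, Pi.one_apply]
      split_ifs <;> simp
    have h2 := hasSubgaussianMGF_of_mem_Icc (hX.comp (measurable_pi_apply i)).aemeasurable h1
    simp only [Function.comp_def, hmean] at h2
    convert h2 using 1
    ext
    norm_num
  have hind : iIndepFun (fun (i : Fin n) (D : Sample dr dc n) => X (D i) - 1 / K) Q :=
    iIndepFun_pi (X := fun _ p => X p - 1 / K) fun _ => (hX.sub_const _).aemeasurable
  set s : Finset (Fin n) := {i : Fin n | n / 2 ≤ (i : ℕ)}
  have hs : (s.card : ℝ) = m := card_secondHalf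
  have hsum : ∀ D : Sample dr dc n,
      ∑ i ∈ s, (X (D i) - 1 / K) = ((secondHalfTimes D a).card : ℝ) - m / K := fun D => by
    rw [Finset.sum_sub_distrib, Finset.sum_const, nsmul_eq_mul, hs]
    congr 1
    · simp only [X, Set.indicator, Set.mem_ofPred_eq, Pi.one_apply, s, secondHalfTimes,
        Finset.filter_and]
      rw [Finset.sum_boole, ← Finset.filter_and, Finset.filter_filter]
    · ring
  have hm : 0 ≤ m := Nat.cast_nonneg _
  have hε : 0 ≤ m / K / 2 := by positivity
  have hval : -(m / K / 2) ^ 2 / (2 * ((∑ _i ∈ s, (1 / 4) : NNReal) : ℝ)) =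
      -(m / (2 * K ^ 2)) := by
    rw [Finset.sum_const, nsmul_eq_mul, NNReal.coe_mul, NNReal.coe_natCast, hs]
    rcases hm.eq_or_lt with h | h
    · rw [← h]; simp
    · push_cast
      field_simp
      norm_num
  have hup := HasSubgaussianMGF.measure_sum_ge_le_of_iIndepFun hind (s := s)
    (c := fun _ => 1 / 4) (fun i _ => hsub i) hε
  have hlow := HasSubgaussianMGF.measure_sum_ge_le_of_iIndepFun
    (X := fun (i : Fin n) (D : Sample dr dc n) => -(X (D i) - 1 / K))
    (hind.comp (fun _ x => -x) fun _ => measurable_neg) (s := s)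
    (c := fun _ => 1 / 4) (fun i _ => (hsub i).neg) hε
  rw [hval] at hup hlow
  simp only [Finset.sum_neg_distrib, hsum] at hup hlow
  calc Q _ ≤ Q ({D | m / K / 2 ≤ ((secondHalfTimes D a).card : ℝ) - m / K} ∪
        {D | m / K / 2 ≤ -(((secondHalfTimes D a).card : ℝ) - m / K)}) := by
        refine measure_mono fun D hD => ?_
        rw [Set.mem_ofPred_eq] at hD
        exact le_abs.1 hD
    _ ≤ _ := measure_union_le _ _
    _ ≤ _ := by
      rw [two_mul]
      refine add_le_add ?_ ?_
      · rw [← ofReal_measureReal]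
        exact ENNReal.ofReal_le_ofReal hup
      · rw [← ofReal_measureReal]
        exact ENNReal.ofReal_le_ofReal hlow

/-- The exponential process of the noise of an arm in the second half of a sample. The random
number of its observations is part of the exponent. -/
theorem lintegral_exp_secondHalf_le (hν : ∀ i, HasSubgaussianMGF id 1 (ν i)) (a : Arm dr dc)
    (l : ℝ) :
    ∫⁻ D, ENNReal.ofReal (Real.exp (∑ i ∈ secondHalfTimes D a,
      (l * ((D i).2 - B a.1 a.2) - l ^ 2 / 2))) ∂(sampleLaw B ν) ≤ 1 := by
  have hobs := fun i => isProbabilityMeasure_obsLaw B (ν i)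
  let g : Arm dr dc × ℝ → ℝ≥0∞ := fun p =>
    if p.1 = a then ENNReal.ofReal (Real.exp (l * (p.2 - B a.1 a.2) - l ^ 2 / 2)) else 1
  have hg : Measurable g :=
    Measurable.ite (measurable_fst (measurableSet_singleton a)) (by fun_prop) measurable_const
  set s : Finset (Fin n) := {i : Fin n | n / 2 ≤ (i : ℕ)}
  have hprod : ∀ D : Sample dr dc n, ENNReal.ofReal (Real.exp (∑ i ∈ secondHalfTimes D a,
      (l * ((D i).2 - B a.1 a.2) - l ^ 2 / 2))) = ∏ i ∈ s, g (D i) := fun D => by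
    rw [Real.exp_sum, ENNReal.ofReal_prod_of_nonneg fun _ _ => (Real.exp_pos _).le]
    simp only [g, s, secondHalfTimes]
    rw [← Finset.prod_filter, Finset.filter_filter]
  simp only [hprod]
  have hind : iIndepFun (fun (i : Fin n) (D : Sample dr dc n) => g (D i)) (sampleLaw B ν) :=
    iIndepFun_pi (X := fun _ => g) fun _ => hg.aemeasurable
  rw [lintegral_prod_eq_prod_lintegral_of_indepFun s _ hind
    fun i => hg.comp (measurable_pi_apply i)]
  refine Finset.prod_le_one' fun i _ => ?_
  rw [← lintegral_map hg (measurable_pi_apply i), sampleLaw_map_eval]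
  exact lintegral_exp_obsLaw_le B (hν i) a l

/-- The noise averages of an arm that is observed often enough are small. -/
theorem sampleLaw_noise_le (hν : ∀ i, HasSubgaussianMGF id 1 (ν i)) (a : Arm dr dc)
    {N c : ℝ} (hc : 0 < c) :
    sampleLaw B ν {D | N ≤ ((secondHalfTimes D a).card : ℝ) ∧
        (secondHalfTimes D a).card * c < |∑ i ∈ secondHalfTimes D a, ((D i).2 - B a.1 a.2)|} ≤
      2 * ENNReal.ofReal (Real.exp (-(N * c ^ 2 / 2))) := by
  have hone : ∀ l : ℝ, sampleLaw B ν {D | N * c ^ 2 / 2 ≤ ∑ i ∈ secondHalfTimes D a,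
      (l * ((D i).2 - B a.1 a.2) - l ^ 2 / 2)} ≤ ENNReal.ofReal (Real.exp (-(N * c ^ 2 / 2))) :=
    fun l => measure_le_exp_neg_of_lintegral_exp_le_one
      (measurable_sum_secondHalf a (φ := fun y => l * (y - B a.1 a.2) - l ^ 2 / 2) (by fun_prop))
      (lintegral_exp_secondHalf_le B ν hν a l) _
  rw [two_mul]
  refine le_trans (le_trans (measure_mono ?_) (measure_union_le _ _))
    (add_le_add (hone c) (hone (-c)))
  rintro D ⟨h1, h2⟩
  simp only [Finset.sum_sub_distrib (f := fun i => _ * _), ← Finset.mul_sum, Finset.sum_const,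
    nsmul_eq_mul, Set.mem_union, Set.mem_ofPred_eq]
  rcases lt_abs.1 h2 with h3 | h3
  · left
    nlinarith [mul_lt_mul_of_pos_left h3 hc, mul_le_mul_of_nonneg_right h1 (sq_nonneg c)]
  · right
    nlinarith [mul_lt_mul_of_pos_left h3 hc, mul_le_mul_of_nonneg_right h1 (sq_nonneg c)]

/-- The probability that the row-enhanced estimator misses the accuracy `h / 4`: either the
low-rank estimator fails on the first half, or some arm is observed too rarely or too often, or
some noise average is large. -/
theorem sampleLaw_estimate_error_le (hν : ∀ i, HasSubgaussianMGF id 1 (ν i)) (hB : B ≠ 0)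
    {Bbar Bhat : Estimator dr dc} (hBbar : Bbar.IsMeasurable)
    (hhat : ∀ D : Sample dr dc n, IsRowEnhancement B.rank Bbar D (Bhat n D)) {h : ℝ} (hh : 0 < h)
    (hn : 0 < n) :
    sampleLaw B ν {D | ∃ a : Arm dr dc, h / 4 < |Bhat n D a.1 a.2 - B a.1 a.2|} ≤
      sampleLaw B (fun i : Fin (n / 2) => ν (Fin.castLE (Nat.div_le_self n 2) i))
        {D | h * leastSingularValue B / (64 * rowNorm B) ≤ frobNorm (Bbar (n / 2) D - B)} +
      ((dr * dc : ℕ) * (2 * ENNReal.ofReal (Real.exp (-((n - n / 2 : ℕ) / (2 * (dr * dc) ^ 2))))) +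
      (dr * dc : ℕ) * (2 * ENNReal.ofReal (Real.exp
        (-((n - n / 2 : ℕ) / (dr * dc) / 2 * (h / (64 * √dc)) ^ 2 / 2))))) := by
  have hmeas : Measurable fun D : Sample dr dc (n / 2) => frobNorm (Bbar (n / 2) D - B) := by
    refine (Finset.measurable_sum _ fun j _ => Finset.measurable_sum _ fun k _ => ?_).sqrt
    exact ((hBbar (n / 2) j k).sub_const _).pow_const 2
  have hfirst : Measurable (firstHalf : Sample dr dc n → Sample dr dc (n / 2)) :=
    measurable_pi_lambda _ fun i => measurable_pi_apply _
  have hset := measurableSet_le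
    (measurable_const (a := h * leastSingularValue B / (64 * rowNorm B))) hmeas
  rw [← sampleLaw_map_firstHalf B ν, Measure.map_apply hfirst hset]
  set m : ℝ := ((n - n / 2 : ℕ) : ℝ)
  have a₀ : Arm dr dc := Classical.arbitrary _
  have hdr : (0 : ℝ) < dr := by exact_mod_cast a₀.1.pos
  have hdc : (0 : ℝ) < dc := by exact_mod_cast a₀.2.pos
  have hm : 0 < m := by
    exact Nat.cast_pos.2 (by omega)
  set E₁ : Set (Sample dr dc n) := firstHalf ⁻¹'
    {D | h * leastSingularValue B / (64 * rowNorm B) ≤ frobNorm (Bbar (n / 2) D - B)}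
  set E₂ : Arm dr dc → Set (Sample dr dc n) := fun a => {D | m / (dr * dc) / 2 ≤
        |((secondHalfTimes D a).card : ℝ) - m / (dr * dc)|}
  set E₃ : Arm dr dc → Set (Sample dr dc n) := fun a =>
    {D | m / (dr * dc) / 2 ≤ ((secondHalfTimes D a).card : ℝ) ∧
        (secondHalfTimes D a).card * (h / (64 * √dc)) <
          |∑ i ∈ secondHalfTimes D a, ((D i).2 - B a.1 a.2)|}
  have hcard : ∀ x : ℝ≥0∞, ∑ _a : Arm dr dc, x = (dr * dc : ℕ) * x := fun x => by
    rw [Finset.sum_const, Finset.card_univ, Fintype.card_prod, Fintype.card_fin, Fintype.card_fin,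
      nsmul_eq_mul]
  have hsub : {D | ∃ a : Arm dr dc, h / 4 < |Bhat n D a.1 a.2 - B a.1 a.2|} ⊆
      E₁ ∪ ((⋃ a, E₂ a) ∪ ⋃ a, E₃ a) := by
    intro D hD
    by_contra hcon
    simp only [Set.mem_union, Set.mem_iUnion, not_or, not_exists] at hcon
    obtain ⟨h1, h2, h3⟩ := hcon
    obtain ⟨a, ha⟩ := hD
    have hc : ∀ a, m / (dr * dc) / 2 ≤ ((secondHalfTimes D a).card : ℝ) ∧
        ((secondHalfTimes D a).card : ℝ) ≤ 3 * (m / (dr * dc)) / 2 := fun a => by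
      have h2a := h2 a
      simp only [E₂, Set.mem_ofPred_eq, not_le] at h2a
      have := abs_lt.1 h2a
      constructor <;> linarith [this.1, this.2]
    refine absurd ((hhat D).abs_sub_le hB hh (m := m / (dr * dc)) (by positivity)
      (not_le.1 h1).le hc (fun a => ?_) a.1 a.2) (not_le.2 ha)
    exact not_lt.1 fun h4 => h3 a ⟨(hc a).1, h4⟩
  refine (measure_mono hsub).trans ((measure_union_le _ _).trans (add_le_add le_rfl
    ((measure_union_le _ _).trans (add_le_add ?_ ?_))))
  · refine (measure_iUnion_fintype_le _ _).trans ?_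
    rw [← hcard]
    exact Finset.sum_le_sum fun a _ => sampleLaw_count_le B ν a
  · refine (measure_iUnion_fintype_le _ _).trans ?_
    rw [← hcard]
    exact Finset.sum_le_sum fun a _ => sampleLaw_noise_le B ν hν a (by positivity)

end Sample

/-! ### The law of the forced samples -/

section Forced

variable {Ω : Type*} {f : ℕ → Ω → Option (Arm dr dc)} {ε : ℕ → Ω → ℝ}

theorem mem_forcedTimes {t u : ℕ} {ω : Ω} :
    u ∈ forcedTimes f t ω ↔ u ∈ Finset.Ico 1 t ∧ (f u ω).isSome := by
  simp [forcedTimes]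

theorem forcedTimes_eq_iff {t : ℕ} {ω : Ω} {S : Finset ℕ} (hS : S ⊆ Finset.Ico 1 t) :
    forcedTimes f t ω = S ↔ ∀ u ∈ Finset.Ico 1 t, ((f u ω).isSome ↔ u ∈ S) := by
  constructor
  · rintro rfl u hu
    rw [mem_forcedTimes]
    exact ⟨fun h => ⟨hu, h⟩, fun h => h.2⟩
  · intro h
    ext u
    rw [mem_forcedTimes]
    exact ⟨fun hu => (h u hu.1).1 hu.2, fun hu => ⟨hS hu, (h u (hS hu)).2 hu⟩⟩

/-- The observation of a forced arm at time `u`; the arm `a₀` is a placeholder for the periods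
without a forced arm. -/
def forcedObs (B : Matrix (Fin dr) (Fin dc) ℝ) (f : ℕ → Ω → Option (Arm dr dc)) (ε : ℕ → Ω → ℝ)
    (a₀ : Arm dr dc) (u : ℕ) (ω : Ω) : Arm dr dc × ℝ :=
  ((f u ω).getD a₀, B ((f u ω).getD a₀).1 ((f u ω).getD a₀).2 + ε u ω)

variable [MeasurableSpace Ω] {P : Measure Ω} {ρ : ℝ}

theorem Environment.measurable_forcedObs (hE : Environment P ρ f ε)
    (B : Matrix (Fin dr) (Fin dc) ℝ) (a₀ : Arm dr dc) (u : ℕ) :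
    Measurable (forcedObs B f ε a₀ u) := by
  have h1 : Measurable fun ω => (f u ω).getD a₀ :=
    (measurable_from_top (f := fun o : Option (Arm dr dc) => o.getD a₀)).comp
      (hE.measurable_forced u)
  exact h1.prodMk (((measurable_of_finite fun a : Arm dr dc => B a.1 a.2).comp h1).add
    (hE.measurable_noise u))

theorem Environment.measurableSet_forced (hE : Environment P ρ f ε) (u : ℕ)
    (p : Option (Arm dr dc) → Prop) : MeasurableSet {ω | p (f u ω)} :=
  hE.measurable_forced u (show MeasurableSet {o | p o} from trivial)

/-- The law of the observation in a period with a forced arm. -/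
theorem Environment.measure_isSome_inter [IsProbabilityMeasure P] (hE : Environment P ρ f ε)
    (B : Matrix (Fin dr) (Fin dc) ℝ) (a₀ : Arm dr dc) {u : ℕ} (hu : 1 ≤ u)
    {s : Set (Arm dr dc × ℝ)} (hs : MeasurableSet s) :
    P {ω | (f u ω).isSome ∧ forcedObs B f ε a₀ u ω ∈ s} =
      (dr * dc : ℕ) * ENNReal.ofReal (forcedProb dr dc ρ u) * obsLaw B (P.map (ε u)) s := by
  have hν : IsProbabilityMeasure (P.map (ε u)) :=
    Measure.isProbabilityMeasure_map (hE.measurable_noise u).aemeasurable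
  have : Nonempty (Arm dr dc) := ⟨a₀⟩
  have hunif : IsProbabilityMeasure (uniformOn (Set.univ : Set (Arm dr dc))) :=
    isProbabilityMeasure_uniformOn Set.finite_univ Set.univ_nonempty
  let sec : Arm dr dc → Set ℝ := fun a => {x | (a, B a.1 a.2 + x) ∈ s}
  have hsec : ∀ a, MeasurableSet (sec a) := fun a =>
    (measurable_const.prodMk (measurable_const.add measurable_id)) hs
  have hleft : P {ω | (f u ω).isSome ∧ forcedObs B f ε a₀ u ω ∈ s} =
      ∑ a, ENNReal.ofReal (forcedProb dr dc ρ u) * P.map (ε u) (sec a) := by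
    have h1 : {ω | (f u ω).isSome ∧ forcedObs B f ε a₀ u ω ∈ s} =
        ⋃ a ∈ (Finset.univ : Finset (Arm dr dc)), f u ⁻¹' {some a} ∩ ε u ⁻¹' sec a := by
      ext ω
      simp only [Set.mem_ofPred_eq, Finset.mem_univ, Set.iUnion_true, Set.mem_iUnion,
        Set.mem_inter_iff, Set.mem_preimage, Set.mem_singleton_iff, sec, forcedObs]
      rcases hf : f u ω with _ | a
      · simp
      · simp
    have hm : ∀ a, MeasurableSet (f u ⁻¹' {some a}) := fun a =>
      hE.measurable_forced u (show MeasurableSet {some a} from trivial)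
    rw [h1, measure_biUnion_finset]
    · refine Finset.sum_congr rfl fun a _ => ?_
      rw [(hE.indep_forced_noise u).measure_inter_preimage_eq_mul _ _
        (show MeasurableSet {some a} from trivial) (hsec a),
        Measure.map_apply (hE.measurable_noise u) (hsec a), ← hE.forced_law u hu a]
      rfl
    · intro a _ b _ hab
      refine Set.disjoint_left.2 fun ω h1 h2 => hab ?_
      have h3 : f u ω = some a := h1.1
      have h4 : f u ω = some b := h2.1
      rw [h3] at h4
      exact Option.some_injective _ h4
    · exact fun a _ => (hm a).inter (hE.measurable_noise u (hsec a))
  have hobs : obsLaw B (P.map (ε u)) s =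
      ∑ a, ENNReal.ofReal (1 / (dr * dc)) * P.map (ε u) (sec a) := by
    rw [obsLaw, Measure.map_apply (measurable_observe B) hs]
    have h1 : (fun p : Arm dr dc × ℝ => (p.1, B p.1.1 p.1.2 + p.2)) ⁻¹' s =
        ⋃ a ∈ (Finset.univ : Finset (Arm dr dc)), {a} ×ˢ sec a := by
      ext ⟨a, x⟩
      simp [sec]
    rw [h1, measure_biUnion_finset]
    · exact Finset.sum_congr rfl fun a _ => by rw [Measure.prod_prod, uniformOn_univ_singleton]
    · intro a _ b _ hab
      refine Set.disjoint_left.2 fun p h1 h2 => hab ?_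
      rw [← (Set.mem_prod.1 h1).1, ← (Set.mem_prod.1 h2).1]
    · exact fun a _ => (measurableSet_singleton a).prod (hsec a)
  rw [hleft, hobs, ← Finset.mul_sum, ← Finset.mul_sum, ← mul_assoc]
  congr 1
  rw [mul_right_comm]
  have hK : (0 : ℝ) < dr * dc := by
    have h1 : (0 : ℝ) < dr := by exact_mod_cast a₀.1.pos
    have h2 : (0 : ℝ) < dc := by exact_mod_cast a₀.2.pos
    positivity
  have : ((dr * dc : ℕ) : ℝ≥0∞) * ENNReal.ofReal (1 / (dr * dc)) = 1 := by
    rw [← ENNReal.ofReal_natCast, ← ENNReal.ofReal_mul (Nat.cast_nonneg _), Nat.cast_mul,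
      mul_one_div_cancel hK.ne', ENNReal.ofReal_one]
  rw [this, one_mul]

theorem Environment.measure_isSome [IsProbabilityMeasure P] (hE : Environment P ρ f ε)
    (a₀ : Arm dr dc) {u : ℕ} (hu : 1 ≤ u) :
    P {ω | (f u ω).isSome} = (dr * dc : ℕ) * ENNReal.ofReal (forcedProb dr dc ρ u) := by
  have hν : IsProbabilityMeasure (P.map (ε u)) :=
    Measure.isProbabilityMeasure_map (hE.measurable_noise u).aemeasurable
  have : Nonempty (Arm dr dc) := ⟨a₀⟩
  have := isProbabilityMeasure_obsLaw (0 : Matrix (Fin dr) (Fin dc) ℝ) (P.map (ε u))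
  simpa using hE.measure_isSome_inter 0 a₀ hu MeasurableSet.univ

/-- Given the set `S` of the forced-sampling periods, the forced observations are independent and
have the law of observations at uniformly random arms: the probability of a box. -/
theorem Environment.measure_forcedTimes_inter_box [IsProbabilityMeasure P]
    (hE : Environment P ρ f ε) (B : Matrix (Fin dr) (Fin dc) ℝ) (a₀ : Arm dr dc) {t : ℕ}
    {S : Finset ℕ} (hS : S ⊆ Finset.Ico 1 t) {s : ℕ → Set (Arm dr dc × ℝ)} (hs : ∀ u, MeasurableSet (s u)) :
    P {ω | forcedTimes f t ω = S ∧ ∀ u ∈ S, forcedObs B f ε a₀ u ω ∈ s u} =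
      P {ω | forcedTimes f t ω = S} * ∏ u ∈ S, obsLaw B (P.map (ε u)) (s u) := by
  -- the event as an intersection over the periods
  have key : ∀ s : ℕ → Set (Arm dr dc × ℝ), (∀ u, MeasurableSet (s u)) →
      P {ω | forcedTimes f t ω = S ∧ ∀ u ∈ S, forcedObs B f ε a₀ u ω ∈ s u} =
        ∏ u ∈ Finset.Ico 1 t, (if u ∈ S then
          P {ω | (f u ω).isSome ∧ forcedObs B f ε a₀ u ω ∈ s u} else P {ω | f u ω = none}) := by
    intro s hs
    let G : ℕ → Set (Option (Arm dr dc) × ℝ) := fun u => if u ∈ S then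
      {p | p.1.isSome ∧ (p.1.getD a₀, B (p.1.getD a₀).1 (p.1.getD a₀).2 + p.2) ∈ s u} else
      {p | p.1 = none}
    have hG : ∀ u, MeasurableSet (G u) := by
      intro u
      have h1 : Measurable fun p : Option (Arm dr dc) × ℝ => p.1.getD a₀ :=
        (measurable_from_top (f := fun o : Option (Arm dr dc) => o.getD a₀)).comp measurable_fst
      simp only [G]
      split_ifs
      · exact (measurable_fst (show MeasurableSet {o : Option (Arm dr dc) | o.isSome} from
          trivial)).inter ((h1.prodMk (((measurable_of_finite fun a : Arm dr dc =>
            B a.1 a.2).comp h1).add measurable_snd)) (hs u))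
      · exact measurable_fst (show MeasurableSet {o : Option (Arm dr dc) | o = none} from trivial)
    have hset : {ω | forcedTimes f t ω = S ∧ ∀ u ∈ S, forcedObs B f ε a₀ u ω ∈ s u} =
        ⋂ u ∈ Finset.Ico 1 t, (fun ω => (f u ω, ε u ω)) ⁻¹' G u := by
      ext ω
      simp only [Set.mem_ofPred_eq, Set.mem_iInter, Set.mem_preimage, forcedTimes_eq_iff hS]
      constructor
      · rintro ⟨h1, h2⟩ u hu
        simp only [G]
        split_ifs with h
        · exact ⟨(h1 u hu).2 h, h2 u h⟩
        · have := (h1 u hu).not.2 h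
          simpa using this
      · intro h
        refine ⟨fun u hu => ?_, fun u hu => ?_⟩
        · have := h u hu
          simp only [G] at this
          split_ifs at this with h3
          · exact ⟨fun _ => h3, fun _ => this.1⟩
          · have h4 : f u ω = none := this
            simp [h4, h3]
        · have := h u (hS hu)
          simp only [G, if_pos hu] at this
          exact this.2
    rw [hset, hE.indep_time.measure_inter_preimage_eq_mul _ fun u _ => hG u]
    refine Finset.prod_congr rfl fun u _ => ?_
    simp only [G]
    split_ifs <;> rfl
  have h1 := key s hs
  have h2 := key (fun _ => Set.univ) fun _ => MeasurableSet.univ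
  simp only [Set.mem_univ, implies_true, and_true] at h2
  rw [h1, h2, Finset.prod_ite, Finset.prod_ite, mul_right_comm]
  congr 1
  have hfil : Finset.filter (fun u => u ∈ S) (Finset.Ico 1 t) = S := by
    rw [Finset.filter_mem_eq_inter, Finset.inter_eq_right.2 hS]
  rw [hfil, ← Finset.prod_mul_distrib]
  refine Finset.prod_congr rfl fun u hu => ?_
  have hu1 : 1 ≤ u := (Finset.mem_Ico.1 (hS hu)).1
  rw [hE.measure_isSome_inter B a₀ hu1 (hs u), hE.measure_isSome a₀ hu1]

theorem Environment.measurableSet_forcedTimes_eq (hE : Environment P ρ f ε) {t : ℕ} {S : Finset ℕ} :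
    MeasurableSet {ω | forcedTimes f t ω = S} := by
  by_cases hS : S ⊆ Finset.Ico 1 t
  · simp only [forcedTimes_eq_iff hS]
    have : {ω | ∀ u ∈ Finset.Ico 1 t, ((f u ω).isSome ↔ u ∈ S)} =
        ⋂ u ∈ Finset.Ico 1 t, {ω | ((f u ω).isSome ↔ u ∈ S)} := by
      ext ω; simp
    rw [this]
    exact Finset.measurableSet_biInter _ fun u _ =>
      hE.measurableSet_forced u fun o => (o.isSome ↔ u ∈ S)
  · have : {ω | forcedTimes f t ω = S} = ∅ := by
      ext ω
      simp only [Set.mem_ofPred_eq, Set.mem_empty_iff_false, iff_false]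
      rintro rfl
      exact hS (Finset.filter_subset _ _)
    rw [this]
    exact MeasurableSet.empty

/-- Given the set `S` of the forced-sampling periods, the law of the forced sample. -/
theorem Environment.measure_forcedTimes_inter_sample [IsProbabilityMeasure P]
    (hE : Environment P ρ f ε) (B : Matrix (Fin dr) (Fin dc) ℝ) (a₀ : Arm dr dc) {t : ℕ}
    {S : Finset ℕ} (hS : S ⊆ Finset.Ico 1 t) {C : Set (Sample dr dc S.card)} (hC : MeasurableSet C) :
    P {ω | forcedTimes f t ω = S ∧
        (fun i => forcedObs B f ε a₀ (S.orderEmbOfFin rfl i) ω) ∈ C} =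
      P {ω | forcedTimes f t ω = S} *
        sampleLaw B (fun i => P.map (ε (S.orderEmbOfFin rfl i))) C := by
  have : Nonempty (Arm dr dc) := ⟨a₀⟩
  have hν : ∀ u, IsProbabilityMeasure (P.map (ε u)) := fun u =>
    Measure.isProbabilityMeasure_map (hE.measurable_noise u).aemeasurable
  have hobs : ∀ u, IsProbabilityMeasure (obsLaw B (P.map (ε u))) := fun u =>
    isProbabilityMeasure_obsLaw B _
  set A : Set Ω := {ω | forcedTimes f t ω = S} with hA_def
  have hA : MeasurableSet A := hE.measurableSet_forcedTimes_eq
  let τ : Fin S.card ↪o ℕ := S.orderEmbOfFin rfl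
  let X : Ω → Sample dr dc S.card := fun ω i => forcedObs B f ε a₀ (τ i) ω
  have hX : Measurable X := measurable_pi_lambda _ fun i => hE.measurable_forcedObs B a₀ (τ i)
  have hset : {ω | forcedTimes f t ω = S ∧
      (fun i => forcedObs B f ε a₀ (S.orderEmbOfFin rfl i) ω) ∈ C} = A ∩ X ⁻¹' C := rfl
  rw [hset]
  by_cases h0 : P A = 0
  · rw [h0, zero_mul]
    exact measure_mono_null Set.inter_subset_left h0
  have hlaw : sampleLaw B (fun i => P.map (ε (τ i))) = (P[|A]).map X := by
    refine Measure.pi_eq fun s hs => ?_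
    rw [Measure.map_apply hX (MeasurableSet.univ_pi hs), cond_apply hA]
    let s' : ℕ → Set (Arm dr dc × ℝ) := Function.extend τ s fun _ => Set.univ
    have hs' : ∀ i, s' (τ i) = s i := fun i => τ.injective.extend_apply _ _ _
    have hs'm : ∀ u, MeasurableSet (s' u) := by
      intro u
      by_cases hu : ∃ i, τ i = u
      · obtain ⟨i, rfl⟩ := hu
        rw [hs']
        exact hs i
      · simp only [s']
        rw [Function.extend_apply' _ _ _ hu]
        exact MeasurableSet.univ
    have hbox : A ∩ X ⁻¹' Set.univ.pi s =
        {ω | forcedTimes f t ω = S ∧ ∀ u ∈ S, forcedObs B f ε a₀ u ω ∈ s' u} := by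
      ext ω
      simp only [Set.mem_inter_iff, Set.mem_preimage, Set.mem_univ_pi, Set.mem_ofPred_eq, A]
      refine and_congr_right fun _ => ⟨fun h u hu => ?_, fun h i => ?_⟩
      · rw [← Finset.mem_coe, ← Finset.range_orderEmbOfFin S rfl] at hu
        obtain ⟨i, rfl⟩ := hu
        have := h i
        rw [← hs'] at this
        exact this
      · rw [← hs']
        exact h _ (Finset.orderEmbOfFin_mem S rfl i)
    have hprod : ∏ u ∈ S, obsLaw B (P.map (ε u)) (s' u) =
        ∏ i, obsLaw B (P.map (ε (τ i))) (s i) := by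
      simp only [← hs']
      have h2 := Finset.prod_map Finset.univ τ.toEmbedding
        (fun u => obsLaw B (P.map (ε u)) (s' u))
      rw [show Finset.univ.map τ.toEmbedding = S by simp [τ]] at h2
      exact h2
    rw [hbox, hE.measure_forcedTimes_inter_box B a₀ hS hs'm, hprod, ← mul_assoc,
      ENNReal.inv_mul_cancel h0 (measure_ne_top _ _), one_mul]
  rw [show (fun i => P.map (ε (S.orderEmbOfFin rfl i))) = fun i => P.map (ε (τ i)) from rfl,
    hlaw, Measure.map_apply hX hC, cond_apply hA, ← mul_assoc,
    ENNReal.mul_inv_cancel h0 (measure_ne_top _ _), one_mul]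

end Forced

/-! ### The number of forced samples -/

/-- The probability that some arm is forced at time `u`, if there are any arms. -/
def forcedRate (ρ : ℝ) (u : ℕ) : ℝ :=
  if (u : ℝ) ≤ 2 * ρ * Real.log ρ then 1 else ρ / (u - ρ * Real.log ρ + 1)

theorem log_le_div_eight {ρ : ℝ} (hρ : 32 ≤ ρ) : Real.log ρ ≤ ρ / 8 := by
  have h1 : Real.log ρ = Real.log (ρ / 32) + 5 * Real.log 2 := by
    rw [Real.log_div (by positivity) (by norm_num), show (32 : ℝ) = 2 ^ 5 by norm_num, Real.log_pow]
    push_cast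
    ring
  have h2 := Real.log_le_sub_one_of_pos (show 0 < ρ / 32 by positivity)
  have h3 := Real.log_two_lt_d9
  rw [h1]
  linarith

theorem three_le_log {ρ : ℝ} (hρ : 32 ≤ ρ) : 3 ≤ Real.log ρ := by
  have h1 : Real.log 32 = 5 * Real.log 2 := by
    rw [show (32 : ℝ) = 2 ^ 5 by norm_num, Real.log_pow]
    push_cast
    ring
  have h2 := Real.log_le_log (by norm_num) hρ
  have h3 := Real.log_two_gt_d9
  linarith

theorem forcedRate_nonneg {ρ : ℝ} (hρ : 32 ≤ ρ) (u : ℕ) : 0 ≤ forcedRate ρ u := by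
  have h3 := three_le_log hρ
  rw [forcedRate]
  split_ifs with h
  · exact zero_le_one
  · exact div_nonneg (by linarith) (by nlinarith)

theorem log_succ_sub_log_le {t : ℕ} (ht : 1 ≤ t) :
    Real.log (t + 1 : ℕ) - Real.log t ≤ 1 / t := by
  have h0 : (0 : ℝ) < t := by exact_mod_cast ht
  rw [← Real.log_div (by positivity) h0.ne']
  refine (Real.log_le_sub_one_of_pos (by positivity)).trans_eq ?_
  push_cast
  field_simp
  ring

/-- The expected number of forced samples before time `t` is at least `ρ log t`, once the
initialization `t ≤ 2 ρ log ρ` is over. -/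
theorem mul_log_le_sum_forcedRate {ρ : ℝ} (hρ : 32 ≤ ρ) {t : ℕ}
    (ht : 2 * ρ * Real.log ρ < t) :
    ρ * Real.log t ≤ ∑ u ∈ Finset.Ico 1 t, forcedRate ρ u := by
  have hl3 := three_le_log hρ
  have hl8 := log_le_div_eight hρ
  set L := ρ * Real.log ρ with hL
  have hL0 : 96 ≤ L := by nlinarith
  set N := ⌊2 * ρ * Real.log ρ⌋₊ with hN
  have hN1 : (N : ℝ) ≤ 2 * L := by
    rw [hL, ← mul_assoc]
    exact Nat.floor_le (by positivity)
  have hN2 : 2 * L < N + 1 := by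
    rw [hL, ← mul_assoc]
    exact Nat.lt_floor_add_one _
  have hinit : ∑ u ∈ Finset.Ico 1 (N + 1), forcedRate ρ u = N := by
    rw [Finset.sum_congr rfl (g := fun _ => (1 : ℝ))]
    · simp
    · intro u hu
      have : (u : ℝ) ≤ N := by exact_mod_cast Nat.lt_succ_iff.1 (Finset.mem_Ico.1 hu).2
      rw [forcedRate, if_pos]
      rw [mul_assoc]
      exact this.trans hN1
  have hgrow : ∀ s, N + 1 ≤ s → N + ρ * (Real.log s - Real.log (N + 1 : ℕ)) ≤
      ∑ u ∈ Finset.Ico 1 s, forcedRate ρ u := by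
    intro s hs
    induction s, hs using Nat.le_induction with
    | base => rw [hinit, sub_self, mul_zero, add_zero]
    | succ s hs ih =>
      rw [Finset.sum_Ico_succ_top (by omega)]
      have h1 := log_succ_sub_log_le (t := s) (by omega)
      have hs' : (N : ℝ) + 1 ≤ s := by exact_mod_cast hs
      have h2 : ρ / s ≤ forcedRate ρ s := by
        rw [forcedRate, if_neg (by rw [mul_assoc]; linarith)]
        exact div_le_div_of_nonneg_left (by linarith) (by linarith) (by linarith)
      have h3 := mul_le_mul_of_nonneg_left h1 (show 0 ≤ ρ by linarith)
      rw [mul_one_div] at h3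
      linarith
  have hNt : N + 1 ≤ t := by
    have : (N : ℝ) < t := by rw [mul_assoc] at ht; linarith
    exact_mod_cast this
  have h1 := hgrow t hNt
  -- the initialization compensates for the logarithm of its length
  have h2 : ρ * Real.log (N + 1 : ℕ) ≤ N := by
    have hx : ((N + 1 : ℕ) : ℝ) ≤ ρ ^ 2 * (1 - 1 / ρ) := by
      have : ρ ^ 2 * (1 - 1 / ρ) = ρ ^ 2 - ρ := by field_simp
      rw [this]
      push_cast
      nlinarith
    have hpos : 0 < 1 - 1 / ρ := by
      rw [sub_pos, div_lt_one (by linarith)]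
      linarith
    have h3 := Real.log_le_log (by positivity) hx
    rw [Real.log_mul (by positivity) hpos.ne', Real.log_pow] at h3
    have h4 := Real.log_le_sub_one_of_pos hpos
    have h5 : Real.log (N + 1 : ℕ) ≤ 2 * Real.log ρ - 1 / ρ := by
      push_cast at h3 ⊢
      linarith
    have h6 := mul_le_mul_of_nonneg_left h5 (show 0 ≤ ρ by linarith)
    have h7 : ρ * (2 * Real.log ρ - 1 / ρ) = 2 * L - 1 := by
      rw [hL]
      field_simp
    linarith
  linarith

section Forced

variable {Ω : Type*} {f : ℕ → Ω → Option (Arm dr dc)} {ε : ℕ → Ω → ℝ} [MeasurableSpace Ω]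
  {P : Measure Ω} {ρ : ℝ}

theorem Environment.measure_isSome_eq_forcedRate [IsProbabilityMeasure P]
    (hE : Environment P ρ f ε) (a₀ : Arm dr dc) {u : ℕ} (hu : 1 ≤ u) :
    P {ω | (f u ω).isSome} = ENNReal.ofReal (forcedRate ρ u) := by
  have h1 : (dr : ℝ) ≠ 0 := by exact_mod_cast a₀.1.pos.ne'
  have h2 : (dc : ℝ) ≠ 0 := by exact_mod_cast a₀.2.pos.ne'
  rw [hE.measure_isSome a₀ hu, ← ENNReal.ofReal_natCast,
    ← ENNReal.ofReal_mul (Nat.cast_nonneg _), forcedProb, forcedRate]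
  congr 1
  push_cast
  split_ifs
  · field_simp
  · rw [← mul_div_assoc, mul_div_mul_left _ _ (mul_ne_zero h1 h2)]

theorem Environment.measure_isNone_eq [IsProbabilityMeasure P] (hρ : 32 ≤ ρ)
    (hE : Environment P ρ f ε) (a₀ : Arm dr dc) {u : ℕ} (hu : 1 ≤ u) :
    P {ω | f u ω = none} = ENNReal.ofReal (1 - forcedRate ρ u) := by
  have h1 : {ω | f u ω = none} = {ω | (f u ω).isSome}ᶜ := by
    ext ω
    rw [Set.mem_compl_iff, Set.mem_ofPred_eq, Set.mem_ofPred_eq]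
    cases f u ω <;> simp
  rw [h1, prob_compl_eq_one_sub (hE.measurableSet_forced u fun o => o.isSome),
    hE.measure_isSome_eq_forcedRate a₀ hu, ENNReal.ofReal_sub _ (forcedRate_nonneg hρ u),
    ENNReal.ofReal_one]

theorem Environment.forcedRate_le_one [IsProbabilityMeasure P]
    (hE : Environment P ρ f ε) (a₀ : Arm dr dc) {u : ℕ} (hu : 1 ≤ u) : forcedRate ρ u ≤ 1 := by
  rw [← ENNReal.ofReal_le_one, ← hE.measure_isSome_eq_forcedRate a₀ hu]
  exact prob_le_one

/-- The number of forced samples is unlikely to be much smaller than its expectation. -/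
theorem Environment.measure_card_forcedTimes_le [IsProbabilityMeasure P] (hρ : 32 ≤ ρ)
    (hE : Environment P ρ f ε) (a₀ : Arm dr dc) (t : ℕ) (x : ℝ) :
    P {ω | ((forcedTimes f t ω).card : ℝ) ≤ x} ≤
      ENNReal.ofReal (Real.exp (x - 5 / 8 * ∑ u ∈ Finset.Ico 1 t, forcedRate ρ u)) := by
  let φ : ℕ → Option (Arm dr dc) → ℝ := fun u o =>
    5 / 8 * forcedRate ρ u - if o.isSome then 1 else 0
  let g : ℕ → Option (Arm dr dc) → ℝ≥0∞ := fun u o => ENNReal.ofReal (Real.exp (φ u o))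
  have hsum : ∀ ω, ∑ u ∈ Finset.Ico 1 t, φ u (f u ω) =
      5 / 8 * ∑ u ∈ Finset.Ico 1 t, forcedRate ρ u - ((forcedTimes f t ω).card : ℝ) := fun ω => by
    rw [Finset.sum_sub_distrib, ← Finset.mul_sum, Finset.sum_boole]
    rfl
  have hφ : ∀ u, Measurable fun ω => φ u (f u ω) := fun u =>
    (measurable_from_top (f := φ u)).comp (hE.measurable_forced u)
  have hone : ∀ u ∈ Finset.Ico 1 t, ∫⁻ ω, g u (f u ω) ∂P ≤ 1 := by
    intro u hu
    have hu1 : 1 ≤ u := (Finset.mem_Ico.1 hu).1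
    set q := forcedRate ρ u
    have hq0 : 0 ≤ q := forcedRate_nonneg hρ u
    have hq1 : q ≤ 1 := hE.forcedRate_le_one a₀ hu1
    have hsome := hE.measure_isSome_eq_forcedRate a₀ hu1
    have hnone := hE.measure_isNone_eq hρ a₀ hu1
    have hms := hE.measurableSet_forced u fun o => o.isSome
    have hmn := hE.measurableSet_forced u fun o => o = none
    have hsplit : ∀ ω, g u (f u ω) =
        Set.indicator {ω | (f u ω).isSome} (fun _ => ENNReal.ofReal (Real.exp (5 / 8 * q - 1))) ω +
        Set.indicator {ω | f u ω = none} (fun _ => ENNReal.ofReal (Real.exp (5 / 8 * q))) ω := by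
      intro ω
      simp only [Set.indicator, Set.mem_ofPred_eq, g, φ]
      rcases f u ω with _ | a <;> simp [q]
    simp only [hsplit]
    rw [lintegral_add_left (measurable_const.indicator hms), lintegral_indicator_const hms,
      lintegral_indicator_const hmn, hsome, hnone, ← ENNReal.ofReal_mul (Real.exp_pos _).le,
      ← ENNReal.ofReal_mul (Real.exp_pos _).le, ← ENNReal.ofReal_add (by positivity)
      (mul_nonneg (Real.exp_pos _).le (by linarith)), ENNReal.ofReal_le_one]
    have h1 : Real.exp (5 / 8 * q - 1) = Real.exp (5 / 8 * q) * Real.exp (-1) := by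
      rw [← Real.exp_add]; ring_nf
    have h2 : Real.exp (-1) ≤ 3 / 8 := by
      have := Real.exp_neg_one_lt_d9
      linarith
    have h3 : 1 - 5 / 8 * q ≤ Real.exp (-(5 / 8 * q)) := by
      have := Real.add_one_le_exp (-(5 / 8 * q))
      linarith
    rw [h1]
    calc Real.exp (5 / 8 * q) * Real.exp (-1) * q + Real.exp (5 / 8 * q) * (1 - q) =
          Real.exp (5 / 8 * q) * (Real.exp (-1) * q + (1 - q)) := by ring
      _ ≤ Real.exp (5 / 8 * q) * Real.exp (-(5 / 8 * q)) := by
        gcongr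
        nlinarith
      _ = 1 := by rw [← Real.exp_add]; simp
  have hint : ∫⁻ ω, ENNReal.ofReal (Real.exp (∑ u ∈ Finset.Ico 1 t, φ u (f u ω))) ∂P ≤ 1 := by
    have hind : iIndepFun (fun u ω => g u (f u ω)) P :=
      hE.indep_time.comp (fun u p => g u p.1) fun u =>
        (measurable_from_top (f := g u)).comp measurable_fst
    simp only [Real.exp_sum, ENNReal.ofReal_prod_of_nonneg fun _ _ => (Real.exp_pos _).le]
    rw [lintegral_prod_eq_prod_lintegral_of_indepFun _ _ hind
      fun u => (measurable_from_top (f := g u)).comp (hE.measurable_forced u)]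
    exact Finset.prod_le_one' hone
  have h := measure_le_exp_neg_of_lintegral_exp_le_one
    (Finset.measurable_sum _ fun u _ => hφ u) hint
    (5 / 8 * ∑ u ∈ Finset.Ico 1 t, forcedRate ρ u - x)
  rw [neg_sub] at h
  refine le_trans (measure_mono fun ω hω => ?_) h
  rw [Set.mem_ofPred_eq] at hω ⊢
  rw [hsum]
  linarith

/-- All periods of the initialization are forced-sampling periods, almost surely. -/
theorem Environment.measure_forcedTimes_eq_zero [IsProbabilityMeasure P] (hρ : 32 ≤ ρ)
    (hE : Environment P ρ f ε) (a₀ : Arm dr dc) {t : ℕ} (ht : 2 * ρ * Real.log ρ < t)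
    {S : Finset ℕ} (hS : S ⊆ Finset.Ico 1 t) (hcard : (S.card : ℝ) ≤ 2 * ρ * Real.log ρ - 1) :
    P {ω | forcedTimes f t ω = S} = 0 := by
  have hl3 := three_le_log hρ
  set N := ⌊2 * ρ * Real.log ρ⌋₊ with hN
  have hN1 : (N : ℝ) ≤ 2 * ρ * Real.log ρ := Nat.floor_le (by positivity)
  have hN2 : 2 * ρ * Real.log ρ < N + 1 := Nat.lt_floor_add_one _
  have hNt : N < t := by
    have : (N : ℝ) < t := by linarith
    exact_mod_cast this
  obtain ⟨u, hu, huS⟩ : ∃ u ∈ Finset.Ico 1 (N + 1), u ∉ S := by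
    by_contra hcon
    push Not at hcon
    have h1 := Finset.card_le_card (s := Finset.Ico 1 (N + 1)) (t := S) hcon
    rw [Nat.card_Ico, Nat.add_sub_cancel] at h1
    have h2 : (N : ℝ) ≤ S.card := by exact_mod_cast h1
    linarith
  rw [Finset.mem_Ico] at hu
  have huN : (u : ℝ) ≤ N := by exact_mod_cast Nat.lt_succ_iff.1 hu.2
  refine measure_mono_null (t := {ω | f u ω = none}) (fun ω hω => ?_) ?_
  · rw [Set.mem_ofPred_eq, forcedTimes_eq_iff hS] at hω
    have := (hω u (Finset.mem_Ico.2 ⟨hu.1, by omega⟩)).not.2 huS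
    rw [Set.mem_ofPred_eq]
    simpa using this
  · rw [hE.measure_isNone_eq hρ a₀ hu.1, forcedRate, if_pos (by linarith), sub_self,
      ENNReal.ofReal_zero]

end Forced

/-! ### Accuracy of the forced-sample estimate -/

/-- The sample-size condition of the tail bound holds for half of the initialization. -/
theorem half_mul_log_le {ρ m : ℝ} (hρ : 32 ≤ ρ) (hm : ρ * Real.log ρ - 1 ≤ m) :
    ρ / 2 * Real.log m ≤ m := by
  have hl3 := three_le_log hρ
  set l := Real.log ρ with hl
  have hL : 0 < ρ * l := by positivity
  have hm0 : 0 < m := by nlinarith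
  -- the tangent of the logarithm at `ρ log ρ`
  have h1 : Real.log m ≤ l + Real.log l + m / (ρ * l) - 1 := by
    have h2 := Real.log_le_sub_one_of_pos (show 0 < m / (ρ * l) by positivity)
    rw [Real.log_div hm0.ne' hL.ne', Real.log_mul (by positivity) (by positivity)] at h2
    linarith
  have h3 : Real.log l ≤ l - 1 := Real.log_le_sub_one_of_pos (by linarith)
  have h4 : ρ / 2 * Real.log m ≤ ρ / 2 * (2 * l - 2) + m / (2 * l) := by
    calc ρ / 2 * Real.log m ≤ ρ / 2 * (2 * l - 2 + m / (ρ * l)) := by gcongr; linarith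
      _ = _ := by field_simp
  have h5 : m / (2 * l) ≤ m - (ρ * l - ρ) := by
    rw [div_le_iff₀ (by positivity)]
    nlinarith
  linarith

theorem exp_neg_two_mul_log {t : ℕ} (ht : 0 < t) :
    Real.exp (-(2 * Real.log t)) = 1 / (t : ℝ) ^ 2 := by
  have h0 : (0 : ℝ) < t := by exact_mod_cast ht
  rw [Real.exp_neg, ← Real.log_rpow h0, Real.exp_log (by positivity)]
  norm_num

section Sample

variable (B : Matrix (Fin dr) (Fin dc) ℝ) {ρ α₁ α₂ h : ℝ}

/-- The failure probability of the row-enhanced estimator on a sample of the size that is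
available at time `t`. -/
theorem sampleLaw_estimate_error_le_of_card [Nonempty (Arm dr dc)] (hB : B ≠ 0)
    {Bbar Bhat : Estimator dr dc} (hBbar : Bbar.IsMeasurable)
    (hhat : ∀ (n : ℕ) (D : Sample dr dc n), IsRowEnhancement B.rank Bbar D (Bhat n D))
    (hh : 0 < h) (hρ : 32 ≤ ρ) {γ : ℝ} (hγ : γ = h * leastSingularValue B / (64 * rowNorm B))
    (hα₁ : 0 < α₁) (hρα : α₂ * (1 + (γ ^ 2)⁻¹) * B.rank * (dr + dc) = ρ / 2)
    (hρK : 16 * (dr * dc : ℝ) ^ 2 ≤ ρ)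
    (hργ : 16 * ((dr + dc) * B.rank) ≤ α₁ * γ ^ 2 * ρ)
    (hρh : 131072 * (dr * dc) * dc ≤ ρ * h ^ 2)
    {ν : ℕ → Measure ℝ} [∀ u, IsProbabilityMeasure (ν u)]
    (hν : ∀ u, HasSubgaussianMGF id 1 (ν u)) (htail : TailBound B B.rank α₁ α₂ Bbar ν)
    {t : ℕ} (ht : 2 * ρ * Real.log ρ < t) {n : ℕ} {τ : Fin n → ℕ} (hτ : StrictMono τ)
    (hτ1 : ∀ i, 1 ≤ τ i) (hn1 : 2 * ρ * Real.log ρ - 1 < n) (hn2 : ρ / 2 * Real.log t < n) :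
    sampleLaw B (fun i => ν (τ i))
        {D | ∃ a : Arm dr dc, h / 4 < |Bhat n D a.1 a.2 - B a.1 a.2|} ≤
      ENNReal.ofReal ((1 + 4 * (dr * dc)) * (1 / (t : ℝ) ^ 2)) := by
  have a₀ : Arm dr dc := Classical.arbitrary _
  have hdr : (0 : ℝ) < dr := by exact_mod_cast a₀.1.pos
  have hdc : (0 : ℝ) < dc := by exact_mod_cast a₀.2.pos
  have hl3 := three_le_log hρ
  have hR := rowNorm_pos hB
  have hD := leastSingularValue_pos hB
  have hγ0 : 0 < γ := by rw [hγ]; positivity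
  have hr : (0 : ℝ) < B.rank := by
    exact_mod_cast Nat.pos_of_ne_zero (rank_ne_zero hB)
  have ht1 : ρ < t := by nlinarith
  have ht0 : 0 < t := by
    have : (0 : ℝ) < t := by linarith
    exact_mod_cast this
  have hlt : 3 ≤ Real.log t := hl3.trans (Real.log_le_log (by linarith) ht1.le)
  have hn0 : 0 < n := by
    have : (0 : ℝ) < n := lt_of_le_of_lt (by positivity) hn2
    exact_mod_cast this
  have hhalf : ((n : ℝ) - 1) / 2 ≤ ((n / 2 : ℕ) : ℝ) := by
    have : n ≤ 2 * (n / 2) + 1 := by omega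
    have : (n : ℝ) ≤ 2 * ((n / 2 : ℕ) : ℝ) + 1 := by exact_mod_cast this
    linarith
  have hsecond : (n : ℝ) / 2 ≤ ((n - n / 2 : ℕ) : ℝ) := by
    have : n ≤ 2 * (n - n / 2) := by omega
    have : (n : ℝ) ≤ 2 * ((n - n / 2 : ℕ) : ℝ) := by exact_mod_cast this
    linarith
  set k : ℝ := ((n / 2 : ℕ) : ℝ) with hk
  set m : ℝ := ((n - n / 2 : ℕ) : ℝ) with hm
  set l := Real.log t with hl
  have hk1 : ρ * Real.log ρ - 1 ≤ k := by linarith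
  have hρl : 32 * 3 ≤ ρ * l := mul_le_mul hρ hlt (by norm_num) (by linarith)
  have hk2 : ρ / 8 * l ≤ k := by linarith
  have hm2 : ρ / 4 * l ≤ m := by linarith
  have hexp : ∀ x : ℝ, 2 * l ≤ x → ENNReal.ofReal (Real.exp (-x)) ≤
      ENNReal.ofReal (1 / (t : ℝ) ^ 2) := fun x hx => by
    rw [← exp_neg_two_mul_log ht0]
    exact ENNReal.ofReal_le_ofReal (Real.exp_le_exp.2 (neg_le_neg hx))
  have htailn : sampleLaw B (fun i : Fin (n / 2) => ν (τ (Fin.castLE (Nat.div_le_self n 2) i)))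
      {D | γ ≤ frobNorm (Bbar (n / 2) D - B)} ≤ ENNReal.ofReal (1 / (t : ℝ) ^ 2) := by
    refine le_trans (htail (n / 2) (fun i => τ (Fin.castLE (Nat.div_le_self n 2) i)) γ ?_
      (fun i j hij => hτ (by simpa using hij)) (fun i => hτ1 _) hγ0 ?_) (hexp _ ?_)
    · have : (2 : ℝ) ≤ ((n / 2 : ℕ) : ℝ) := by
        rw [← hk]
        nlinarith
      exact_mod_cast this
    · have hlog : 0 < Real.log k := Real.log_pos (by nlinarith)
      rw [hρα, le_div_iff₀ hlog]
      exact half_mul_log_le hρ hk1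
    · rw [le_div_iff₀ (by positivity)]
      calc 2 * l * ((dr + dc) * B.rank) = (16 * ((dr + dc) * B.rank)) * l / 8 := by ring
        _ ≤ (α₁ * γ ^ 2 * ρ) * l / 8 := by gcongr
        _ = α₁ * γ ^ 2 * (ρ / 8 * l) := by ring
        _ ≤ α₁ * γ ^ 2 * k := by gcongr
  have hcount : ENNReal.ofReal (Real.exp (-(m / (2 * (dr * dc) ^ 2)))) ≤
      ENNReal.ofReal (1 / (t : ℝ) ^ 2) := by
    refine hexp _ ?_
    rw [le_div_iff₀ (by positivity)]
    calc 2 * l * (2 * (dr * dc) ^ 2) = (16 * (dr * dc : ℝ) ^ 2) * l / 4 := by ring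
      _ ≤ ρ * l / 4 := by gcongr
      _ ≤ m := by linarith
  have hnoise : ENNReal.ofReal (Real.exp (-(m / (dr * dc) / 2 * (h / (64 * √dc)) ^ 2 / 2))) ≤
      ENNReal.ofReal (1 / (t : ℝ) ^ 2) := by
    refine hexp _ ?_
    have h1 : m / (dr * dc) / 2 * (h / (64 * √dc)) ^ 2 / 2 =
        m * h ^ 2 / (16384 * (dr * dc) * dc) := by
      rw [div_pow, mul_pow, Real.sq_sqrt hdc.le]
      field_simp
      ring
    rw [h1, le_div_iff₀ (by positivity)]
    calc 2 * l * (16384 * (dr * dc) * dc) = (131072 * (dr * dc) * dc) * l / 4 := by ring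
      _ ≤ (ρ * h ^ 2) * l / 4 := by gcongr
      _ = (ρ / 4 * l) * h ^ 2 := by ring
      _ ≤ m * h ^ 2 := by gcongr
  refine (sampleLaw_estimate_error_le B (fun i => ν (τ i)) (fun i => hν (τ i)) hB hBbar
    (hhat n) hh hn0).trans ?_
  rw [← hγ]
  calc _ ≤ ENNReal.ofReal (1 / (t : ℝ) ^ 2) +
        ((dr * dc : ℕ) * (2 * ENNReal.ofReal (1 / (t : ℝ) ^ 2)) +
          (dr * dc : ℕ) * (2 * ENNReal.ofReal (1 / (t : ℝ) ^ 2))) := by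
        gcongr
    _ = _ := by
      rw [ENNReal.ofReal_mul (by positivity), ENNReal.ofReal_add zero_le_one (by positivity),
        ENNReal.ofReal_mul (by norm_num), ← Nat.cast_mul (α := ℝ), ENNReal.ofReal_natCast,
        ENNReal.ofReal_one, ENNReal.ofReal_ofNat]
      ring

end Sample

section Forced

variable {Ω : Type*} {f : ℕ → Ω → Option (Arm dr dc)} {ε : ℕ → Ω → ℝ} {π : ℕ → Ω → Arm dr dc}
  {B : Matrix (Fin dr) (Fin dc) ℝ} {ρ α₁ α₂ h : ℝ}

theorem forcedSample_eq (hforced : ∀ t, 1 ≤ t → ∀ ω a, f t ω = some a → π t ω = a)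
    (a₀ : Arm dr dc) (t : ℕ) (ω : Ω) :
    forcedSample B f ε π t ω =
      fun i => forcedObs B f ε a₀ ((forcedTimes f t ω).orderEmbOfFin rfl i) ω := by
  funext i
  have hi := Finset.orderEmbOfFin_mem (forcedTimes f t ω) rfl i
  rw [mem_forcedTimes, Option.isSome_iff_exists] at hi
  obtain ⟨hu, a, ha⟩ := hi
  have hπ := hforced _ (Finset.mem_Ico.1 hu).1 ω a ha
  simp only [forcedSample, forcedObs, reward, ha, hπ, Option.getD_some]

/-- After the initialization, the forced-sample estimate misses the accuracy `h / 4` with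
probability `O(1 / t²)`. -/
theorem Environment.measure_forcedEstimate_error_le [MeasurableSpace Ω] {P : Measure Ω}
    [IsProbabilityMeasure P]
    (hE : Environment P ρ f ε) (hforced : ∀ t, 1 ≤ t → ∀ ω a, f t ω = some a → π t ω = a)
    (a₀ : Arm dr dc) (hB : B ≠ 0)
    {Bbar Bhat : Estimator dr dc} (hBbar : Bbar.IsMeasurable) (hBhat : Bhat.IsMeasurable)
    (hhat : ∀ (n : ℕ) (D : Sample dr dc n), IsRowEnhancement B.rank Bbar D (Bhat n D))
    (hh : 0 < h) (hρ : 32 ≤ ρ) {γ : ℝ} (hγ : γ = h * leastSingularValue B / (64 * rowNorm B))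
    (hα₁ : 0 < α₁) (hρα : α₂ * (1 + (γ ^ 2)⁻¹) * B.rank * (dr + dc) = ρ / 2)
    (hρK : 16 * (dr * dc : ℝ) ^ 2 ≤ ρ)
    (hργ : 16 * ((dr + dc) * B.rank) ≤ α₁ * γ ^ 2 * ρ)
    (hρh : 131072 * (dr * dc) * dc ≤ ρ * h ^ 2)
    (htail : TailBound B B.rank α₁ α₂ Bbar fun t => P.map (ε t))
    {t : ℕ} (ht : 2 * ρ * Real.log ρ < t) :
    P {ω | ∃ a : Arm dr dc, h / 4 < |forcedEstimate B f ε π Bhat t ω a.1 a.2 - B a.1 a.2|} ≤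
      ENNReal.ofReal ((2 + 4 * (dr * dc)) * (1 / (t : ℝ) ^ 2)) := by
  have : Nonempty (Arm dr dc) := ⟨a₀⟩
  have hν : ∀ u, IsProbabilityMeasure (P.map (ε u)) := fun u =>
    Measure.isProbabilityMeasure_map (hE.measurable_noise u).aemeasurable
  have hνsub : ∀ u, HasSubgaussianMGF id 1 (P.map (ε u)) := fun u =>
    (HasSubgaussianMGF.id_map_iff (hE.measurable_noise u).aemeasurable).2 (hE.subgaussian u)
  have hl3 := three_le_log hρ
  have ht1 : ρ < t := by nlinarith
  have ht0 : 0 < t := by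
    have : (0 : ℝ) < t := by linarith
    exact_mod_cast this
  have hlt : 3 ≤ Real.log t := hl3.trans (Real.log_le_log (by linarith) ht1.le)
  set x := ρ / 2 * Real.log t with hx
  let C : (n : ℕ) → Set (Sample dr dc n) := fun n =>
    {D | ∃ a : Arm dr dc, h / 4 < |Bhat n D a.1 a.2 - B a.1 a.2|}
  have hC : ∀ n, MeasurableSet (C n) := by
    intro n
    have : C n = ⋃ a : Arm dr dc, {D | h / 4 < |Bhat n D a.1 a.2 - B a.1 a.2|} := by
      ext D; simp [C]
    rw [this]
    exact MeasurableSet.iUnion fun a => measurableSet_lt measurable_const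
      ((hBhat n a.1 a.2).sub_const _).abs
  let F : Finset (Finset ℕ) := (Finset.Ico 1 t).powerset.filter fun S => x < S.card
  have hfew : P {ω | ((forcedTimes f t ω).card : ℝ) ≤ x} ≤ ENNReal.ofReal (1 / (t : ℝ) ^ 2) := by
    refine (hE.measure_card_forcedTimes_le hρ a₀ t x).trans (ENNReal.ofReal_le_ofReal ?_)
    rw [← exp_neg_two_mul_log ht0]
    refine Real.exp_le_exp.2 ?_
    have := mul_log_le_sum_forcedRate hρ ht
    rw [hx]
    nlinarith
  have hset : ∀ S ∈ F, P {ω | forcedTimes f t ω = S ∧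
      (fun i => forcedObs B f ε a₀ (S.orderEmbOfFin rfl i) ω) ∈ C S.card} ≤
      P {ω | forcedTimes f t ω = S} *
        ENNReal.ofReal ((1 + 4 * (dr * dc)) * (1 / (t : ℝ) ^ 2)) := by
    intro S hS
    obtain ⟨hS1, hS2⟩ := Finset.mem_filter.1 hS
    rw [Finset.mem_powerset] at hS1
    rw [hE.measure_forcedTimes_inter_sample B a₀ hS1 (hC _)]
    by_cases hcard : (S.card : ℝ) ≤ 2 * ρ * Real.log ρ - 1
    · rw [hE.measure_forcedTimes_eq_zero hρ a₀ ht hS1 hcard, zero_mul, zero_mul]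
    · gcongr
      exact sampleLaw_estimate_error_le_of_card B hB hBbar hhat hh hρ hγ hα₁ hρα hρK hργ hρh
        hνsub htail ht (S.orderEmbOfFin rfl).strictMono
        (fun i => (Finset.mem_Ico.1 (hS1 (Finset.orderEmbOfFin_mem S rfl i))).1)
        (not_le.1 hcard) hS2
  have hsum : ∑ S ∈ F, P {ω | forcedTimes f t ω = S} ≤ 1 := by
    rw [← measure_biUnion_finset]
    · exact prob_le_one
    · intro S _ S' _ hne
      refine Set.disjoint_left.2 fun ω h1 h2 => hne ?_
      exact (show forcedTimes f t ω = S from h1).symm.trans h2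
    · exact fun S _ => hE.measurableSet_forcedTimes_eq
  calc P _ ≤ P ({ω | ((forcedTimes f t ω).card : ℝ) ≤ x} ∪ ⋃ S ∈ F, {ω | forcedTimes f t ω = S ∧
        (fun i => forcedObs B f ε a₀ (S.orderEmbOfFin rfl i) ω) ∈ C S.card}) := by
        refine measure_mono fun ω hω => ?_
        rw [Set.mem_union]
        by_cases hc : ((forcedTimes f t ω).card : ℝ) ≤ x
        · exact Or.inl hc
        · right
          simp only [Set.mem_iUnion]
          refine ⟨forcedTimes f t ω, Finset.mem_filter.2
            ⟨Finset.mem_powerset.2 (Finset.filter_subset _ _), not_le.1 hc⟩, rfl, ?_⟩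
          rw [← forcedSample_eq hforced]
          exact hω
    _ ≤ _ := measure_union_le _ _
    _ ≤ ENNReal.ofReal (1 / (t : ℝ) ^ 2) + ∑ S ∈ F, P {ω | forcedTimes f t ω = S} *
          ENNReal.ofReal ((1 + 4 * (dr * dc)) * (1 / (t : ℝ) ^ 2)) := by
        refine add_le_add hfew ((measure_biUnion_finset_le _ _).trans (Finset.sum_le_sum hset))
    _ ≤ ENNReal.ofReal (1 / (t : ℝ) ^ 2) +
          1 * ENNReal.ofReal ((1 + 4 * (dr * dc)) * (1 / (t : ℝ) ^ 2)) := by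
        rw [← Finset.sum_mul]
        gcongr
    _ = _ := by
        rw [one_mul, ← ENNReal.ofReal_add (by positivity) (by positivity)]
        congr 1
        ring

/-- If the estimate is accurate to `h / 4`, the targeted set holds every best arm and only arms
that are at most `h` worse. -/
theorem targetSet_of_accurate {Bhat : Estimator dr dc} {t : ℕ} {ω : Ω}
    (hacc : ∀ a : Arm dr dc, |forcedEstimate B f ε π Bhat t ω a.1 a.2 - B a.1 a.2| ≤ h / 4) :
    (∀ a, armGap B a = 0 → a ∈ targetSet B f ε π Bhat h t ω) ∧
      ∀ a ∈ targetSet B f ε π Bhat h t ω, armGap B a ≤ h := by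
  set M := forcedEstimate B f ε π Bhat t ω
  have hle : ∀ (A : Matrix (Fin dr) (Fin dc) ℝ) (a : Arm dr dc), A a.1 a.2 ≤ maxEntry A :=
    fun A a => le_ciSup (f := fun a : Arm dr dc => A a.1 a.2) (Set.finite_range _).bddAbove a
  have hatt : ∀ (A : Matrix (Fin dr) (Fin dc) ℝ) (_ : Arm dr dc), ∃ b : Arm dr dc,
      A b.1 b.2 = maxEntry A := fun A a => by
    have : Nonempty (Arm dr dc) := ⟨a⟩
    exact exists_eq_ciSup_of_finite (f := fun a : Arm dr dc => A a.1 a.2)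
  constructor
  · intro a ha
    obtain ⟨b, hb⟩ := hatt M a
    have h1 := abs_le.1 (hacc a)
    have h2 := abs_le.1 (hacc b)
    have h3 := hle B b
    rw [armGap] at ha
    show maxEntry M - h / 2 ≤ M a.1 a.2
    linarith [h1.1, h2.2]
  · intro a ha
    have ha' : maxEntry M - h / 2 ≤ M a.1 a.2 := ha
    obtain ⟨b, hb⟩ := hatt B a
    have h1 := abs_le.1 (hacc a)
    have h2 := abs_le.1 (hacc b)
    have h3 := hle M b
    rw [armGap]
    linarith [h1.2, h2.1]

end Forced

/-! ### Exponential supermartingales of the played noise -/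

/-- If `m₁` is independent of `m₂ ⊔ m₃`, and `m₂` of `m₃`, then `m₁ ⊔ m₂` is independent of
`m₃`. -/
theorem indep_sup_left_of_indep {Ω : Type*} {m₁ m₂ m₃ m : MeasurableSpace Ω} {P : Measure[m] Ω}
    [IsProbabilityMeasure P] (h₁ : m₁ ≤ m) (h₂ : m₂ ≤ m) (h₃ : m₃ ≤ m)
    (h1 : Indep m₁ (m₂ ⊔ m₃) P) (h2 : Indep m₂ m₃ P) : Indep (m₁ ⊔ m₂) m₃ P := by
  let p : Set (Set Ω) := {s | ∃ A B, MeasurableSet[m₁] A ∧ MeasurableSet[m₂] B ∧ A ∩ B = s}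
  have hp : IsPiSystem p := by
    rintro _ ⟨A, B, hA, hB, rfl⟩ _ ⟨A', B', hA', hB', rfl⟩ -
    exact ⟨A ∩ A', B ∩ B', hA.inter hA', hB.inter hB', Set.inter_inter_inter_comm _ _ _ _⟩
  have hgen : m₁ ⊔ m₂ = MeasurableSpace.generateFrom p := by
    refine le_antisymm (sup_le ?_ ?_) (MeasurableSpace.generateFrom_le ?_)
    · exact fun A hA => MeasurableSpace.measurableSet_generateFrom
        ⟨A, Set.univ, hA, MeasurableSet.univ, Set.inter_univ A⟩
    · exact fun B hB => MeasurableSpace.measurableSet_generateFrom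
        ⟨Set.univ, B, MeasurableSet.univ, hB, Set.univ_inter B⟩
    · rintro _ ⟨A, B, hA, hB, rfl⟩
      exact MeasurableSet.inter ((le_sup_left : m₁ ≤ m₁ ⊔ m₂) A hA)
        ((le_sup_right : m₂ ≤ m₁ ⊔ m₂) B hB)
  refine IndepSets.indep (sup_le h₁ h₂) h₃ hp (@MeasurableSpace.isPiSystem_measurableSet Ω m₃)
    hgen (@MeasurableSpace.generateFrom_measurableSet Ω m₃).symm ?_
  rw [IndepSets_iff]
  rintro _ C ⟨A, B, hA, hB, rfl⟩ hC
  rw [Indep_iff] at h1 h2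
  have hB' := (le_sup_left : m₂ ≤ m₂ ⊔ m₃) B hB
  have hC' := (le_sup_right : m₃ ≤ m₂ ⊔ m₃) C hC
  rw [Set.inter_assoc, h1 A (B ∩ C) hA (hB'.inter hC'), h2 B C hB hC, h1 A B hA hB', mul_assoc]

section History

variable {Ω : Type*} {f : ℕ → Ω → Option (Arm dr dc)} {ε : ℕ → Ω → ℝ}

theorem history_mono {s t : ℕ} (hst : s ≤ t) : history f ε s ≤ history f ε t := by
  refine sup_le_sup ?_ ?_
  · exact biSup_mono fun i hi => ⟨hi.1, hi.2.trans hst⟩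
  · exact biSup_mono fun i hi => ⟨hi.1, hi.2.trans_le hst⟩

theorem measurable_noise_history {s t : ℕ} (hs : 1 ≤ s) (hst : s < t) :
    Measurable[history f ε t] (ε s) := by
  refine Measurable.of_comap_le (le_sup_of_le_right ?_)
  exact le_biSup (fun s => MeasurableSpace.comap (ε s) inferInstance) (Set.mem_Ico.2 ⟨hs, hst⟩)

/-- The logarithm of the exponential process of the noise in the periods selected by `H`. -/
def logProcess (ε : ℕ → Ω → ℝ) (H : ℕ → Set Ω) (l : ℝ) (t : ℕ) (ω : Ω) : ℝ :=
  ∑ s ∈ Finset.Ico 1 t, (H s).indicator (fun ω => l * ε s ω - l ^ 2 / 2) ω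

theorem measurable_logProcess {H : ℕ → Set Ω}
    (hH : ∀ s, 1 ≤ s → MeasurableSet[history f ε s] (H s)) (l : ℝ) (t : ℕ) :
    Measurable[history f ε t] (logProcess ε H l t) := by
  refine Finset.measurable_sum _ fun s hs => ?_
  rw [Finset.mem_Ico] at hs
  refine Measurable.indicator ?_ (history_mono hs.2.le _ (hH s hs.1))
  exact ((measurable_noise_history hs.1 hs.2).const_mul l).sub_const _

variable [mΩ : MeasurableSpace Ω] {P : Measure Ω} {ρ : ℝ}

theorem Environment.history_le (hE : Environment P ρ f ε) (t : ℕ) : history f ε t ≤ mΩ :=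
  sup_le (iSup₂_le fun s _ => (hE.measurable_forced s).comap_le)
    (iSup₂_le fun s _ => (hE.measurable_noise s).comap_le)

/-- The noise at time `t` is independent of what is known when the arm of time `t` is chosen. -/
theorem Environment.indep_history_noise [IsProbabilityMeasure P] (hE : Environment P ρ f ε)
    (t : ℕ) : Indep (history f ε t) (MeasurableSpace.comap (ε t) inferInstance) P := by
  let M : ℕ → MeasurableSpace Ω := fun s =>
    MeasurableSpace.comap (fun ω => (f s ω, ε s ω)) inferInstance
  have hM : ∀ s, M s ≤ mΩ := fun s =>
    ((hE.measurable_forced s).prodMk (hE.measurable_noise s)).comap_le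
  have hf : ∀ s, MeasurableSpace.comap (f s) inferInstance ≤ M s := fun s => by
    rintro _ ⟨A, hA, rfl⟩
    exact ⟨Prod.fst ⁻¹' A, measurable_fst hA, rfl⟩
  have hε : ∀ s, MeasurableSpace.comap (ε s) inferInstance ≤ M s := fun s => by
    rintro _ ⟨A, hA, rfl⟩
    exact ⟨Prod.snd ⁻¹' A, measurable_snd hA, rfl⟩
  have hpast : Indep (⨆ s ∈ Set.Ico 1 t, M s) (M t) P := by
    have h1 := indep_iSup_of_disjoint hM hE.indep_time (S := Set.Ico 1 t) (T := {t})
      (by simp)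
    simpa using h1
  have h2 := indep_sup_left_of_indep (m := mΩ) (iSup₂_le fun s _ => hM s) ((hf t).trans (hM t))
    ((hε t).trans (hM t)) (indep_of_indep_of_le_right hpast (sup_le (hf t) (hε t)))
    (hE.indep_forced_noise t)
  refine indep_of_indep_of_le_left h2 (sup_le (iSup₂_le fun s hs => ?_) (iSup₂_le fun s hs => ?_))
  · rcases hs.2.eq_or_lt with h | h
    · rw [h]
      exact le_sup_right
    · exact le_sup_of_le_left ((hf s).trans (le_biSup M (Set.mem_Ico.2 ⟨hs.1, h⟩)))
  · exact le_sup_of_le_left ((hε s).trans (le_biSup M hs))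

/-- The exponential process of the noise in periods that are selected without looking into the
future is a supermartingale. -/
theorem Environment.lintegral_exp_logProcess_le [IsProbabilityMeasure P]
    (hE : Environment P ρ f ε) {H : ℕ → Set Ω}
    (hH : ∀ s, 1 ≤ s → MeasurableSet[history f ε s] (H s)) (l : ℝ) (t : ℕ) :
    ∫⁻ ω, ENNReal.ofReal (Real.exp (logProcess ε H l t ω)) ∂P ≤ 1 := by
  induction t with
  | zero => simp [logProcess]
  | succ t ih =>
    rcases Nat.eq_zero_or_pos t with rfl | ht
    · simp [logProcess]
    have hle := hE.history_le t
    let X : Ω → ℝ≥0∞ := fun ω => ENNReal.ofReal (Real.exp (logProcess ε H l t ω))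
    have hX : Measurable[history f ε t] X := by
      exact ENNReal.measurable_ofReal.comp
        (Real.measurable_exp.comp (measurable_logProcess hH l t))
    let Y : Ω → ℝ≥0∞ := fun ω => ENNReal.ofReal (Real.exp (l * ε t ω - l ^ 2 / 2))
    have hY : Measurable[MeasurableSpace.comap (ε t) inferInstance] Y := by
      have : Measurable fun x : ℝ => ENNReal.ofReal (Real.exp (l * x - l ^ 2 / 2)) := by fun_prop
      exact this.comp (comap_measurable (ε t))
    have hHt := hH t ht
    have hsplit : ∀ ω, ENNReal.ofReal (Real.exp (logProcess ε H l (t + 1) ω)) =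
        (H t).indicator X ω * Y ω + (H t)ᶜ.indicator X ω := by
      intro ω
      have h1 : logProcess ε H l (t + 1) ω = logProcess ε H l t ω +
          (H t).indicator (fun ω => l * ε t ω - l ^ 2 / 2) ω := by
        rw [logProcess, Finset.sum_Ico_succ_top ht]
        rfl
      rw [h1]
      by_cases hω : ω ∈ H t
      · simp only [Set.indicator_of_mem hω, Set.indicator_of_notMem (Set.notMem_compl_iff.2 hω),
          add_zero]
        rw [Real.exp_add, ENNReal.ofReal_mul (Real.exp_pos _).le]
      · simp only [Set.indicator_of_notMem hω, Set.indicator_of_mem (Set.mem_compl hω), add_zero,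
          zero_mul, zero_add]
        rfl
    have hXH : Measurable[history f ε t] ((H t).indicator X) := hX.indicator hHt
    have hXHc : Measurable ((H t)ᶜ.indicator X) := (hX.indicator hHt.compl).mono hle le_rfl
    simp only [hsplit]
    rw [lintegral_add_right _ hXHc,
      lintegral_mul_eq_lintegral_mul_lintegral_of_independent_measurableSpace hle
        (hE.measurable_noise t).comap_le (hE.indep_history_noise t) hXH hY]
    calc _ ≤ (∫⁻ ω, (H t).indicator X ω ∂P) * 1 + ∫⁻ ω, (H t)ᶜ.indicator X ω ∂P := by
          gcongr
          exact lintegral_exp_subgaussian_le (hE.subgaussian t) l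
      _ = ∫⁻ ω, X ω ∂P := by
        rw [mul_one, ← lintegral_add_right _ hXHc]
        refine lintegral_congr fun ω => ?_
        by_cases hω : ω ∈ H t <;> simp [hω]
      _ ≤ 1 := ih

end History

/-! ### Counting plays -/

section Plays

variable {Ω : Type*} {f : ℕ → Ω → Option (Arm dr dc)} {ε : ℕ → Ω → ℝ} {π : ℕ → Ω → Arm dr dc}

theorem mem_playTimes {a : Arm dr dc} {t s : ℕ} {ω : Ω} :
    s ∈ playTimes π a t ω ↔ s ∈ Finset.Ico 1 t ∧ π s ω = a := by
  simp [playTimes]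

theorem playTimes_mono {a : Arm dr dc} {s t : ℕ} (hst : s ≤ t) (ω : Ω) :
    playTimes π a s ω ⊆ playTimes π a t ω :=
  Finset.filter_subset_filter _ (Finset.Ico_subset_Ico_right hst)

theorem card_playTimes_succ {a : Arm dr dc} {t : ℕ} (ht : 1 ≤ t) (ω : Ω) :
    (playTimes π a (t + 1) ω).card =
      (playTimes π a t ω).card + if π t ω = a then 1 else 0 := by
  rw [playTimes, Finset.card_filter, Finset.sum_Ico_succ_top ht, ← Finset.card_filter]
  rfl

theorem card_playTimes_lt {a : Arm dr dc} {s t : ℕ} {ω : Ω} (hs : 1 ≤ s) (hst : s < t)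
    (ha : π s ω = a) : (playTimes π a s ω).card < (playTimes π a t ω).card := by
  have h1 := card_playTimes_succ (π := π) (a := a) hs ω
  have h2 := Finset.card_le_card (playTimes_mono (π := π) (a := a) (Nat.succ_le_of_lt hst) ω)
  rw [if_pos ha] at h1
  exact Nat.lt_of_succ_le (h1.symm.le.trans h2)

theorem card_playTimes_le_sub_one (a : Arm dr dc) (t : ℕ) (ω : Ω) :
    (playTimes π a t ω).card ≤ t - 1 := by
  refine (Finset.card_filter_le _ _).trans ?_
  rw [Nat.card_Ico]

theorem sum_card_playTimes (T : ℕ) (ω : Ω) :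
    ∑ a, (playTimes π a (T + 1) ω).card = T := by
  simp only [playTimes]
  rw [← Finset.card_eq_sum_card_fiberwise (fun _ _ => Finset.mem_univ _), Nat.card_Ico,
    Nat.add_sub_cancel]

/-- A sum over time of a function of the arm played and the number of its earlier plays. -/
theorem sum_plays_eq (ψ : Arm dr dc → ℕ → ℝ) (T : ℕ) (ω : Ω) :
    ∑ t ∈ Finset.Ico 1 (T + 1), ψ (π t ω) (playTimes π (π t ω) t ω).card =
      ∑ a, ∑ n ∈ Finset.range (playTimes π a (T + 1) ω).card, ψ a n := by
  induction T with
  | zero => simp [playTimes]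
  | succ T ih =>
    rw [Finset.sum_Ico_succ_top (by omega), ih]
    have h1 : ∀ a, ∑ n ∈ Finset.range (playTimes π a (T + 1 + 1) ω).card, ψ a n =
        ∑ n ∈ Finset.range (playTimes π a (T + 1) ω).card, ψ a n +
          if π (T + 1) ω = a then ψ a (playTimes π a (T + 1) ω).card else 0 := fun a => by
      rw [card_playTimes_succ (by omega)]
      split_ifs with h
      · rw [Finset.sum_range_succ]
      · rw [add_zero, add_zero]
    simp only [h1, Finset.sum_add_distrib, Finset.sum_ite_eq, Finset.mem_univ, if_true]

theorem measurable_card_playTimes (hπ : ∀ t, 1 ≤ t → Measurable[history f ε t] (π t))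
    (a : Arm dr dc) (t : ℕ) :
    Measurable[history f ε t] fun ω => (playTimes π a t ω).card := by
  simp only [playTimes, Finset.card_filter]
  refine Finset.measurable_sum _ fun s hs => ?_
  rw [Finset.mem_Ico] at hs
  refine Measurable.ite ?_ measurable_const measurable_const
  exact history_mono hs.2.le _ (hπ s hs.1 (measurableSet_singleton a))

/-- The event that arm `a` is played at time `s`, and was played fewer than `n` times before. -/
def earlyPlay (π : ℕ → Ω → Arm dr dc) (a : Arm dr dc) (n s : ℕ) : Set Ω :=
  {ω | π s ω = a ∧ (playTimes π a s ω).card < n}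

theorem measurableSet_earlyPlay (hπ : ∀ t, 1 ≤ t → Measurable[history f ε t] (π t))
    (a : Arm dr dc) (n s : ℕ) (hs : 1 ≤ s) :
    MeasurableSet[history f ε s] (earlyPlay π a n s) :=
  MeasurableSet.inter (hπ s hs (measurableSet_singleton a))
    (measurable_card_playTimes hπ a s (show MeasurableSet {k | k < n} from trivial))

theorem logProcess_play (a : Arm dr dc) (l : ℝ) (t : ℕ) (ω : Ω) :
    logProcess ε (fun s => {ω | π s ω = a}) l t ω =
      l * ∑ s ∈ playTimes π a t ω, ε s ω - l ^ 2 / 2 * (playTimes π a t ω).card := by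
  have h1 : logProcess ε (fun s => {ω | π s ω = a}) l t ω =
      ∑ s ∈ playTimes π a t ω, (l * ε s ω - l ^ 2 / 2) := by
    rw [playTimes, Finset.sum_filter]
    exact Finset.sum_congr rfl fun s _ => Set.indicator_apply _ _ _
  rw [h1, Finset.sum_sub_distrib, ← Finset.mul_sum, Finset.sum_const, nsmul_eq_mul]
  ring

/-- As long as arm `a` was played `n` times, its noise so far is the noise of its first `n` plays,
which later plays do not change. -/
theorem logProcess_earlyPlay {a : Arm dr dc} {n t T : ℕ} {ω : Ω} (ht : t ≤ T)
    (hn : (playTimes π a t ω).card = n) (l : ℝ) :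
    logProcess ε (earlyPlay π a n) l (T + 1) ω =
      l * ∑ s ∈ playTimes π a t ω, ε s ω - l ^ 2 / 2 * n := by
  have hset : (Finset.Ico 1 (T + 1)).filter (fun s => π s ω = a ∧ (playTimes π a s ω).card < n) =
      playTimes π a t ω := by
    ext s
    rw [mem_playTimes, Finset.mem_filter, Finset.mem_Ico, Finset.mem_Ico]
    constructor
    · rintro ⟨⟨h1, h2⟩, h3, h4⟩
      refine ⟨⟨h1, ?_⟩, h3⟩
      by_contra hts
      have := Finset.card_le_card (playTimes_mono (π := π) (a := a) (not_lt.1 hts) ω)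
      omega
    · rintro ⟨⟨h1, h2⟩, h3⟩
      exact ⟨⟨h1, by omega⟩, h3, hn ▸ card_playTimes_lt h1 h2 h3⟩
  have h1 : logProcess ε (earlyPlay π a n) l (T + 1) ω =
      ∑ s ∈ playTimes π a t ω, (l * ε s ω - l ^ 2 / 2) := by
    classical
    rw [← hset, Finset.sum_filter]
    exact Finset.sum_congr rfl fun s _ =>
      (Set.indicator_apply _ _ _).trans (if_congr Iff.rfl rfl rfl)
  rw [h1, Finset.sum_sub_distrib, ← Finset.mul_sum, Finset.sum_const, nsmul_eq_mul, hn]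
  ring

end Plays

/-! ### The regret of the confidence bounds -/

/-- The event that the average noise of the first `n` plays of arm `a` exceeds the exploration
bonus at the horizon `T`. -/
def overestimated {Ω : Type*} (ε : ℕ → Ω → ℝ) (π : ℕ → Ω → Arm dr dc) (T : ℕ) (a : Arm dr dc)
    (n : ℕ) : Set Ω :=
  {ω | Real.log T ≤ logProcess ε (earlyPlay π a n) √(2 * Real.log T / n) (T + 1) ω}

/-- An upper bound for the amount by which the index of arm `a` at time `t` falls below the mean
of the arm: a sum over the possible numbers `n` of plays. For each of them the exponential process
of the noise is taken at the exponent `-√(2 log t / n)`, and scaled. -/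
def shortfall {Ω : Type*} (ε : ℕ → Ω → ℝ) (π : ℕ → Ω → Arm dr dc) (a : Arm dr dc) (t : ℕ) (ω : Ω) :
    ℝ :=
  ∑ n ∈ Finset.Ico 1 t, 1 / (√(2 * n * Real.log t) * t) *
    Real.exp (logProcess ε (fun s => {ω | π s ω = a}) (-√(2 * Real.log t / n)) t ω)

theorem sum_one_div_sqrt_le (N : ℕ) :
    ∑ n ∈ Finset.Ico 1 (N + 1), 1 / √(n : ℝ) ≤ 2 * √(N : ℝ) := by
  induction N with
  | zero => simp
  | succ N ih =>
    rw [Finset.sum_Ico_succ_top (by omega)]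
    have h1 : 1 / √((N + 1 : ℕ) : ℝ) ≤ 2 * √((N + 1 : ℕ) : ℝ) - 2 * √(N : ℝ) := by
      have hp : (0 : ℝ) < √((N + 1 : ℕ) : ℝ) := by positivity
      rw [div_le_iff₀ hp]
      have h2 := Real.sq_sqrt (show (0 : ℝ) ≤ ((N + 1 : ℕ) : ℝ) by positivity)
      have h3 := Real.sq_sqrt (show (0 : ℝ) ≤ (N : ℝ) by positivity)
      push_cast at h2 ⊢
      nlinarith [sq_nonneg (√((N : ℝ) + 1) - √(N : ℝ))]
    linarith

section UCB

variable {Ω : Type*} {f : ℕ → Ω → Option (Arm dr dc)} {ε : ℕ → Ω → ℝ} {π : ℕ → Ω → Arm dr dc}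

theorem shortfall_nonneg (a : Arm dr dc) (t : ℕ) (ω : Ω) : 0 ≤ shortfall ε π a t ω :=
  Finset.sum_nonneg fun _ _ => by positivity

/-- The shortfall of the index is at most one of the terms of `shortfall`: with `c` the bonus and
`n` the number of plays it is `(-c S - n c²) / (n c)`, and `x ≤ exp x`. -/
theorem le_shortfall {a : Arm dr dc} {t : ℕ} (ht : 2 ≤ t) {ω : Ω}
    (hn : (playTimes π a t ω).card ≠ 0) :
    -(∑ s ∈ playTimes π a t ω, ε s ω) / (playTimes π a t ω).card -
      √(2 * Real.log t / (playTimes π a t ω).card) ≤ shortfall ε π a t ω := by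
  set n := (playTimes π a t ω).card with hn_def
  set S := ∑ s ∈ playTimes π a t ω, ε s ω with hS
  have hn0 : (0 : ℝ) < n := by exact_mod_cast Nat.pos_of_ne_zero hn
  have ht0 : (0 : ℝ) < t := by
    have : 0 < t := by omega
    exact_mod_cast this
  have hl : 0 < Real.log t := Real.log_pos (by exact_mod_cast ht)
  have hmem : n ∈ Finset.Ico 1 t := by
    have := card_playTimes_le_sub_one (π := π) a t ω
    rw [Finset.mem_Ico]
    omega
  refine le_trans ?_ (Finset.single_le_sum (f := fun n : ℕ => 1 / (√(2 * n * Real.log t) * t) *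
    Real.exp (logProcess ε (fun s => {ω | π s ω = a}) (-√(2 * Real.log t / n)) t ω))
    (fun _ _ => by positivity) hmem)
  rw [logProcess_play, ← hS, ← hn_def]
  set c := √(2 * Real.log t / n) with hc
  have hc0 : 0 < c := by positivity
  have hc2 : c ^ 2 = 2 * Real.log t / n := Real.sq_sqrt (by positivity)
  have hnc2 : n * c ^ 2 = 2 * Real.log t := by rw [hc2]; field_simp
  have hsq : √(2 * n * Real.log t) = n * c := by
    rw [← Real.sqrt_sq (show 0 ≤ n * c by positivity)]
    congr 1
    linear_combination (-(n : ℝ)) * hnc2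
  rw [hsq]
  have hexp : Real.exp (-c * S - (-c) ^ 2 / 2 * n) = t * Real.exp (-c * S - n * c ^ 2) := by
    rw [show (-c * S - (-c) ^ 2 / 2 * n) = Real.log t + (-c * S - n * c ^ 2) by
      rw [neg_sq]; linarith, Real.exp_add, Real.exp_log ht0]
  rw [hexp]
  have h1 : -c * S - n * c ^ 2 ≤ Real.exp (-c * S - n * c ^ 2) := by
    have := Real.add_one_le_exp (-c * S - n * c ^ 2)
    linarith
  calc -S / n - c = (-c * S - n * c ^ 2) / (n * c) := by field_simp
    _ ≤ Real.exp (-c * S - n * c ^ 2) / (n * c) := by gcongr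
    _ = _ := by field_simp

/-- The bound for the regret of one period, in which an arm with `n` earlier plays is played: the
gap itself in the first play or if the arm is overestimated, and twice the exploration bonus
otherwise. Arms with gaps above `h` are left out of the last case, as they are not targeted. -/
def playCost (B : Matrix (Fin dr) (Fin dc) ℝ) (ε : ℕ → Ω → ℝ) (π : ℕ → Ω → Arm dr dc) (h : ℝ)
    (T : ℕ) (ω : Ω) (a : Arm dr dc) (n : ℕ) : ℝ :=
  if n = 0 then armGap B a
  else armGap B a * (overestimated ε π T a n).indicator 1 ω +
    if 0 < armGap B a ∧ armGap B a ≤ h then 2 * √(2 * Real.log T) * (1 / √(n : ℝ)) else 0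

variable {B : Matrix (Fin dr) (Fin dc) ℝ} {h : ℝ}

theorem armGap_nonneg (B : Matrix (Fin dr) (Fin dc) ℝ) (a : Arm dr dc) : 0 ≤ armGap B a :=
  sub_nonneg.2 (le_ciSup (f := fun a : Arm dr dc => B a.1 a.2) (Set.finite_range _).bddAbove a)

theorem playCost_nonneg (T : ℕ) (ω : Ω) (a : Arm dr dc) (n : ℕ) :
    0 ≤ playCost B ε π h T ω a n := by
  have hg := armGap_nonneg B a
  rw [playCost]
  split_ifs
  · exact hg
  · have : 0 ≤ (overestimated ε π T a n).indicator (1 : Ω → ℝ) ω :=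
      Set.indicator_nonneg (fun _ _ => zero_le_one) _
    positivity
  · have : 0 ≤ (overestimated ε π T a n).indicator (1 : Ω → ℝ) ω :=
      Set.indicator_nonneg (fun _ _ => zero_le_one) _
    positivity

theorem sum_reward_playTimes (a : Arm dr dc) (t : ℕ) (ω : Ω) :
    ∑ s ∈ playTimes π a t ω, reward B ε π s ω =
      (playTimes π a t ω).card * B a.1 a.2 + ∑ s ∈ playTimes π a t ω, ε s ω := by
  have : ∀ s ∈ playTimes π a t ω, reward B ε π s ω = B a.1 a.2 + ε s ω := fun s hs => by
    rw [reward, (mem_playTimes.1 hs).2]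
  rw [Finset.sum_congr rfl this, Finset.sum_add_distrib, Finset.sum_const, nsmul_eq_mul]

/-- The regret of a period in which the index is maximized over a set that contains the best arm
`b`. -/
theorem armGap_le_playCost_add_shortfall {t T : ℕ} (ht : 2 ≤ t) (htT : t ≤ T) {ω : Ω}
    {b : Arm dr dc} (hb : armGap B b = 0) (hgap : armGap B (π t ω) ≤ h)
    (hucb : ucbIndex B ε π t b ω ≤ ucbIndex B ε π t (π t ω) ω) :
    armGap B (π t ω) ≤ playCost B ε π h T ω (π t ω) (playTimes π (π t ω) t ω).card +
      shortfall ε π b t ω := by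
  set a := π t ω with ha
  set n := (playTimes π a t ω).card with hn
  have hg := armGap_nonneg B a
  have hs := shortfall_nonneg (ε := ε) (π := π) b t ω
  have hind : 0 ≤ (overestimated ε π T a n).indicator (1 : Ω → ℝ) ω :=
    Set.indicator_nonneg (fun _ _ => zero_le_one) _
  rw [playCost]
  by_cases hn0 : n = 0
  · rw [if_pos hn0]
    linarith
  rw [if_neg hn0]
  rcases hg.eq_or_lt with hg0 | hg0
  · rw [← hg0]
    simp [hs]
  rw [if_pos ⟨hg0, hgap⟩]
  have hnb : (playTimes π b t ω).card ≠ 0 := by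
    intro h0
    rw [ucbIndex, ucbIndex, if_pos h0, if_neg hn0] at hucb
    exact absurd hucb (not_le.2 (EReal.coe_lt_top _))
  rw [ucbIndex, ucbIndex, if_neg hnb, if_neg hn0, EReal.coe_le_coe_iff, sum_reward_playTimes,
    sum_reward_playTimes, add_div, add_div, mul_div_cancel_left₀ _ (Nat.cast_ne_zero.2 hnb),
    mul_div_cancel_left₀ _ (Nat.cast_ne_zero.2 hn0)] at hucb
  have hshort := le_shortfall (ε := ε) ht hnb
  rw [neg_div] at hshort
  set Sa := ∑ s ∈ playTimes π a t ω, ε s ω with hSa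
  have hnpos : (0 : ℝ) < n := by exact_mod_cast Nat.pos_of_ne_zero hn0
  have ht1 : (1 : ℝ) ≤ t := by
    have : 1 ≤ t := by omega
    exact_mod_cast this
  have hlt : 0 ≤ Real.log t := Real.log_nonneg ht1
  have hlT : Real.log t ≤ Real.log T := Real.log_le_log (by linarith) (by exact_mod_cast htT)
  have hbonus : √(2 * Real.log t / n) ≤ √(2 * Real.log T / n) := by gcongr
  have hsplit : √(2 * Real.log T / n) = √(2 * Real.log T) * (1 / √(n : ℝ)) := by
    rw [Real.sqrt_div' _ hnpos.le]
    ring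
  have hdiff : armGap B a = B b.1 b.2 - B a.1 a.2 := by
    rw [armGap] at hb ⊢
    linarith
  by_cases hover : Sa / n ≤ √(2 * Real.log T / n)
  · have h1 : 0 ≤ armGap B a * (overestimated ε π T a n).indicator (1 : Ω → ℝ) ω := by positivity
    rw [hsplit] at hover hbonus
    linarith
  · have hmem : ω ∈ overestimated ε π T a n := by
      rw [overestimated, Set.mem_ofPred_eq, logProcess_earlyPlay htT hn.symm, ← hSa]
      set l := √(2 * Real.log T / n)
      have hl0 : 0 ≤ l := Real.sqrt_nonneg _
      have hl2 : l ^ 2 = 2 * Real.log T / n := Real.sq_sqrt (by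
        have := hlt.trans hlT
        positivity)
      have hnl : l ^ 2 * n = 2 * Real.log T := by rw [hl2]; field_simp
      have h1 : l * n ≤ Sa := by
        rw [not_le, lt_div_iff₀ hnpos] at hover
        exact hover.le
      nlinarith [mul_le_mul_of_nonneg_left h1 hl0]
    rw [Set.indicator_of_mem hmem, Pi.one_apply, mul_one]
    have : 0 ≤ 2 * √(2 * Real.log T) * (1 / √(n : ℝ)) := by positivity
    linarith

/-- The total cost of the plays of an arm. -/
theorem sum_playCost_le (T N : ℕ) (hN : N ≤ T) (ω : Ω) (a : Arm dr dc) :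
    ∑ n ∈ Finset.range N, playCost B ε π h T ω a n ≤
      armGap B a + armGap B a * ∑ n ∈ Finset.Ico 1 (T + 1),
          (overestimated ε π T a n).indicator (1 : Ω → ℝ) ω +
        if 0 < armGap B a ∧ armGap B a ≤ h then 4 * √(2 * Real.log T) * √(N : ℝ) else 0 := by
  have hg := armGap_nonneg B a
  have hind : ∀ n, 0 ≤ (overestimated ε π T a n).indicator (1 : Ω → ℝ) ω := fun n =>
    Set.indicator_nonneg (fun _ _ => zero_le_one) _
  rcases N with _ | N
  · have := Finset.sum_nonneg fun n (_ : n ∈ Finset.Ico 1 (T + 1)) => hind n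
    simp only [Finset.range_zero, Finset.sum_empty]
    positivity
  have hlT : 0 ≤ √(2 * Real.log T) := Real.sqrt_nonneg _
  rw [Finset.range_eq_Ico, Finset.sum_eq_sum_Ico_succ_bot (by omega), zero_add]
  have h0 : playCost B ε π h T ω a 0 = armGap B a := if_pos rfl
  have h1 : ∀ n ∈ Finset.Ico 1 (N + 1), playCost B ε π h T ω a n =
      armGap B a * (overestimated ε π T a n).indicator (1 : Ω → ℝ) ω +
        (if 0 < armGap B a ∧ armGap B a ≤ h then 2 * √(2 * Real.log T) else 0) *
          (1 / √(n : ℝ)) := fun n hn => by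
    rw [Finset.mem_Ico] at hn
    rw [playCost, if_neg (by omega), ite_mul, zero_mul]
  rw [h0, Finset.sum_congr rfl h1, Finset.sum_add_distrib, ← Finset.mul_sum, ← Finset.mul_sum,
    add_assoc]
  refine add_le_add le_rfl (add_le_add ?_ ?_)
  · refine mul_le_mul_of_nonneg_left ?_ hg
    exact Finset.sum_le_sum_of_subset_of_nonneg (Finset.Ico_subset_Ico_right (by omega))
      fun n _ _ => hind n
  · split_ifs
    · have h2 := sum_one_div_sqrt_le N
      have h3 : √(N : ℝ) ≤ √((N + 1 : ℕ) : ℝ) := Real.sqrt_le_sqrt (by push_cast; linarith)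
      calc 2 * √(2 * Real.log T) * ∑ n ∈ Finset.Ico 1 (N + 1), 1 / √(n : ℝ) ≤
            2 * √(2 * Real.log T) * (2 * √((N + 1 : ℕ) : ℝ)) := by
              gcongr
              exact h2.trans (by linarith)
        _ = _ := by ring
    · rw [zero_mul]

/-- The regret over a set `G` of periods in which the index is maximized over arms that include
the best arm `b` and have gaps of at most `h`. -/
theorem sum_armGap_le {T : ℕ} {ω : Ω} {b : Arm dr dc} (hb : armGap B b = 0) {G : Finset ℕ}
    (hG : G ⊆ Finset.Ico 1 (T + 1)) (hG2 : ∀ t ∈ G, 2 ≤ t)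
    (hgap : ∀ t ∈ G, armGap B (π t ω) ≤ h)
    (hucb : ∀ t ∈ G, ucbIndex B ε π t b ω ≤ ucbIndex B ε π t (π t ω) ω) :
    ∑ t ∈ G, armGap B (π t ω) ≤ ∑ a, armGap B a +
      ∑ a, armGap B a * ∑ n ∈ Finset.Ico 1 (T + 1),
          (overestimated ε π T a n).indicator (1 : Ω → ℝ) ω +
      4 * √(2 * Real.log T) *
        √((Finset.card {a : Arm dr dc | 0 < armGap B a ∧ armGap B a ≤ h} : ℝ) * T) +
      ∑ t ∈ G, shortfall ε π b t ω := by
  have h1 : ∑ t ∈ G, armGap B (π t ω) ≤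
      ∑ t ∈ G, playCost B ε π h T ω (π t ω) (playTimes π (π t ω) t ω).card +
        ∑ t ∈ G, shortfall ε π b t ω := by
    rw [← Finset.sum_add_distrib]
    refine Finset.sum_le_sum fun t ht => ?_
    have := Finset.mem_Ico.1 (hG ht)
    exact armGap_le_playCost_add_shortfall (hG2 t ht) (by omega) hb (hgap t ht) (hucb t ht)
  have h2 : ∑ t ∈ G, playCost B ε π h T ω (π t ω) (playTimes π (π t ω) t ω).card ≤
      ∑ a, ∑ n ∈ Finset.range (playTimes π a (T + 1) ω).card, playCost B ε π h T ω a n := by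
    rw [← sum_plays_eq]
    exact Finset.sum_le_sum_of_subset_of_nonneg hG fun t _ _ => playCost_nonneg T ω _ _
  have h3 := Finset.sum_le_sum fun a (_ : a ∈ Finset.univ) =>
    sum_playCost_le (B := B) (ε := ε) (π := π) (h := h) T (playTimes π a (T + 1) ω).card
      (by simpa using card_playTimes_le_sub_one (π := π) a (T + 1) ω) ω a
  rw [Finset.sum_add_distrib, Finset.sum_add_distrib] at h3
  have h4 : ∑ a : Arm dr dc, (if 0 < armGap B a ∧ armGap B a ≤ h then
      4 * √(2 * Real.log T) * √((playTimes π a (T + 1) ω).card : ℝ) else 0) ≤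
      4 * √(2 * Real.log T) *
        √((Finset.card {a : Arm dr dc | 0 < armGap B a ∧ armGap B a ≤ h} : ℝ) * T) := by
    rw [← Finset.sum_filter, ← Finset.mul_sum]
    refine mul_le_mul_of_nonneg_left ?_ (by positivity)
    refine Real.le_sqrt_of_sq_le ?_
    refine (sq_sum_le_card_mul_sum_sq).trans ?_
    refine mul_le_mul_of_nonneg_left ?_ (Nat.cast_nonneg _)
    have h5 : ∑ a : Arm dr dc, ((playTimes π a (T + 1) ω).card : ℝ) = T := by
      exact_mod_cast sum_card_playTimes (π := π) T ω
    rw [← h5]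
    simp only [Real.sq_sqrt (Nat.cast_nonneg _)]
    exact Finset.sum_le_sum_of_subset_of_nonneg (Finset.filter_subset _ _)
      fun _ _ _ => Nat.cast_nonneg _
  linarith

end UCB

/-! ### Probability of overestimation and expected shortfall -/

section Expectation

variable {Ω : Type*} [mΩ : MeasurableSpace Ω] {P : Measure Ω} {ρ : ℝ}
  {f : ℕ → Ω → Option (Arm dr dc)} {ε : ℕ → Ω → ℝ} {π : ℕ → Ω → Arm dr dc}

theorem Environment.measurableSet_overestimated (hE : Environment P ρ f ε)
    (hπ : ∀ t, 1 ≤ t → Measurable[history f ε t] (π t)) (T : ℕ) (a : Arm dr dc) (n : ℕ) :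
    MeasurableSet (overestimated ε π T a n) :=
  measurableSet_le measurable_const ((measurable_logProcess (f := f)
    (measurableSet_earlyPlay hπ a n) _ _).mono (hE.history_le _) le_rfl)

/-- For each number of plays, an arm is overestimated with probability at most `1 / T`. This is
Chernoff's bound for the noise of the first `n` plays, where the bonus is the optimal exponent. -/
theorem Environment.measure_overestimated_le [IsProbabilityMeasure P] (hE : Environment P ρ f ε)
    (hπ : ∀ t, 1 ≤ t → Measurable[history f ε t] (π t)) {T : ℕ} (hT : 1 ≤ T) (a : Arm dr dc)
    (n : ℕ) : P.real (overestimated ε π T a n) ≤ 1 / T := by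
  have hT0 : (0 : ℝ) < T := by exact_mod_cast hT
  have h := measure_le_exp_neg_of_lintegral_exp_le_one
    ((measurable_logProcess (f := f) (measurableSet_earlyPlay hπ a n) √(2 * Real.log T / n)
      (T + 1)).mono (hE.history_le _) le_rfl)
    (hE.lintegral_exp_logProcess_le (measurableSet_earlyPlay hπ a n) _ _) (Real.log T)
  rw [Real.exp_neg, Real.exp_log hT0, ← one_div] at h
  exact ENNReal.toReal_le_of_le_ofReal (by positivity) h

theorem Environment.measurable_shortfall (hE : Environment P ρ f ε)
    (hπ : ∀ t, 1 ≤ t → Measurable[history f ε t] (π t)) (a : Arm dr dc) (t : ℕ) :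
    Measurable (shortfall ε π a t) := by
  refine Finset.measurable_sum _ fun n _ => Measurable.const_mul ?_ _
  exact Real.measurable_exp.comp ((measurable_logProcess (f := f)
    (fun s hs => hπ s hs (measurableSet_singleton a)) _ _).mono (hE.history_le _) le_rfl)

/-- The index of an arm falls below its mean by at most `1 / √t` in expectation. -/
theorem Environment.lintegral_shortfall_le [IsProbabilityMeasure P] (hE : Environment P ρ f ε)
    (hπ : ∀ t, 1 ≤ t → Measurable[history f ε t] (π t)) (a : Arm dr dc) {t : ℕ} (ht : 1 ≤ t)
    (hlt : 2 ≤ Real.log t) :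
    ∫⁻ ω, ENNReal.ofReal (shortfall ε π a t ω) ∂P ≤ ENNReal.ofReal (1 / √(t : ℝ)) := by
  have ht0 : (0 : ℝ) < t := by exact_mod_cast ht
  have hH : ∀ s, 1 ≤ s → MeasurableSet[history f ε s] {ω | π s ω = a} := fun s hs =>
    hπ s hs (measurableSet_singleton a)
  have hm : ∀ l, Measurable fun ω =>
      ENNReal.ofReal (Real.exp (logProcess ε (fun s => {ω | π s ω = a}) l t ω)) := fun l =>
    ENNReal.measurable_ofReal.comp (Real.measurable_exp.comp
      ((measurable_logProcess (f := f) hH _ _).mono (hE.history_le _) le_rfl))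
  have hterm : ∀ n : ℕ, 0 ≤ 1 / (√(2 * n * Real.log t) * t) := fun n => by positivity
  have hsum : ∀ ω, ENNReal.ofReal (shortfall ε π a t ω) =
      ∑ n ∈ Finset.Ico 1 t, ENNReal.ofReal (1 / (√(2 * n * Real.log t) * t)) * ENNReal.ofReal
        (Real.exp (logProcess ε (fun s => {ω | π s ω = a}) (-√(2 * Real.log t / n)) t ω)) := by
    intro ω
    rw [shortfall, ENNReal.ofReal_sum_of_nonneg fun n _ => by positivity]
    exact Finset.sum_congr rfl fun n _ => ENNReal.ofReal_mul (hterm n)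
  simp only [hsum]
  rw [lintegral_finsetSum _ fun n _ => (hm _).const_mul _]
  calc _ ≤ ∑ n ∈ Finset.Ico 1 t, ENNReal.ofReal (1 / (√(2 * n * Real.log t) * t)) := by
        refine Finset.sum_le_sum fun n _ => ?_
        rw [lintegral_const_mul _ (hm _)]
        exact mul_le_of_le_one_right' (hE.lintegral_exp_logProcess_le hH _ t)
    _ = ENNReal.ofReal (∑ n ∈ Finset.Ico 1 t, 1 / (√(2 * n * Real.log t) * t)) :=
        (ENNReal.ofReal_sum_of_nonneg fun n _ => hterm n).symm
    _ ≤ _ := by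
        refine ENNReal.ofReal_le_ofReal ?_
        have h1 : ∀ n ∈ Finset.Ico 1 t, 1 / (√(2 * n * Real.log t) * t) ≤
            1 / (2 * t) * (1 / √(n : ℝ)) := fun n hn => by
          have hn0 : (0 : ℝ) < n := by exact_mod_cast (Finset.mem_Ico.1 hn).1
          have h2 : 2 * √(n : ℝ) ≤ √(2 * n * Real.log t) := by
            refine Real.le_sqrt_of_sq_le ?_
            rw [mul_pow, Real.sq_sqrt hn0.le]
            nlinarith
          rw [one_div_mul_one_div]
          refine one_div_le_one_div_of_le (by positivity) ?_
          calc 2 * (t : ℝ) * √(n : ℝ) = 2 * √(n : ℝ) * t := by ring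
            _ ≤ _ := by gcongr
        refine (Finset.sum_le_sum h1).trans ?_
        rw [← Finset.mul_sum]
        have h3 := sum_one_div_sqrt_le (t - 1)
        rw [Nat.sub_add_cancel ht] at h3
        have h4 : √((t - 1 : ℕ) : ℝ) ≤ √(t : ℝ) := Real.sqrt_le_sqrt (by
          exact_mod_cast Nat.sub_le t 1)
        calc 1 / (2 * (t : ℝ)) * ∑ n ∈ Finset.Ico 1 t, 1 / √(n : ℝ) ≤
              1 / (2 * t) * (2 * √(t : ℝ)) := by
                gcongr
                exact h3.trans (by linarith)
          _ = √(t : ℝ) / t := by field_simp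
          _ = 1 / √(t : ℝ) := by rw [Real.sqrt_div_self, one_div]

theorem Environment.integrable_shortfall [IsProbabilityMeasure P] (hE : Environment P ρ f ε)
    (hπ : ∀ t, 1 ≤ t → Measurable[history f ε t] (π t)) (a : Arm dr dc) {t : ℕ} (ht : 1 ≤ t)
    (hlt : 2 ≤ Real.log t) : Integrable (shortfall ε π a t) P := by
  refine ⟨(hE.measurable_shortfall hπ a t).aestronglyMeasurable, ?_⟩
  rw [hasFiniteIntegral_iff_ofReal (ae_of_all _ fun ω => shortfall_nonneg a t ω)]
  exact (hE.lintegral_shortfall_le hπ a ht hlt).trans_lt ENNReal.ofReal_lt_top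

theorem Environment.integral_shortfall_le [IsProbabilityMeasure P] (hE : Environment P ρ f ε)
    (hπ : ∀ t, 1 ≤ t → Measurable[history f ε t] (π t)) (a : Arm dr dc) {t : ℕ} (ht : 1 ≤ t)
    (hlt : 2 ≤ Real.log t) : ∫ ω, shortfall ε π a t ω ∂P ≤ 1 / √(t : ℝ) := by
  rw [integral_eq_lintegral_of_nonneg_ae (ae_of_all _ fun ω => shortfall_nonneg a t ω)
    (hE.measurable_shortfall hπ a t).aestronglyMeasurable]
  exact ENNReal.toReal_le_of_le_ofReal (by positivity) (hE.lintegral_shortfall_le hπ a ht hlt)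

end Expectation

theorem sum_one_div_le_log {T : ℕ} (hT : 1 ≤ T) :
    ∑ t ∈ Finset.Ico 2 (T + 1), 1 / (t : ℝ) ≤ Real.log T := by
  induction T, hT using Nat.le_induction with
  | base => simp
  | succ T hT ih =>
    rw [Finset.sum_Ico_succ_top (by omega)]
    have h0 : (0 : ℝ) < T := by exact_mod_cast hT
    have h1 := Real.log_le_sub_one_of_pos (show 0 < (T : ℝ) / (T + 1 : ℕ) by positivity)
    rw [Real.log_div h0.ne' (by positivity)] at h1
    have h2 : (T : ℝ) / (T + 1 : ℕ) - 1 = -(1 / ((T + 1 : ℕ) : ℝ)) := by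
      push_cast
      field_simp
      ring
    linarith

/-! ### Gaps -/

theorem exists_armGap_eq_zero [Nonempty (Arm dr dc)] (B : Matrix (Fin dr) (Fin dc) ℝ) :
    ∃ b, armGap B b = 0 := by
  obtain ⟨b, hb⟩ := exists_eq_ciSup_of_finite (f := fun a : Arm dr dc => B a.1 a.2)
  exact ⟨b, sub_eq_zero.2 hb.symm⟩

theorem armGap_le (B : Matrix (Fin dr) (Fin dc) ℝ) (a : Arm dr dc) :
    armGap B a ≤ 2 * rowNorm B := by
  have : Nonempty (Arm dr dc) := ⟨a⟩
  obtain ⟨b, hb⟩ := exists_armGap_eq_zero B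
  have h1 := abs_le.1 (abs_entry_le_rowNorm B b.1 b.2)
  have h2 := abs_le.1 (abs_entry_le_rowNorm B a.1 a.2)
  rw [armGap] at hb ⊢
  linarith [h1.2, h2.1]

theorem nearOptimalCount_le (B : Matrix (Fin dr) (Fin dc) ℝ) (h : ℝ) :
    nearOptimalCount B h ≤ dr * dc := by
  rw [nearOptimalCount]
  refine (Set.ncard_le_ncard (Set.subset_univ _)).trans_eq ?_
  rw [Set.ncard_univ, Nat.card_eq_fintype_card, Fintype.card_prod, Fintype.card_fin,
    Fintype.card_fin]

/-- A best arm counts towards `g(h)`, but not towards the regret. -/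
theorem card_suboptimal_lt_nearOptimalCount {B : Matrix (Fin dr) (Fin dc) ℝ} {h : ℝ} (hh : 0 < h)
    {b : Arm dr dc} (hb : armGap B b = 0) :
    (Finset.card {a : Arm dr dc | 0 < armGap B a ∧ armGap B a ≤ h}) + 1 ≤
      nearOptimalCount B h := by
  rw [← Finset.card_insert_of_notMem (a := b) (by simp [hb]), nearOptimalCount,
    ← Set.ncard_coe_finset]
  refine Set.ncard_le_ncard (fun a ha => ?_) (Set.toFinite _)
  rw [Finset.mem_coe, Finset.mem_insert, Finset.mem_filter] at ha
  have : armGap B a ≤ h := by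
    rcases ha with rfl | ha
    · rw [hb]
      exact hh.le
    · exact ha.2.2
  rw [armGap] at this
  rw [Set.mem_ofPred_eq]
  linarith

/-- The lower-order cost `2 √T` of the confidence bounds is paid for by the best arm, which
`g` counts but `c` does not. -/
theorem sqrt_add_le_of_lt {c g T l : ℝ} (hc : 0 ≤ c) (hcg : c + 1 ≤ g) (hl : g ≤ l) :
    4 * √(2 * l) * √(c * T) + 2 * √T ≤ 4 * √(2 * T * g * l) := by
  have hg : 0 < g := by linarith
  have hl0 : 0 < l := by linarith
  have h1 : √(2 * l) * √(c * T) = √(2 * l) * √c * √T := by rw [Real.sqrt_mul hc]; ring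
  have h2 : √(2 * T * g * l) = √(2 * l) * √g * √T := by
    rw [← Real.sqrt_mul (by positivity), ← Real.sqrt_mul (by positivity)]
    ring_nf
  rw [mul_assoc, h1, h2]
  have hsg : 0 < √g := Real.sqrt_pos.2 hg
  have hsc : 0 ≤ √c := Real.sqrt_nonneg _
  have hc2 := Real.sq_sqrt hc
  have hg2 := Real.sq_sqrt hg.le
  have hu : √g ≤ √(2 * l) := Real.sqrt_le_sqrt (by linarith)
  -- `√g - √c ≥ 1 / (2 √g)`
  have h3 : 1 ≤ 2 * √g * (√g - √c) := by nlinarith [sq_nonneg (√g - √c)]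
  have h4 : 0 ≤ √g - √c := by
    by_contra h5
    nlinarith
  have h5 : 1 ≤ 2 * √(2 * l) * (√g - √c) := by nlinarith
  nlinarith [mul_le_mul_of_nonneg_right h5 (Real.sqrt_nonneg T)]

/-! ### The regret bound -/

section Regret

variable {Ω : Type*} {ρ : ℝ} {f : ℕ → Ω → Option (Arm dr dc)} {ε : ℕ → Ω → ℝ}
  {π : ℕ → Ω → Arm dr dc}
  {B : Matrix (Fin dr) (Fin dc) ℝ} {Bhat : Estimator dr dc} {h : ℝ}

theorem Environment.measurable_armGap [MeasurableSpace Ω] {P : Measure Ω} (hE : Environment P ρ f ε)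
    (hπ : ∀ t, 1 ≤ t → Measurable[history f ε t] (π t)) {t : ℕ} (ht : 1 ≤ t) :
    Measurable fun ω => armGap B (π t ω) :=
  (measurable_of_finite (armGap B)).comp ((hπ t ht).mono (hE.history_le t) le_rfl)

theorem Environment.integrable_armGap [MeasurableSpace Ω] {P : Measure Ω}
    [IsProbabilityMeasure P] (hE : Environment P ρ f ε)
    (hπ : ∀ t, 1 ≤ t → Measurable[history f ε t] (π t)) {t : ℕ} (ht : 1 ≤ t) :
    Integrable (fun ω => armGap B (π t ω)) P :=
  Integrable.of_mem_Icc 0 (2 * rowNorm B) (hE.measurable_armGap hπ ht).aemeasurable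
    (ae_of_all _ fun _ => ⟨armGap_nonneg B _, armGap_le B _⟩)

/-- The regret is at most the largest gap in every period. -/
theorem Environment.regret_le_mul [MeasurableSpace Ω] {P : Measure Ω}
    [IsProbabilityMeasure P] (hE : Environment P ρ f ε)
    (hπ : ∀ t, 1 ≤ t → Measurable[history f ε t] (π t)) {b : ℝ} (hb : rowNorm B ≤ b) (T : ℕ) :
    regret B π P T ≤ 2 * b * T := by
  have h1 : ∀ t ∈ Finset.Icc 1 T, ∫ ω, armGap B (π t ω) ∂P ≤ 2 * b := fun t ht => by
    refine (integral_mono (hE.integrable_armGap hπ (Finset.mem_Icc.1 ht).1)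
      (integrable_const (2 * b)) fun ω => (armGap_le B _).trans (by linarith)).trans_eq ?_
    simp
  refine (Finset.sum_le_sum h1).trans_eq ?_
  rw [Finset.sum_const, Nat.card_Icc, nsmul_eq_mul, Nat.add_sub_cancel, mul_comm]

/-- The pathwise decomposition of the regret: initialization, later forced samples, periods with
an inaccurate estimate (in the sets `bad t`), and confidence bounds. -/
theorem sum_armGap_le_decomposition (hρ : 32 ≤ ρ) (hbandit : IsLowRankBandit B f ε π Bhat h)
    {b : Arm dr dc} (hb : armGap B b = 0) {bad : ℕ → Set Ω}
    (hbad : ∀ t ω, ω ∉ bad t →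
      ∀ a : Arm dr dc, |forcedEstimate B f ε π Bhat t ω a.1 a.2 - B a.1 a.2| ≤ h / 4)
    {β : ℝ} (hβ : rowNorm B ≤ β) {T : ℕ} (ω : Ω) :
    ∑ t ∈ Finset.Ico 1 (T + 1), armGap B (π t ω) ≤
      (2 * β * (2 * ρ * Real.log ρ) + ∑ a, armGap B a + 4 * √(2 * Real.log T) *
        √((Finset.card {a : Arm dr dc | 0 < armGap B a ∧ armGap B a ≤ h} : ℝ) * T)) +
      (∑ t ∈ (Finset.Ico 1 (T + 1)).filter (fun t : ℕ => 2 * ρ * Real.log ρ < t),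
        (2 * β * {ω | (f t ω).isSome}.indicator (1 : Ω → ℝ) ω +
          2 * β * (bad t).indicator (1 : Ω → ℝ) ω + shortfall ε π b t ω) +
      ∑ a, armGap B a * ∑ n ∈ Finset.Ico 1 (T + 1),
          (overestimated ε π T a n).indicator (1 : Ω → ℝ) ω) := by
  classical
  have hβ0 : 0 ≤ 2 * β := by linarith [rowNorm_nonneg B]
  have hgap : ∀ a, armGap B a ≤ 2 * β := fun a => (armGap_le B a).trans (by linarith)
  have hl3 := three_le_log hρ
  set J := (Finset.Ico 1 (T + 1)).filter (fun t : ℕ => 2 * ρ * Real.log ρ < t) with hJ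
  set G := J.filter (fun t => f t ω = none ∧ ω ∉ bad t) with hG
  have hI := Finset.sum_filter_add_sum_filter_not (Finset.Ico 1 (T + 1))
    (fun t : ℕ => 2 * ρ * Real.log ρ < t) (fun t => armGap B (π t ω))
  have hJsplit := Finset.sum_filter_add_sum_filter_not J
    (fun t => f t ω = none ∧ ω ∉ bad t) (fun t => armGap B (π t ω))
  rw [← hJ] at hI
  rw [← hG] at hJsplit
  have hinit : ∑ t ∈ (Finset.Ico 1 (T + 1)).filter (fun t : ℕ => ¬ 2 * ρ * Real.log ρ < t),
      armGap B (π t ω) ≤ 2 * β * (2 * ρ * Real.log ρ) := by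
    have hcard : (((Finset.Ico 1 (T + 1)).filter
        (fun t : ℕ => ¬ 2 * ρ * Real.log ρ < t)).card : ℝ) ≤ 2 * ρ * Real.log ρ := by
      have hsub : (Finset.Ico 1 (T + 1)).filter (fun t : ℕ => ¬ 2 * ρ * Real.log ρ < t) ⊆
          Finset.Icc 1 ⌊2 * ρ * Real.log ρ⌋₊ := fun t ht => by
        rw [Finset.mem_filter, not_lt, Finset.mem_Ico] at ht
        exact Finset.mem_Icc.2 ⟨ht.1.1, Nat.le_floor ht.2⟩
      have h1 := Finset.card_le_card hsub
      rw [Nat.card_Icc, Nat.add_sub_cancel] at h1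
      exact (Nat.cast_le.2 h1).trans (Nat.floor_le (by positivity))
    refine (Finset.sum_le_card_nsmul _ _ _ fun t _ => hgap (π t ω)).trans ?_
    rw [nsmul_eq_mul, mul_comm]
    gcongr
  have hind : ∀ (s : Set Ω), 0 ≤ s.indicator (1 : Ω → ℝ) ω := fun s =>
    Set.indicator_nonneg (fun _ _ => zero_le_one) _
  have hrest : ∑ t ∈ J.filter (fun t => ¬ (f t ω = none ∧ ω ∉ bad t)), armGap B (π t ω) ≤
      ∑ t ∈ J, (2 * β * {ω | (f t ω).isSome}.indicator (1 : Ω → ℝ) ω +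
          2 * β * (bad t).indicator (1 : Ω → ℝ) ω) := by
    refine (Finset.sum_le_sum fun t ht => ?_).trans (Finset.sum_le_sum_of_subset_of_nonneg
      (Finset.filter_subset _ _) fun t _ _ =>
        add_nonneg (mul_nonneg hβ0 (hind _)) (mul_nonneg hβ0 (hind _)))
    have h1 := (Finset.mem_filter.1 ht).2
    have h2 := mul_nonneg hβ0 (hind {ω | (f t ω).isSome})
    have h3 := mul_nonneg hβ0 (hind (bad t))
    by_cases hbt : ω ∈ bad t
    · rw [Set.indicator_of_mem hbt, Pi.one_apply, mul_one] at h3 ⊢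
      linarith [hgap (π t ω)]
    · have hf : ω ∈ {ω | (f t ω).isSome} := by
        have h4 : f t ω ≠ none := fun h0 => h1 ⟨h0, hbt⟩
        rw [Set.mem_ofPred_eq]
        exact Option.isSome_iff_ne_none.2 h4
      rw [Set.indicator_of_mem hf, Pi.one_apply, mul_one] at h2 ⊢
      linarith [hgap (π t ω)]
  have hGJ : G ⊆ J := Finset.filter_subset _ _
  have hGt : ∀ t ∈ G, 1 ≤ t ∧ f t ω = none ∧
      b ∈ targetSet B f ε π Bhat h t ω ∧
      ∀ a ∈ targetSet B f ε π Bhat h t ω, armGap B a ≤ h := fun t ht => by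
    obtain ⟨h1, h2, h3⟩ := Finset.mem_filter.1 ht
    have h4 := targetSet_of_accurate (hbad t ω h3)
    exact ⟨(Finset.mem_Ico.1 (Finset.mem_filter.1 h1).1).1, h2, h4.1 b hb, h4.2⟩
  have hucb := sum_armGap_le (ε := ε) (π := π) (h := h) (T := T) (ω := ω) hb (G := G)
    (hGJ.trans (Finset.filter_subset _ _))
    (fun t ht => by
      have h1 := (Finset.mem_filter.1 (hGJ ht)).2
      have : (1 : ℝ) < t := by nlinarith
      exact_mod_cast this)
    (fun t ht => by
      obtain ⟨h1, h2, -, h4⟩ := hGt t ht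
      exact h4 _ (hbandit.targeted t h1 ω h2).1)
    (fun t ht => by
      obtain ⟨h1, h2, h3, -⟩ := hGt t ht
      exact (hbandit.targeted t h1 ω h2).2 b h3)
  have hshort : ∑ t ∈ G, shortfall ε π b t ω ≤ ∑ t ∈ J, shortfall ε π b t ω :=
    Finset.sum_le_sum_of_subset_of_nonneg hGJ fun t _ _ => shortfall_nonneg b t ω
  rw [Finset.sum_add_distrib]
  linarith

/-- The regret bound for horizons beyond the length of the initialization. -/
theorem Environment.regret_le [MeasurableSpace Ω] {P : Measure Ω}
    [IsProbabilityMeasure P] (hE : Environment P ρ f ε) (hρ : 32 ≤ ρ)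
    (hbandit : IsLowRankBandit B f ε π Bhat h) (hh : 0 < h) (a₀ : Arm dr dc)
    {F : ℝ} (hF0 : 0 ≤ F) (hFρ : F ≤ ρ)
    (hbad : ∀ t : ℕ, 2 * ρ * Real.log ρ < t → P {ω | ∃ a : Arm dr dc,
      h / 4 < |forcedEstimate B f ε π Bhat t ω a.1 a.2 - B a.1 a.2|} ≤
        ENNReal.ofReal (F * (1 / (t : ℝ) ^ 2)))
    {β : ℝ} (hβ : rowNorm B ≤ β) {T : ℕ} (hT : ρ ≤ T)
    (hTK : ((dr * dc : ℕ) : ℝ) ≤ Real.log T) :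
    regret B π P T ≤ 10 * (β * ρ * Real.log T) +
      4 * √(2 * T * nearOptimalCount B h * Real.log T) + 2 * ∑ a, armGap B a := by
  have : Nonempty (Arm dr dc) := ⟨a₀⟩
  obtain ⟨b, hb⟩ := exists_armGap_eq_zero B
  have hπ := hbandit.adapted
  have hβ0 : 0 ≤ β := (rowNorm_nonneg B).trans hβ
  have hl3 := three_le_log hρ
  have hT0 : (0 : ℝ) < T := by linarith
  have hT1 : 1 ≤ T := by exact_mod_cast hT0
  have hlT : Real.log ρ ≤ Real.log T := Real.log_le_log (by linarith) hT
  set bad : ℕ → Set Ω := fun t => toMeasurable P {ω | ∃ a : Arm dr dc,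
      h / 4 < |forcedEstimate B f ε π Bhat t ω a.1 a.2 - B a.1 a.2|} with hbad_def
  have hbadm : ∀ t, MeasurableSet (bad t) := fun t => measurableSet_toMeasurable _ _
  have hbadc : ∀ t ω, ω ∉ bad t →
      ∀ a : Arm dr dc, |forcedEstimate B f ε π Bhat t ω a.1 a.2 - B a.1 a.2| ≤ h / 4 := by
    intro t ω hω a
    by_contra hcon
    exact hω (subset_toMeasurable P _ ⟨a, not_le.1 hcon⟩)
  set J := (Finset.Ico 1 (T + 1)).filter (fun t : ℕ => 2 * ρ * Real.log ρ < t) with hJ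
  set c : ℝ := (Finset.card {a : Arm dr dc | 0 < armGap B a ∧ armGap B a ≤ h} : ℝ) with hc
  set A := 2 * β * (2 * ρ * Real.log ρ) + ∑ a, armGap B a + 4 * √(2 * Real.log T) * √(c * T)
    with hA
  have hJt : ∀ t ∈ J, 2 ≤ t ∧ t ≤ T ∧ ρ < t ∧ 2 * ρ * Real.log ρ < t ∧ 2 ≤ Real.log t := by
    intro t ht
    obtain ⟨h1, h2⟩ := Finset.mem_filter.1 ht
    have h3 : ρ < t := by nlinarith
    have h4 : (2 : ℝ) ≤ t := by linarith
    have h5 := Real.log_le_log (by linarith) h3.le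
    exact ⟨by exact_mod_cast h4, by have := (Finset.mem_Ico.1 h1).2; omega, h3, h2, by linarith⟩
  -- integrate the pathwise bound
  have hone : ∀ s : Set Ω, MeasurableSet s → Integrable (s.indicator (1 : Ω → ℝ)) P :=
    fun s hs => (integrable_const (1 : ℝ)).indicator hs
  have hsome : ∀ t, MeasurableSet {ω | (f t ω).isSome} := fun t =>
    hE.measurableSet_forced t fun o => o.isSome
  have hover := fun a n => hE.measurableSet_overestimated hπ T a n
  have hint1 : ∀ t ∈ J, Integrable (fun ω =>
      2 * β * {ω | (f t ω).isSome}.indicator (1 : Ω → ℝ) ω +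
          2 * β * (bad t).indicator (1 : Ω → ℝ) ω + shortfall ε π b t ω) P := fun t ht => by
    obtain ⟨h1, -, -, -, h5⟩ := hJt t ht
    exact (((hone _ (hsome t)).const_mul _).add ((hone _ (hbadm t)).const_mul _)).add
      (hE.integrable_shortfall hπ b (by omega) h5)
  have hint2 : ∀ a, Integrable (fun ω => armGap B a * ∑ n ∈ Finset.Ico 1 (T + 1),
      (overestimated ε π T a n).indicator (1 : Ω → ℝ) ω) P := fun a =>
    (integrable_finsetSum _ fun n _ => hone _ (hover a n)).const_mul _
  have hreg : regret B π P T ≤ A + (∑ t ∈ J, (2 * β * P.real {ω | (f t ω).isSome} +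
      2 * β * P.real (bad t) + ∫ ω, shortfall ε π b t ω ∂P) +
      ∑ a, armGap B a * ∑ n ∈ Finset.Ico 1 (T + 1), P.real (overestimated ε π T a n)) := by
    have h1 : regret B π P T = ∫ ω, ∑ t ∈ Finset.Ico 1 (T + 1), armGap B (π t ω) ∂P := by
      rw [integral_finsetSum _ fun t ht => hE.integrable_armGap hπ (Finset.mem_Ico.1 ht).1]
      rfl
    rw [h1]
    refine (integral_mono
      (integrable_finsetSum _ fun t ht => hE.integrable_armGap hπ (Finset.mem_Ico.1 ht).1)
      ((integrable_const A).add ((integrable_finsetSum _ hint1).add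
        (integrable_finsetSum _ fun a _ => hint2 a)))
      fun ω => sum_armGap_le_decomposition hρ hbandit hb hbadc hβ ω).trans_eq ?_
    refine (integral_add (integrable_const A) ((integrable_finsetSum _ hint1).add
      (integrable_finsetSum _ fun a _ => hint2 a))).trans (congrArg₂ _ (by simp) ?_)
    refine (integral_add (integrable_finsetSum _ hint1)
      (integrable_finsetSum _ fun a _ => hint2 a)).trans ?_
    rw [integral_finsetSum _ hint1, integral_finsetSum _ fun a _ => hint2 a]
    congr 1
    · refine Finset.sum_congr rfl fun t ht => ?_
      obtain ⟨h1, -, -, -, h5⟩ := hJt t ht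
      refine (integral_add (((hone _ (hsome t)).const_mul _).add ((hone _ (hbadm t)).const_mul _))
        (hE.integrable_shortfall hπ b (by omega) h5)).trans (congrArg (· + _) ?_)
      refine (integral_add ((hone _ (hsome t)).const_mul _)
        ((hone _ (hbadm t)).const_mul _)).trans ?_
      rw [integral_const_mul, integral_const_mul, integral_indicator_one (hsome t),
        integral_indicator_one (hbadm t)]
    · refine Finset.sum_congr rfl fun a _ => ?_
      rw [integral_const_mul, integral_finsetSum _ fun n _ => hone _ (hover a n)]
      congr 1
      exact Finset.sum_congr rfl fun n _ => integral_indicator_one (hover a n)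
  -- bound the three sums
  have hterm : ∀ t ∈ J, 2 * β * P.real {ω | (f t ω).isSome} +
      2 * β * P.real (bad t) + ∫ ω, shortfall ε π b t ω ∂P ≤
      6 * β * ρ * (1 / t) + 1 / √(t : ℝ) := by
    intro t ht
    obtain ⟨h1, -, h3, h4, h5⟩ := hJt t ht
    have ht0 : (0 : ℝ) < t := by linarith
    have ht1 : (1 : ℝ) ≤ t := by linarith
    have hP1 : P.real {ω | (f t ω).isSome} ≤ 2 * ρ * (1 / t) := by
      rw [measureReal_def, hE.measure_isSome_eq_forcedRate a₀ (by omega),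
        ENNReal.toReal_ofReal (forcedRate_nonneg hρ t), forcedRate, if_neg (not_le.2 h4),
        mul_one_div, div_le_div_iff₀ (by nlinarith) ht0]
      nlinarith
    have hP2 : P.real (bad t) ≤ ρ * (1 / t) := by
      have h6 : P.real (bad t) ≤ F * (1 / (t : ℝ) ^ 2) := by
        rw [measureReal_def, measure_toMeasurable]
        exact ENNReal.toReal_le_of_le_ofReal (by positivity) (hbad t h4)
      refine h6.trans (mul_le_mul hFρ ?_ (by positivity) (by linarith))
      exact one_div_le_one_div_of_le ht0 (by nlinarith)
    have hP3 := hE.integral_shortfall_le hπ b (t := t) (by omega) h5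
    have h7 := mul_le_mul_of_nonneg_left hP1 (show 0 ≤ 2 * β by linarith)
    have h8 := mul_le_mul_of_nonneg_left hP2 (show 0 ≤ 2 * β by linarith)
    linarith
  have hJ2 : J ⊆ Finset.Ico 2 (T + 1) := fun t ht => by
    obtain ⟨h1, h2, -⟩ := hJt t ht
    exact Finset.mem_Ico.2 ⟨h1, by omega⟩
  have hsum1 : ∑ t ∈ J, 1 / (t : ℝ) ≤ Real.log T :=
    (Finset.sum_le_sum_of_subset_of_nonneg hJ2 fun _ _ _ => by positivity).trans
      (sum_one_div_le_log hT1)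
  have hsum2 : ∑ t ∈ J, 1 / √(t : ℝ) ≤ 2 * √(T : ℝ) :=
    (Finset.sum_le_sum_of_subset_of_nonneg (Finset.filter_subset _ _)
      fun _ _ _ => by positivity).trans (sum_one_div_sqrt_le T)
  have hJsum : ∑ t ∈ J, (2 * β * P.real {ω | (f t ω).isSome} +
      2 * β * P.real (bad t) + ∫ ω, shortfall ε π b t ω ∂P) ≤
      6 * β * ρ * Real.log T + 2 * √(T : ℝ) := by
    refine (Finset.sum_le_sum hterm).trans ?_
    rw [Finset.sum_add_distrib, ← Finset.mul_sum]
    have : 0 ≤ 6 * β * ρ := by positivity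
    gcongr
  have hosum : ∑ a, armGap B a * ∑ n ∈ Finset.Ico 1 (T + 1), P.real (overestimated ε π T a n) ≤
      ∑ a, armGap B a := by
    refine Finset.sum_le_sum fun a _ => mul_le_of_le_one_right (armGap_nonneg B a) ?_
    refine (Finset.sum_le_card_nsmul _ _ _ fun n _ =>
      hE.measure_overestimated_le hπ hT1 a n).trans_eq ?_
    rw [Nat.card_Ico, Nat.add_sub_cancel, nsmul_eq_mul]
    field_simp
  have hsqrt : 4 * √(2 * Real.log T) * √(c * T) + 2 * √(T : ℝ) ≤
      4 * √(2 * T * nearOptimalCount B h * Real.log T) := by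
    refine sqrt_add_le_of_lt (Nat.cast_nonneg _) ?_ ?_
    · rw [hc]
      exact_mod_cast card_suboptimal_lt_nearOptimalCount hh hb
    · exact le_trans (by exact_mod_cast nearOptimalCount_le B h) hTK
  have hinit : 2 * β * (2 * ρ * Real.log ρ) ≤ 4 * (β * ρ * Real.log T) := by
    have : β * ρ * Real.log ρ ≤ β * ρ * Real.log T := by gcongr
    linarith
  linarith

end Regret

/-! ### The choice of the constants -/

/-- The resolution parameter in terms of the least singular value: the row incoherence cancels
the dimension and the rank. -/
theorem gammaRes_rowIncoherence {B : Matrix (Fin dr) (Fin dc) ℝ} (hB : B ≠ 0) (hdr : 0 < dr)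
    (h : ℝ) :
    gammaRes dr B.rank (rowIncoherence B) h = h * leastSingularValue B / (64 * rowNorm B) := by
  have h1 := rowNorm_pos hB
  have h2 := leastSingularValue_pos hB
  have h3 : (0 : ℝ) < B.rank := Nat.cast_pos.2 (Nat.pos_of_ne_zero (rank_ne_zero hB))
  have h4 : (0 : ℝ) < √((dr : ℝ) / B.rank) := Real.sqrt_pos.2 (by positivity)
  rw [gammaRes, rowIncoherence]
  field_simp

theorem nonempty_arm_of_ne_zero {B : Matrix (Fin dr) (Fin dc) ℝ} (hB : B ≠ 0) :
    Nonempty (Arm dr dc) := by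
  by_contra hcon
  refine hB (Matrix.ext fun j k => ?_)
  exact absurd ⟨(j, k)⟩ hcon

end LowRankBandit

end

open LowRankBandit

theorem theorem2 :
    ∃ C₁ : ℝ, 0 < C₁ ∧
    ∀ (dr dc r : ℕ) (μ α₁ : ℝ), 0 < α₁ →
    ∃ α₃ α₄ α₅ : ℝ, 0 < α₃ ∧ 0 < α₄ ∧ 0 < α₅ ∧
    ∀ (α₂ bstar : ℝ) (B : Matrix (Fin dr) (Fin dc) ℝ),
      0 < α₂ → B ≠ 0 → B.rank = r → LowRankBandit.rowIncoherence B = μ →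
      LowRankBandit.rowNorm B ≤ bstar →
    ∀ (Bbar Bhat : LowRankBandit.Estimator dr dc),
      Bbar.IsMeasurable → Bhat.IsMeasurable →
      (∀ (n : ℕ) (D : LowRankBandit.Sample dr dc n),
        LowRankBandit.IsRowEnhancement r Bbar D (Bhat n D)) →
    ∀ (T : ℕ) (h : ℝ), 1 ≤ T →
      LowRankBandit.hLow dr r μ α₄ α₅ T ≤ h →
      LowRankBandit.rhoMin dr r μ α₃ α₄ α₅ h ≤ LowRankBandit.rhoParam dr dc r μ α₂ h →
    ∀ (Ω : Type*) [MeasurableSpace Ω] (P : MeasureTheory.Measure Ω)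
      [MeasureTheory.IsProbabilityMeasure P]
      (f : ℕ → Ω → Option (LowRankBandit.Arm dr dc)) (ε : ℕ → Ω → ℝ)
      (π : ℕ → Ω → LowRankBandit.Arm dr dc),
      LowRankBandit.Environment P (LowRankBandit.rhoParam dr dc r μ α₂ h) f ε →
      LowRankBandit.TailBound B r α₁ α₂ Bbar (fun t => P.map (ε t)) →
      LowRankBandit.IsLowRankBandit B f ε π Bhat h →
      LowRankBandit.regret B π P T
        ≤ C₁ * (α₂ * bstar * (1 + 1 / LowRankBandit.gammaRes dr r μ h ^ 2) * r * (dr + dc)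
              * Real.log T)
          + 4 * √(2 * T * LowRankBandit.nearOptimalCount B h * Real.log T)
          + 100 * bstar
          + (1 + Real.pi ^ 2 / 3) * ∑ j, ∑ k, LowRankBandit.armGap B (j, k) := by
  -- the two summands of `1 / α₃` are for the numbers of observations and for `K ≤ log T`; those of
  -- `α₄` are for the tail bound and for the noise averages
  refine ⟨20, by norm_num, fun dr dc r μ α₁ hα₁ =>
    ⟨1 / (16 * (dr * dc : ℝ) ^ 2 + Real.exp (dr * dc)),
    16 * ((dr + dc) * r) / α₁ + 32 * (dr * dc) * dc * dr / (μ ^ 2 * r) + 1, 1, by positivity,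
    by positivity, one_pos, ?_⟩⟩
  rintro α₂ b B hα₂ hB rfl rfl hb Bbar Bhat hBbar hBhat hhat T h hT hlow hmin Ω _ P _ f ε π hE
    htail hbandit
  obtain ⟨a₀⟩ := nonempty_arm_of_ne_zero hB
  have hdr : 0 < dr := Fin.pos a₀.1
  have hdc : 0 < dc := Fin.pos a₀.2
  have hdr1 : (1 : ℝ) ≤ dr := by exact_mod_cast hdr
  have hdc1 : (1 : ℝ) ≤ dc := by exact_mod_cast hdc
  have hK1 : (1 : ℝ) ≤ dr * dc := by nlinarith
  have hR := rowNorm_pos hB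
  have hD := leastSingularValue_pos hB
  have hr : (0 : ℝ) < B.rank := Nat.cast_pos.2 (Nat.pos_of_ne_zero (rank_ne_zero hB))
  have hb0 : 0 < b := hR.trans_le hb
  have hT1 : (1 : ℝ) ≤ T := by exact_mod_cast hT
  have hh : 0 < h := lt_of_lt_of_le (by positivity) ((le_max_right _ _).trans hlow)
  have hγ := gammaRes_rowIncoherence hB hdr h
  have hμ : rowIncoherence B ^ 2 * B.rank = dr * (rowNorm B / leastSingularValue B) ^ 2 := by
    rw [rowIncoherence, mul_pow, Real.sq_sqrt (by positivity)]
    field_simp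
  rw [rhoMin] at hmin
  set ρ := rhoParam dr dc B.rank (rowIncoherence B) α₂ h with hρ
  rw [rhoParam] at hρ
  set γ := gammaRes dr B.rank (rowIncoherence B) h
  have hγ0 : 0 < γ := by rw [hγ]; positivity
  have hρ32 : 32 ≤ ρ := (le_max_left _ _).trans ((le_max_left _ _).trans hmin)
  have hρexp : 16 * (dr * dc : ℝ) ^ 2 + Real.exp (dr * dc) ≤ ρ := by
    have h1 := (le_max_right _ _).trans ((le_max_left _ _).trans hmin)
    rw [div_div_eq_mul_div, div_one] at h1
    exact le_trans (le_mul_of_one_le_left (by positivity) (by linarith)) h1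
  have hρα₄ := (div_le_iff₀ (by positivity)).1
    ((le_max_left _ _).trans ((le_max_right _ _).trans hmin))
  have hργ : 16 * ((dr + dc) * B.rank) ≤ α₁ * γ ^ 2 * ρ := by
    have h1 : 16 * ((dr + dc) * B.rank) / α₁ ≤ ρ * γ ^ 2 := by
      have : (0 : ℝ) ≤ 32 * (dr * dc) * dc * dr / (rowIncoherence B ^ 2 * B.rank) := by positivity
      linarith
    have h2 := (div_le_iff₀ hα₁).1 h1
    linarith
  -- this is the bound from the second summand of `α₄`, as `γ² = (h / 64)² dr / (μ² r)`
  have hρh : 131072 * (dr * dc) * dc ≤ ρ * h ^ 2 := by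
    have h1 : 32 * (dr * dc) * dc * dr / (rowIncoherence B ^ 2 * B.rank) ≤ ρ * γ ^ 2 := by
      have : (0 : ℝ) ≤ 16 * ((dr + dc) * B.rank) / α₁ := by positivity
      linarith
    rw [hμ, hγ, div_le_iff₀ (by positivity)] at h1
    have h2 : ρ * (h * leastSingularValue B / (64 * rowNorm B)) ^ 2 *
        (dr * (rowNorm B / leastSingularValue B) ^ 2) = ρ * h ^ 2 / 4096 * dr := by
      field_simp
      norm_num
    rw [h2] at h1
    have h3 := le_of_mul_le_mul_right h1 (by linarith)
    linarith
  have hρα : α₂ * (1 + (γ ^ 2)⁻¹) * B.rank * (dr + dc) = ρ / 2 := by rw [hρ]; ring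
  have hlead : α₂ * b * (1 + 1 / γ ^ 2) * B.rank * (dr + dc) * Real.log T =
      b * ρ * Real.log T / 2 := by
    rw [one_div]
    linear_combination b * Real.log T * hρα
  have hgap : 0 ≤ ∑ a, armGap B a := Finset.sum_nonneg fun a _ => armGap_nonneg B a
  have hπ2 : 0 ≤ Real.pi ^ 2 / 3 - 1 := by nlinarith [Real.pi_gt_three]
  have hlast : 2 * ∑ a, armGap B a ≤ (1 + Real.pi ^ 2 / 3) * ∑ a, armGap B a := by nlinarith
  rw [hlead, ← Fintype.sum_prod_type (armGap B)]
  have hsq := Real.sqrt_nonneg (2 * T * nearOptimalCount B h * Real.log T)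
  have hlog0 := Real.log_nonneg hT1
  have hbρ : 0 ≤ b * ρ := by positivity
  rcases lt_or_ge (T : ℝ) ρ with hTρ | hTρ
  · have h1 := hE.regret_le_mul (B := B) hbandit.adapted hb T
    rcases hT.eq_or_lt with rfl | hT2
    -- the logarithm vanishes, but the regret of one period is at most `2 b*`
    · simp only [Nat.cast_one] at h1 hsq ⊢
      rw [Real.log_one]
      simp only [mul_zero, Real.sqrt_zero, zero_div]
      linarith
    · have h2 : (2 : ℝ) ≤ T := by exact_mod_cast hT2
      have h3 := (Real.log_two_gt_d9.le).trans (Real.log_le_log two_pos h2)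
      have h4 := mul_le_mul_of_nonneg_left h3 hbρ
      have h5 := mul_le_mul_of_nonneg_left hTρ.le hb0.le
      linarith
  · have hexp : Real.exp (dr * dc) ≤ T := by linarith [sq_nonneg (dr * dc : ℝ)]
    have hTK : ((dr * dc : ℕ) : ℝ) ≤ Real.log T := by
      rw [Nat.cast_mul]
      exact (Real.le_log_iff_exp_le (by linarith)).2 hexp
    have hexp0 := Real.exp_pos (dr * dc : ℝ)
    have hFρ : 2 + 4 * (dr * dc : ℝ) ≤ ρ := by
      have := mul_le_mul hK1 hK1 zero_le_one (by positivity)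
      nlinarith only [this, hK1, hρexp, hexp0]
    have h1 := hE.regret_le hρ32 hbandit hh a₀ (F := 2 + 4 * (dr * dc)) (by positivity)
      hFρ (fun t ht => hE.measure_forcedEstimate_error_le hbandit.forced a₀ hB hBbar
        hBhat hhat hh hρ32 hγ hα₁ hρα (by linarith) hργ hρh htail ht) hb hTρ hTK
    linarith
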